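/- **Setting.** Let $N$ be a lattice of rank $r\ge 2$, $M$ its dual, $N_\mathbb R=N\otimes\mathbb R$. Let $\Delta=(n_e)_{e\in E}$ be a finite family of at least three non-zero vectors of $N$ with $\sum_e n_e=0$, let $e_0\in E$, and let $\omega\in\Lambda^2M$ be an integral $2$-form with $\iota_{n_e}\omega=\omega(n_e,-)\neq0$ for every $e\in E$. A *rational tropical curve of degree $\Delta$* is a metric tree $\Gamma$ with all vertices of valency at least $3$ and with unbounded ends labelled by $E$, together with a map $h:\Gamma\to N_\mathbb R$ that is affine with slope in $N$ on each edge, has slope $n_e$ on the end $e$, and is balanced (the sum of the outgoing slopes is zero) at each vertex; curves are taken up to isometries compatible with $h$ and with the labels. The *moment* of the end $e$ is $\omega(n_e,p)$ for any $p\in h(e)$; the family of moments lies in $\mathfrak M=\{\mu\in\mathbb R^E:\sum_e\mu_e=0\}$. We also write $h(e_0)$ for the image of the end $e_0$, which is a point of $N_\mathbb R/\langle n_{e_0}\rangle$. For a trivalent vertex $V$ with outgoing slopes $a,b,c$ put $\pi_V=a\wedge b=b\wedge c=c\wedge a\in\Lambda^2N$ (defined up to sign), and let $K_\omega\subset\Lambda^2N$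 be spanned by the $\pi_V$ with $\omega(\pi_V)=0$, for all trivalent vertices $V$ of rational curves of degree $\Delta$. For a trivalent curve put $$B_\Gamma^{K_\omega}=\prod_V\left(q^{\pi_V}-q^{-\pi_V}\right)\in\mathbb Z[\Lambda^2N/K_\omega],$$ the sign of $\pi_V$ being chosen such that $\omega(\pi_V)>0$ (the factor is $0$ if $\omega(\pi_V)=0$). Let $\mu\in\mathfrak M$ and let $A\subset N_\mathbb R/\langle n_{e_0}\rangle$. The pair $(\mu,A)$ is *in general position* if every curve of degree $\Delta$ with moments $\mu$ and $h(e_0)\in A$ is trivalent, and the map recording the moments and $h(e_0)$ is injective on the cone of curves of its combinatorial type. A *tropical curve* $\Xi$ in $N_\mathbb R/\langle n_{e_0}\rangle$ is a finite balanced graph (of any genus) with bounded edges and unbounded ends, the slope of each edge being an element of $N/\langle n_{e_0}\rangle$ (the primitive direction times the weight); its *degree* is the multiset of slopes of its unbounded ends. If the affine hyperplane $\{\omega(n_{e_0},x)=t\}$ avoids the vertices of $\Xi$, its intersection index with $\Xi$ is $\sum|\omega(n_{e_0},\delta)|$ over the intersection points, $\delta$ being the slope of $\Xi$ at the point. The pair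 $(\mu,\Xi)$ is *generic* if it is in general position and the hyperplane $\{\omega(n_{e_0},x)=\mu_{e_0}\}$ avoids the vertices of $\Xi$. **Theorem.** There is an element $\mathcal B_\Delta^{\omega,e_0}\in\mathbb Z[\Lambda^2N/K_\omega]$ such that: 1. For every $\delta\in N/\langle n_{e_0}\rangle$ with $\omega(n_{e_0},\delta)\ne0$, every $\mu\in\mathfrak M$ and every line $D\subset N_\mathbb R/\langle n_{e_0}\rangle$ of slope $\delta$ such that $(\mu,D)$ is in general position, there are finitely many rational tropical curves $\Gamma$ of degree $\Delta$ with moments $\mu$ and $h(e_0)\in D$, and $\sum_\Gamma B_\Gamma^{K_\omega}=\mathcal B_\Delta^{\omega,e_0}$. Moreover, for fixed $\delta$, the pairs $(\mu,x)\in\mathfrak M\times N_\mathbb R/\langle n_{e_0}\rangle$ such that $\mu$ and the line of slope $\delta$ through $x$ are not in general position lie in finitely many proper affine subspaces. 2. For every tropical curve $\Xi$ in $N_\mathbb R/\langle n_{e_0}\rangle$, the intersection index $\omega\cdot\Xi$ of $\Xi$ with an affine hyperplane $\{\omega(n_{e_0},x)=t\}$ avoiding its vertices does not depend on $t$, and depends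 on $\Xi$ only through its degree. For every $\mu\in\mathfrak M$ such that $(\mu,\Xi)$ is generic, there are finitely many rational tropical curves $\Gamma$ of degree $\Delta$ with moments $\mu$ and $h(e_0)\in\Xi$, and $$\sum_{\Gamma}|\omega(n_{e_0},\delta_\Gamma)|\,B_\Gamma^{K_\omega}=(\omega\cdot\Xi)\,\mathcal B_\Delta^{\omega,e_0},$$ where $\delta_\Gamma$ is the slope of $\Xi$ at the point $h(e_0)$ (if several edges of $\Xi$ cross at this point, their contributions $|\omega(n_{e_0},\delta)|$ are added). In particular the count depends neither on $\mu$ nor on $\Xi$, except through the degree of $\Xi$. Moreover, for fixed $\Xi$, the pairs $(\mu,v)\in\mathfrak M\times N_\mathbb R/\langle n_{e_0}\rangle$ such that $(\mu,\Xi+v)$ is not generic lie in finitely many proper affine subspaces. -/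

import Mathlib

open scoped TensorProduct

noncomputable section

namespace OmegaProblem

/-! ### The lattice, its real span, and integral 2-forms -/

/-- The real vector space `N_ℝ = ℝ ⊗ N` spanned by a lattice `N`. -/
abbrev RealSpace (N : Type*) [AddCommGroup N] : Type _ := ℝ ⊗[ℤ] N

/-- The inclusion `N → N_ℝ`, `a ↦ 1 ⊗ a`. -/
def incl (N : Type*) [AddCommGroup N] : N →ₗ[ℤ] RealSpace N := TensorProduct.mk ℤ ℝ N 1

/-- The quotient space `N_ℝ / ⟨n⟩`, where the images of ends of slope `n` live. -/
abbrev EndSpace {N : Type*} [AddCommGroup N] (n : N) : Type _ :=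
  RealSpace N ⧸ Submodule.span ℝ {incl N n}

/-- The quotient `N / ⟨n⟩`, containing the slopes of lines and curves in `N_ℝ / ⟨n⟩`. -/
abbrev EndLattice {N : Type*} [AddCommGroup N] (n : N) : Type _ :=
  N ⧸ Submodule.span ℤ {n}

/-- The natural map `N / ⟨n⟩ → N_ℝ / ⟨n⟩`. -/
def endIncl {N : Type*} [AddCommGroup N] (n : N) : EndLattice n →ₗ[ℤ] EndSpace n :=
  Submodule.liftQ (Submodule.span ℤ {n})
    (((Submodule.span ℝ {incl N n}).mkQ.restrictScalars ℤ) ∘ₗ incl N)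
    (by
      rw [Submodule.span_le, Set.singleton_subset_iff]
      simp [Submodule.mem_span_singleton_self])

/-- A 2-form `ω ∈ Λ² M`, `M` being the dual of `N`: an alternating bilinear form on `N`
with integral values. -/
abbrev TwoForm (N : Type*) [AddCommGroup N] : Type _ := N [⋀^Fin 2]→ₗ[ℤ] ℤ

/-- The interior product `ι_a ω = ω(a, -)`. -/
def contract {N : Type*} [AddCommGroup N] (ω : TwoForm N) (a : N) : N →ₗ[ℤ] ℤ where
  toFun b := ω ![a, b]
  map_add' b c := by
    have key : ∀ x : N, Function.update ![a, 0] 1 x = ![a, x] := fun x => by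
      ext i; fin_cases i <;> rfl
    have h := ω.map_update_add ![a, 0] 1 b c
    rwa [key, key, key] at h
  map_smul' t b := by
    have key : ∀ x : N, Function.update ![a, 0] 1 x = ![a, x] := fun x => by
      ext i; fin_cases i <;> rfl
    have h := ω.map_update_smul ![a, 0] 1 t b
    rwa [key, key] at h

theorem contract_self {N : Type*} [AddCommGroup N] (ω : TwoForm N) (a : N) :
    contract ω a a = 0 :=
  ω.map_eq_zero_of_eq ![a, a] (i := 0) (j := 1) (by simp) (by decide)

/-- The real extension `N_ℝ → ℝ` of `ω(a, -)`. -/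
def realContract {N : Type*} [AddCommGroup N] (ω : TwoForm N) (a : N) : RealSpace N →ₗ[ℝ] ℝ :=
  ((Int.castAddHom ℝ).toIntLinearMap ∘ₗ contract ω a).liftBaseChange ℝ

theorem realContract_incl {N : Type*} [AddCommGroup N] (ω : TwoForm N) (a b : N) :
    realContract ω a (incl N b) = (ω ![a, b] : ℝ) := by
  change realContract ω a ((1 : ℝ) ⊗ₜ[ℤ] b) = _
  rw [realContract, LinearMap.liftBaseChange_tmul, one_smul]
  rfl

/-- The form `ω(n, -)` on `N / ⟨n⟩`. -/
def latticeForm {N : Type*} [AddCommGroup N] (ω : TwoForm N) (n : N) : EndLattice n →ₗ[ℤ] ℤ :=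
  Submodule.liftQ (Submodule.span ℤ {n}) (contract ω n)
    (by
      rw [Submodule.span_le, Set.singleton_subset_iff]
      exact contract_self ω n)

/-- The form `ω(n, -)` on `N_ℝ / ⟨n⟩`. -/
def spaceForm {N : Type*} [AddCommGroup N] (ω : TwoForm N) (n : N) : EndSpace n →ₗ[ℝ] ℝ :=
  Submodule.liftQ (Submodule.span ℝ {incl N n}) (realContract ω n)
    (by
      rw [Submodule.span_le, Set.singleton_subset_iff]
      have h := contract_self ω n
      have h' := realContract_incl ω n n
      change ω ![n, n] = 0 at h
      rw [h] at h'
      simpa using h')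

/-! ### Rational tropical curves with labelled ends -/

/-- The edges of a graph adjacent to the vertex `v`: the bounded edges `v w`, recorded by the
neighbour `w`, and the unbounded ends (labelled by `E`) attached to `v`. -/
abbrev Direction {E : Type*} {k : ℕ} (G : SimpleGraph (Fin k)) (att : E → Fin k)
    (v : Fin k) : Type _ :=
  {w : Fin k // G.Adj v w} ⊕ {e : E // att e = v}

open Classical in
/-- A parametrized rational tropical curve `h : Γ → N_ℝ` of degree `Δ`, with unbounded ends
labelled by `E`, the end `e` having slope `Δ e`. The underlying graph is a tree whose vertices
have valency at least three. On every bounded edge `h` is affine with slope in `N`; it is thus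
determined by the images of the vertices. Bounded edges may be contracted (slope `0`). -/
structure Curve {E N : Type*} [Fintype E] [AddCommGroup N] (Δ : E → N) where
  /-- the number of vertices -/
  numVert : ℕ
  /-- the graph of bounded edges -/
  graph : SimpleGraph (Fin numVert)
  isTree : graph.IsTree
  /-- the vertex to which an unbounded end is attached -/
  endVert : E → Fin numVert
  three_le_valence : ∀ v, 3 ≤ Nat.card (Direction graph endVert v)
  /-- the length of a bounded edge -/
  length : ∀ ⦃v w⦄, graph.Adj v w → ℝ
  length_pos : ∀ ⦃v w⦄ (hvw : graph.Adj v w), 0 < length hvw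
  length_symm : ∀ ⦃v w⦄ (hvw : graph.Adj v w), length hvw.symm = length hvw
  /-- the image of a vertex under `h` -/
  pos : Fin numVert → RealSpace N
  /-- the slope of `h` on the bounded edge `v w`, oriented from `v` to `w` -/
  slope : ∀ ⦃v w⦄, graph.Adj v w → N
  affine : ∀ ⦃v w⦄ (hvw : graph.Adj v w),
    pos w = pos v + length hvw • incl N (slope hvw)
  balanced : ∀ v, ∑ d : Direction graph endVert v,
    Sum.elim (fun w => slope w.2) (fun e => Δ e.1) d = 0

namespace Curve

variable {E N : Type*} [Fintype E] [AddCommGroup N] {Δ : E → N}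

/-- The edges (bounded or not) adjacent to a vertex. -/
abbrev Dir (c : Curve Δ) (v : Fin c.numVert) : Type _ := Direction c.graph c.endVert v

/-- The outgoing slopes at a vertex. -/
def outSlope (c : Curve Δ) (v : Fin c.numVert) : c.Dir v → N :=
  Sum.elim (fun w => c.slope w.2) (fun e => Δ e.1)

/-- The valency of a vertex. -/
def valence (c : Curve Δ) (v : Fin c.numVert) : ℕ := Nat.card (c.Dir v)

/-- All the vertices have valency three. -/
def Trivalent (c : Curve Δ) : Prop := ∀ v, c.valence v = 3

/-- Two curves have the same combinatorial type: the underlying graphs with labelled ends are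
isomorphic. -/
def SameType (c c' : Curve Δ) : Prop :=
  ∃ φ : c.graph ≃g c'.graph, ∀ e, c'.endVert e = φ (c.endVert e)

/-- Isomorphism of parametrized tropical curves with labelled ends: an isometry commuting with
the maps to `N_ℝ` and preserving the labels of the ends. -/
def Iso (c c' : Curve Δ) : Prop :=
  ∃ φ : c.graph ≃g c'.graph, (∀ e, c'.endVert e = φ (c.endVert e)) ∧
    (∀ ⦃v w⦄ (hvw : c.graph.Adj v w), c'.length (φ.map_adj_iff.2 hvw) = c.length hvw) ∧
    ∀ v, c'.pos (φ v) = c.pos v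

/-- The moment `ω(n_e, p)` of the end `e`, for `p` in the image of `e`. It does not depend on the
point `p`, which is taken to be the image of the vertex of `e`. -/
def moment (c : Curve Δ) (ω : TwoForm N) (e : E) : ℝ := realContract ω (Δ e) (c.pos (c.endVert e))

/-- The image `h(e)` of the end `e` in `N_ℝ / ⟨n_e⟩`. -/
def ev (c : Curve Δ) (e : E) : EndSpace (Δ e) :=
  (Submodule.span ℝ {incl N (Δ e)}).mkQ (c.pos (c.endVert e))

/-- On the cone of the moduli space which parametrizes the curves with the combinatorial type
of `c`, the evaluation map recording all the moments and the image of the end `e₀` is injective. -/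
def EvInjective (c : Curve Δ) (ω : TwoForm N) (e₀ : E) : Prop :=
  ∀ c₁ c₂ : Curve Δ, c.SameType c₁ → c.SameType c₂ →
    c₁.moment ω = c₂.moment ω → c₁.ev e₀ = c₂.ev e₀ → c₁.Iso c₂

end Curve

/-! ### Refined multiplicities -/

/-- The bivector `a ∧ b ∈ Λ² N`. -/
def wedge {N : Type*} [AddCommGroup N] (a b : N) : ⋀[ℤ]^2 N := exteriorPower.ιMulti ℤ 2 ![a, b]

/-- The sublattice `K_ω ⊆ Λ² N` spanned by the bivectors `π_V` with `ω(π_V) = 0`, where `V` runs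
through the trivalent vertices of rational curves of degree `Δ` and `π_V = a_V ∧ b_V` for two
of the outgoing slopes at `V`. -/
def kernelLattice {E N : Type*} [Fintype E] [AddCommGroup N] (Δ : E → N) (ω : TwoForm N) :
    Submodule ℤ (⋀[ℤ]^2 N) :=
  Submodule.span ℤ {π | ∃ (c : Curve Δ) (v : Fin c.numVert) (i j : c.Dir v),
    c.valence v = 3 ∧ i ≠ j ∧ ω ![c.outSlope v i, c.outSlope v j] = 0 ∧
    π = wedge (c.outSlope v i) (c.outSlope v j)}

/-- The ring `ℤ[Λ² N / K_ω]`. -/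
abbrev RefinedRing {E N : Type*} [Fintype E] [AddCommGroup N] (Δ : E → N) (ω : TwoForm N) :
    Type _ :=
  AddMonoidAlgebra ℤ (⋀[ℤ]^2 N ⧸ kernelLattice Δ ω)

/-- The monomial `q^π ∈ ℤ[Λ² N / K_ω]`. -/
def qPow {E N : Type*} [Fintype E] [AddCommGroup N] (Δ : E → N) (ω : TwoForm N)
    (π : ⋀[ℤ]^2 N) : RefinedRing Δ ω :=
  AddMonoidAlgebra.single ((kernelLattice Δ ω).mkQ π) 1

namespace Curve

variable {E N : Type*} [Fintype E] [AddCommGroup N] {Δ : E → N}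

open Classical in
/-- The factor `q^{π_V} - q^{-π_V}` of a vertex `V`, where `π_V = a ∧ b` for two of the outgoing
slopes chosen such that `ω(a, b) > 0`; the factor is `0` if there is no such choice. At a
trivalent vertex, the bivector `π_V` does not depend on the choice by the balancing condition. -/
def vertexFactor (c : Curve Δ) (ω : TwoForm N) (v : Fin c.numVert) : RefinedRing Δ ω :=
  if h : ∃ p : c.Dir v × c.Dir v, 0 < ω ![c.outSlope v p.1, c.outSlope v p.2] then
    qPow Δ ω (wedge (c.outSlope v h.choose.1) (c.outSlope v h.choose.2)) -
      qPow Δ ω (-wedge (c.outSlope v h.choose.1) (c.outSlope v h.choose.2))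
  else 0

/-- The refined multiplicity `B_Γ^{K_ω}`. -/
def refinedMult (c : Curve Δ) (ω : TwoForm N) : RefinedRing Δ ω := ∏ v, c.vertexFactor ω v

end Curve

/-- `HasCount sol m b`: up to isomorphism, there are finitely many curves satisfying `sol`, and
the sum of their multiplicities `m` is `b`. -/
def HasCount {E N : Type*} [Fintype E] [AddCommGroup N] {Δ : E → N} {R : Type*}
    [AddCommMonoid R] (sol : Curve Δ → Prop) (m : Curve Δ → R) (b : R) : Prop :=
  ∃ S : Finset (Curve Δ), (∀ c ∈ S, sol c) ∧ (∀ c, sol c → ∃! s, s ∈ S ∧ c.Iso s) ∧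
    ∑ c ∈ S, m c = b

/-! ### Constraints -/

/-- The space of families of moments `μ ∈ ℝ^Δ` with `∑ μ_e = 0`. -/
def momentSpace (E : Type*) [Fintype E] : Submodule ℝ (E → ℝ) where
  carrier := {μ | ∑ e, μ e = 0}
  add_mem' {a b} ha hb := by
    simp only [Set.mem_ofPred_eq] at ha hb ⊢
    simp [Finset.sum_add_distrib, ha, hb]
  zero_mem' := by simp
  smul_mem' t a ha := by
    simp only [Set.mem_ofPred_eq] at ha ⊢
    simp [← Finset.mul_sum, ha]

/-- The curves of degree `Δ` with family of moments `μ` whose end `e₀` has its image in the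
subset `A` of `N_ℝ / ⟨n_{e₀}⟩`. -/
def Solves {E N : Type*} [Fintype E] [AddCommGroup N] {Δ : E → N} (ω : TwoForm N) (e₀ : E)
    (μ : E → ℝ) (A : Set (EndSpace (Δ e₀))) (c : Curve Δ) : Prop :=
  c.moment ω = μ ∧ c.ev e₀ ∈ A

/-- The constraints `(μ, A)` avoid the images of the cones of the moduli space that are not
top-dimensional, and of those on which the evaluation map is not injective. -/
def GeneralPosition {E N : Type*} [Fintype E] [AddCommGroup N] (Δ : E → N) (ω : TwoForm N)
    (e₀ : E) (μ : E → ℝ) (A : Set (EndSpace (Δ e₀))) : Prop :=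
  ∀ c : Curve Δ, Solves ω e₀ μ A c → c.Trivalent ∧ c.EvInjective ω e₀

/-- The line `D` through `x` with slope `δ` in `N_ℝ / ⟨n⟩`. -/
def line {N : Type*} [AddCommGroup N] (n : N) (x : EndSpace n) (δ : EndLattice n) :
    Set (EndSpace n) :=
  {y | ∃ t : ℝ, y = x + t • endIncl n δ}

/-- A property of the points of a finite-dimensional real vector space holds generically if it
holds outside finitely many proper affine subspaces. -/
def HoldsGenerically {W : Type*} [AddCommGroup W] [Module ℝ W] (P : W → Prop) : Prop :=
  ∃ S : Finset (AffineSubspace ℝ W), (∀ A ∈ S, A ≠ ⊤) ∧ ∀ w, ¬ P w → ∃ A ∈ S, w ∈ A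

open Classical in
/-- A tropical curve (tropical cycle of dimension one, of any genus, connected or not) in
`N_ℝ / ⟨n⟩`: finitely many vertices, bounded edges between them and unbounded ends. The slope of
an edge is the primitive integral vector directing it times its weight, and the sum of the
outgoing slopes at every vertex vanishes. Two-valent vertices are allowed, so that a line is a
tropical curve. Edges may meet outside of the vertices. -/
structure TropicalCurve {N : Type*} [AddCommGroup N] (n : N) where
  numVert : ℕ
  numBounded : ℕ
  numEnds : ℕ
  /-- the position of a vertex -/
  pos : Fin numVert → EndSpace n
  /-- the origin of a bounded edge, for an orientation chosen arbitrarily -/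
  src : Fin numBounded → Fin numVert
  /-- the target of a bounded edge -/
  tgt : Fin numBounded → Fin numVert
  /-- the length of a bounded edge -/
  length : Fin numBounded → ℝ
  length_pos : ∀ b, 0 < length b
  /-- the slope of a bounded edge, oriented from `src` to `tgt` -/
  slope : Fin numBounded → EndLattice n
  affine : ∀ b, pos (tgt b) = pos (src b) + length b • endIncl n (slope b)
  /-- the vertex of an unbounded end -/
  root : Fin numEnds → Fin numVert
  /-- the outgoing slope of an unbounded end -/
  endSlope : Fin numEnds → EndLattice n
  balanced : ∀ v, (∑ b with src b = v, endIncl n (slope b)) -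
    (∑ b with tgt b = v, endIncl n (slope b)) + (∑ e with root e = v, endIncl n (endSlope e)) = 0

namespace TropicalCurve

variable {N : Type*} [AddCommGroup N] {n : N}

/-- The edges, bounded or not. -/
abbrev Edge (Ξ : TropicalCurve n) : Type := Fin Ξ.numBounded ⊕ Fin Ξ.numEnds

/-- The slope of an edge. -/
def edgeSlope (Ξ : TropicalCurve n) : Ξ.Edge → EndLattice n := Sum.elim Ξ.slope Ξ.endSlope

/-- The segment or half-line carried by an edge. -/
def carrier (Ξ : TropicalCurve n) : Ξ.Edge → Set (EndSpace n) :=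
  Sum.elim
    (fun b => {x | ∃ t : ℝ, 0 ≤ t ∧ t ≤ Ξ.length b ∧
      x = Ξ.pos (Ξ.src b) + t • endIncl n (Ξ.slope b)})
    (fun e => {x | ∃ t : ℝ, 0 ≤ t ∧ x = Ξ.pos (Ξ.root e) + t • endIncl n (Ξ.endSlope e)})

/-- The set of points of the curve. -/
def support (Ξ : TropicalCurve n) : Set (EndSpace n) := Set.range Ξ.pos ∪ ⋃ ε, Ξ.carrier ε

/-- The degree: the multiset of slopes of the unbounded ends. -/
def degree (Ξ : TropicalCurve n) : Multiset (EndLattice n) := Finset.univ.val.map Ξ.endSlope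

/-- The translate of the curve by a vector. -/
def translate (Ξ : TropicalCurve n) (u : EndSpace n) : TropicalCurve n where
  __ := Ξ
  pos v := Ξ.pos v + u
  affine b := by rw [Ξ.affine b]; abel

/-- The hyperplane `ω(n, x) = t` meets the curve outside of its vertices, thus transversally. -/
def Transverse (Ξ : TropicalCurve n) (ω : TwoForm N) (t : ℝ) : Prop :=
  ∀ v, spaceForm ω n (Ξ.pos v) ≠ t

open Classical in
/-- The intersection index of the curve with the hyperplane `ω(n, x) = t` transverse to it: every
edge meeting the hyperplane does so in a unique point, which contributes `|ω(n, δ)|`, where `δ` is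
the slope of the edge. -/
def hyperplaneIndex (Ξ : TropicalCurve n) (ω : TwoForm N) (t : ℝ) : ℕ :=
  ∑ ε with ∃ x ∈ Ξ.carrier ε, spaceForm ω n x = t, (latticeForm ω n (Ξ.edgeSlope ε)).natAbs

open Classical in
/-- The weight `|ω(n, δ)|` of a point `x` of the curve, where `δ` is the slope of the edge that
contains `x`; if several edges cross at `x`, their contributions are added. -/
def slopeWeight (Ξ : TropicalCurve n) (ω : TwoForm N) (x : EndSpace n) : ℕ :=
  ∑ ε with x ∈ Ξ.carrier ε, (latticeForm ω n (Ξ.edgeSlope ε)).natAbs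

end TropicalCurve

/-- The pair `(μ, Ξ)` is generic: the constraints are in general position, and the hyperplane
which contains the images of the end `e₀` avoids the vertices of `Ξ`. -/
def GenericCurve {E N : Type*} [Fintype E] [AddCommGroup N] (Δ : E → N) (ω : TwoForm N)
    (e₀ : E) (μ : E → ℝ) (Ξ : TropicalCurve (Δ e₀)) : Prop :=
  Ξ.Transverse ω (μ e₀) ∧ GeneralPosition Δ ω e₀ μ Ξ.support

end OmegaProblem

end

/-!
Let `μ` be a family of moments. The end `e₀` of a curve with moments `μ` is mapped to a point of
the hyperplane `{ω(n_{e₀}, x) = μ_{e₀}}`. A line of slope `δ` meets this hyperplane in one point,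
and a tropical curve `Ξ` without vertices on it meets it in finitely many points, whose total
weight is the intersection index (`TropicalCurve.exists_finset_inter`). Hence both counts are sums,
over finitely many points `x`, of the number of curves with moments `μ` and `h(e₀) = x`
(`hasCount_of_finset`), and it is enough to show that this number is always the same. The
intersection index itself is constant because of the balancing condition
(`TropicalCurve.hyperplaneIndex_eq`).

*From curves to flow trees.* Root a curve at `e₀`. The edge above a vertex `V` separates `e₀` from
a set of ends, the cluster of `V`, and the clusters form a laminar family which determines the
combinatorial type (`Curve.sameType_of_clusters_eq`, `IsClusterFamily.exists_curve`). By balancing,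
the slope of an edge is the sum `n_J` of the slopes of the ends of its cluster `J`. Follow the curve
from the root, starting at a point `p` above `x`, and record the defects `y_e = μ_e - ω(n_e, p)`.
Along an edge with cluster `J` they move linearly in the direction `-ω(n_e, n_J)`, and a vertex
where `J` splits into `A` and `B` is reached when the sum of the `y_e` over `A` is zero. So the
defects at `p` and the clusters determine all the lengths, and curves become binary trees with
leaves labelled by the ends other than `e₀` for which the lengths so computed are positive
(`Curve.exists_tree`, `exists_curve_of_tree`). The multiplicity of the curve is the product of the
commutators `q^{n_A ∧ n_B} - q^{n_B ∧ n_A}` over the vertices of the tree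
(`Curve.refinedMult_eq_mult`).

*The number of flow trees is constant.* Suppose first that no `ω(n_A, n_B)` with `A` and `B`
disjoint is zero, and that the defects satisfy no rational relation besides the obvious one. The
sum over the trees which start at a given point of a flow line satisfies a recursion: it is zero
behind the last wall, and it jumps at each wall `y(L) = 0` by the commutator times the product of
the sums for the two branches. The chain sums `∑ b(I \ K₁) b(K₁ \ K₂) ⋯ b(Kₘ)` over chains of
subsets with `y(Kⱼ) < 0`, twisted by the powers of `q`, jump in the same way
(`chainSum_sub_eq_sum_jumps`), thanks to the associativity of the twisted product, and their
coefficients `b` can be chosen so that the values behind the last wall agree as well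
(`exists_chainSum_eq`, `treeSum_eq_chainSum`). The sum over all the trees on a flow line is then
the difference of the values of a chain sum at the two ends of the line. These values only depend
on the direction of the line, not on the line (`topTreeSum_const`).

*Degenerate forms.* In general both `ω` and the defects are perturbed. In general position the set
of flow trees does not change under a small perturbation, apart from the trees with a vertex where
`ω(n_A, n_B) = 0`. Those do not contribute, since every such bivector `n_A ∧ n_B` occurs at a vertex
of some curve, hence lies in `K_ω`, and its commutator vanishes in `ℤ[Λ²N / K_ω]`
(`wedge_mem_kernelLattice`, `eventually_topTreeSum_eq`, `exists_topTreeSum_eq`).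

*General position.* The curves of a given type are the points of an open cone of a vector space on
which the moments and `h(e₀)` are linear. Counting dimensions, if the type is not trivalent or if
this map is not injective, then its image does not contain the space of all the pairs `(μ, x)`
with `∑ μ_e = 0` and `ω(n_{e₀}, x) = μ_{e₀}` (`Curve.exists_notMem_range`). There are finitely many
types, and pulling their images back along the projection onto the hyperplane in the direction of a
slope gives the finitely many proper affine subspaces.
-/

noncomputable section

namespace OmegaProblem

/-! ### Sums over chains of subsets, and their jumps along a line -/

section FlowTrees

variable {ι R : Type*} [DecidableEq ι] [CommRing R]

/-- The proper non-empty subsets of a finite set. -/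
def properParts (I : Finset ι) : Finset (Finset ι) := I.ssubsets.filter Finset.Nonempty

theorem mem_properParts {I K : Finset ι} : K ∈ properParts I ↔ K ⊂ I ∧ K.Nonempty := by
  simp [properParts]

theorem properParts_sdiff {I K : Finset ι} (h : K ∈ properParts I) : I \ K ∈ properParts I := by
  rw [mem_properParts] at h ⊢
  refine ⟨Finset.sdiff_ssubset h.1.1 h.2, ?_⟩
  rw [Finset.sdiff_nonempty]
  exact h.1.2

theorem properParts_card_lt {I K : Finset ι} (h : K ∈ properParts I) : K.card < I.card :=
  Finset.card_lt_card (mem_properParts.1 h).1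

theorem properParts_trans {I K L : Finset ι} (h : K ∈ properParts I) (h' : L ∈ properParts K) :
    L ∈ properParts I := by
  rw [mem_properParts] at h h' ⊢
  exact ⟨h'.1.trans h.1, h'.2⟩

theorem sum_sdiff_part (f : ι → ℝ) {I K : Finset ι} (h : K ⊆ I) :
    ∑ i ∈ I \ K, f i = ∑ i ∈ I, f i - ∑ i ∈ K, f i := by
  rw [← Finset.sum_sdiff h]; ring

/-- The sum over the chains `I = K₀ ⊃ K₁ ⊃ ⋯ ⊃ Kₘ ≠ ∅` with `z(Kⱼ) < 0` for `j ≥ 1`, weighted by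
`b` on the successive differences and by the commutation factors `Q`. -/
def chainSum (Q : Finset ι → Finset ι → R) (b : Finset ι → R) (z : ι → ℝ) (I : Finset ι) : R :=
  b I + ∑ K ∈ (properParts I).attach,
    if ∑ i ∈ K.1, z i < 0 then Q (I \ K.1) K.1 * b (I \ K.1) * chainSum Q b z K.1 else 0
termination_by I.card
decreasing_by exact properParts_card_lt K.2

theorem chainSum_eq (Q : Finset ι → Finset ι → R) (b : Finset ι → R) (z : ι → ℝ) (I : Finset ι) :
    chainSum Q b z I = b I + ∑ K ∈ properParts I,
      if ∑ i ∈ K, z i < 0 then Q (I \ K) K * b (I \ K) * chainSum Q b z K else 0 := by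
  rw [chainSum]
  congr 1
  exact Finset.sum_attach (properParts I) (fun K => if ∑ i ∈ K, z i < 0 then
    Q (I \ K) K * b (I \ K) * chainSum Q b z K else 0)

theorem chainSum_congr (Q : Finset ι → Finset ι → R) {b b' : Finset ι → R} {z z' : ι → ℝ}
    (I : Finset ι) (hb : ∀ K ⊆ I, b K = b' K)
    (hz : ∀ K ∈ properParts I, (∑ i ∈ K, z i < 0 ↔ ∑ i ∈ K, z' i < 0)) :
    chainSum Q b z I = chainSum Q b' z' I := by
  induction' hn : I.card using Nat.strong_induction_on with n ih generalizing I
  rw [chainSum_eq, chainSum_eq, hb I subset_rfl]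
  congr 1
  refine Finset.sum_congr rfl fun K hK => ?_
  rw [ih K.card (hn ▸ properParts_card_lt hK) K
    (fun L hL => hb L (hL.trans (mem_properParts.1 hK).1.1))
    (fun L hL => hz L (properParts_trans hK hL)) rfl, hb _ Finset.sdiff_subset]
  simp only [hz K hK]

/-- The value `b I` may be chosen freely, and the other terms of the chain sum over `I` only
involve smaller subsets: chain sums with given values at given points exist. -/
theorem exists_chainSum_eq (Q : Finset ι → Finset ι → R) (z : Finset ι → ι → ℝ)
    (a : Finset ι → R) (n : ℕ) :
    ∃ b : Finset ι → R, ∀ I : Finset ι, I.card ≤ n → chainSum Q b (z I) I = a I := by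
  induction n with
  | zero =>
    refine ⟨a, fun I hI => ?_⟩
    obtain rfl : I = ∅ := by simpa using hI
    have h : properParts (∅ : Finset ι) = ∅ := Finset.eq_empty_of_forall_notMem fun K hK => by
      have := properParts_card_lt hK
      simp at this
    rw [chainSum_eq, h]
    simp
  | succ n ih =>
    obtain ⟨b, hb⟩ := ih
    refine ⟨fun I => if I.card ≤ n then b I else
      a I - (chainSum Q b (z I) I - b I), fun I hI => ?_⟩
    rcases Nat.lt_or_ge n I.card with h | h
    · rw [chainSum_eq, if_neg (by omega), chainSum_eq Q b]
      rw [add_sub_cancel_left, sub_add_eq_add_sub, sub_eq_iff_eq_add]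
      congr 1
      refine Finset.sum_congr rfl fun K hK => ?_
      have h1 := properParts_card_lt hK
      have h2 := properParts_card_lt (properParts_sdiff hK)
      rw [if_pos (show (I \ K).card ≤ n by omega),
        chainSum_congr Q (b' := b) (z' := z I) K (fun L hL => ?_) (fun _ _ => Iff.rfl)]
      have := Finset.card_le_card hL
      rw [if_pos (show L.card ≤ n by omega)]
    · rw [← hb I h]
      refine chainSum_congr Q I (fun L hL => ?_) (fun _ _ => Iff.rfl)
      have := Finset.card_le_card hL
      rw [if_pos (by omega)]

/-- The time at which the line `t ↦ z + t g` meets the wall `z(K) = 0` of `K`; it is meaningful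
only if `g(K)` is not zero. -/
def wallTime (z g : ι → ℝ) (K : Finset ι) : ℝ := -(∑ i ∈ K, z i) / ∑ i ∈ K, g i

theorem sum_at {ι : Type*} (z g : ι → ℝ) (t : ℝ) (K : Finset ι) :
    ∑ i ∈ K, (z i + t * g i) = ∑ i ∈ K, z i + t * ∑ i ∈ K, g i := by
  rw [Finset.sum_add_distrib, Finset.mul_sum]

theorem sum_at_wallTime {ι : Type*} (z g : ι → ℝ) {K : Finset ι} (h : ∑ i ∈ K, g i ≠ 0) :
    ∑ i ∈ K, (z i + wallTime z g K * g i) = 0 := by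
  rw [sum_at, wallTime]
  field_simp
  ring

/-- The direction, as a sign in `R`, in which the line `t ↦ z + t g` crosses the wall of `K`. -/
def crossSign (R : Type*) [CommRing R] (g : ι → ℝ) (K : Finset ι) : R :=
  if ∑ i ∈ K, g i < 0 then 1 else -1

/-- The indicator of `z(K) + t g(K) < 0` as a function of `t`: it is the value at `t = -∞`,
corrected by the crossing sign after the crossing of the wall. -/
theorem indicator_at {ι R : Type*} [CommRing R] (z g : ι → ℝ) {K : Finset ι} {t : ℝ}
    (h : ∑ i ∈ K, g i ≠ 0) (ht : t ≠ wallTime z g K) :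
    (if ∑ i ∈ K, (z i + t * g i) < 0 then (1 : R) else 0) =
      (if ∑ i ∈ K, -g i < 0 then 1 else 0) +
        if wallTime z g K < t then crossSign R g K else 0 := by
  rw [sum_at, Finset.sum_neg_distrib, crossSign]
  rw [wallTime] at *
  generalize ∑ i ∈ K, z i = a at *
  generalize ∑ i ∈ K, g i = c at *
  rcases lt_or_gt_of_ne h with hc | hc
  · have e : a + t * c < 0 ↔ -a / c < t := by
      rw [div_lt_iff_of_neg hc]
      constructor <;> intro h <;> linarith
    rw [if_neg (show ¬ -c < 0 by linarith), if_pos hc, zero_add]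
    simp only [e]
  · have e : a + t * c < 0 ↔ ¬ -a / c < t := by
      rw [div_lt_iff₀ hc]
      have : t * c ≠ -a := by
        intro h'
        exact ht (by rw [← h']; field_simp)
      constructor
      · intro h; linarith
      · intro h; exact lt_of_le_of_ne (by linarith) (fun h' => this (by linarith))
    rw [if_pos (show -c < 0 by linarith), if_neg (show ¬ c < 0 by linarith)]
    simp only [e]
    split_ifs <;> simp

/-- The chain sum over `I \ L` at a point of the wall of `L`, in terms of the subsets of `I`
that contain `L`. -/
theorem chainSum_sdiff (Q : Finset ι → Finset ι → R) (b : Finset ι → R) (z : ι → ℝ)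
    {I L : Finset ι} (hL : L ∈ properParts I) (h0 : ∑ i ∈ L, z i = 0) :
    chainSum Q b z (I \ L) = b (I \ L) + ∑ K ∈ (properParts I).filter (L ∈ properParts ·),
      if ∑ i ∈ K, z i < 0 then Q (I \ K) (K \ L) * b (I \ K) * chainSum Q b z (K \ L)
      else 0 := by
  rw [chainSum_eq]
  congr 1
  rw [mem_properParts] at hL
  have e : ∀ K, L ⊆ K → ∑ i ∈ K \ L, z i = ∑ i ∈ K, z i := fun K hK => by
    rw [sum_sdiff_part _ hK, h0, sub_zero]
  refine Finset.sum_bij' (fun K _ => K ∪ L) (fun K _ => K \ L) ?_ ?_ ?_ ?_ ?_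
  · intro K hK
    rw [mem_properParts] at hK
    have hd : Disjoint K L := Finset.disjoint_of_subset_left hK.1.1 Finset.sdiff_disjoint
    rw [Finset.mem_filter, mem_properParts, mem_properParts]
    obtain ⟨x, hx, hx'⟩ := Finset.exists_of_ssubset hK.1
    obtain ⟨k, hk⟩ := hK.2
    refine ⟨⟨⟨Finset.union_subset (hK.1.1.trans Finset.sdiff_subset) hL.1.1, fun h => ?_⟩,
      ⟨k, Finset.mem_union_left _ hk⟩⟩, ⟨Finset.subset_union_right, fun h => ?_⟩, hL.2⟩
    · rw [Finset.mem_sdiff] at hx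
      have := h hx.1
      rw [Finset.mem_union] at this
      tauto
    · exact Finset.disjoint_left.1 hd hk (h (Finset.mem_union_left _ hk))
  · intro K hK
    simp only [Finset.mem_filter, mem_properParts] at hK
    rw [mem_properParts]
    obtain ⟨x, hx, hx'⟩ := Finset.exists_of_ssubset hK.1.1
    refine ⟨⟨Finset.sdiff_subset_sdiff hK.1.1.1 subset_rfl, fun h => hx' ?_⟩, ?_⟩
    · have := h (Finset.mem_sdiff.2 ⟨hx, fun h' => hx' (hK.2.1.1 h')⟩)
      exact (Finset.mem_sdiff.1 this).1
    · rw [Finset.sdiff_nonempty]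
      exact hK.2.1.2
  · intro K hK
    rw [mem_properParts] at hK
    have hd : Disjoint K L := Finset.disjoint_of_subset_left hK.1.1 Finset.sdiff_disjoint
    simp only [Finset.union_sdiff_right]
    exact Finset.sdiff_eq_self_of_disjoint hd
  · intro K hK
    simp only [Finset.mem_filter, mem_properParts] at hK
    exact Finset.sdiff_union_of_subset hK.2.1.1
  · intro K hK
    rw [mem_properParts] at hK
    have hd : Disjoint K L := Finset.disjoint_of_subset_left hK.1.1 Finset.sdiff_disjoint
    have e1 : (K ∪ L) \ L = K := by
      rw [Finset.union_sdiff_right]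
      exact Finset.sdiff_eq_self_of_disjoint hd
    have e2 : I \ (K ∪ L) = (I \ L) \ K := by
      rw [Finset.union_comm, sdiff_sdiff_left, Finset.sup_eq_union]
    rw [← e (K ∪ L) Finset.subset_union_right, e1, e2]

/-- The cocycle relation, which expresses the associativity of the twisted group algebra whose
commutation factors are given by `Q`. -/
def IsCocycle (Q : Finset ι → Finset ι → R) : Prop :=
  ∀ A B C : Finset ι, Disjoint A B → Disjoint A C → Disjoint B C →
    Q A (B ∪ C) * Q B C = Q (A ∪ B) C * Q A B

/-- The jumps of a chain sum along a line: crossing the wall of `L` contributes the product of the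
chain sums of `I \ L` and `L`, taken at the point of crossing. The point `-g` stands for the
beginning of the line, since `z + t g` lies on the same sides of all the walls as `-g` when `t` is
close to `-∞`. -/
theorem chainSum_sub_eq_sum_jumps (Q : Finset ι → Finset ι → R) (hQ : IsCocycle Q)
    (b : Finset ι → R) (z g : ι → ℝ) (I : Finset ι) (hg : ∀ K ∈ properParts I, ∑ i ∈ K, g i ≠ 0)
    (hd : ∀ K ∈ properParts I, ∀ L ∈ properParts K, wallTime z g L ≠ wallTime z g K)
    (t : ℝ) (ht : ∀ K ∈ properParts I, t ≠ wallTime z g K) :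
    chainSum Q b (fun i => z i + t * g i) I - chainSum Q b (fun i => -g i) I =
      ∑ L ∈ properParts I, if wallTime z g L < t then
        crossSign R g L * Q (I \ L) L *
          chainSum Q b (fun i => z i + wallTime z g L * g i) (I \ L) *
          chainSum Q b (fun i => z i + wallTime z g L * g i) L else 0 := by
  induction' hn : I.card using Nat.strong_induction_on with n ih generalizing I t
  set J : Finset ι → Finset ι → R := fun K L => crossSign R g L * Q (K \ L) L *
          chainSum Q b (fun i => z i + wallTime z g L * g i) (K \ L) *
          chainSum Q b (fun i => z i + wallTime z g L * g i) L with hJ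
  set H : ℝ → Finset ι → R := fun t K => chainSum Q b (fun i => z i + t * g i) K with hH
  set H0 : Finset ι → R := fun K => chainSum Q b (fun i => -g i) K with hH0
  set h0 : Finset ι → R := fun K => if ∑ i ∈ K, -g i < 0 then 1 else 0 with hh0
  set W : Finset ι → R := fun K => Q (I \ K) K * b (I \ K) with hW
  have ih' : ∀ K ∈ properParts I, ∀ s : ℝ, (∀ L ∈ properParts K, s ≠ wallTime z g L) →
      H s K - H0 K = ∑ L ∈ properParts K, if wallTime z g L < s then J K L else 0 :=
    fun K hK s hs => ih K.card (hn ▸ properParts_card_lt hK) K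
      (fun L hL => hg L (properParts_trans hK hL))
      (fun L hL => hd L (properParts_trans hK hL)) s hs rfl
  have mulind : ∀ (P : Prop) [Decidable P] (x : R),
      (if P then x else 0) = (if P then 1 else 0) * x := by
    intro P _ x; split_ifs <;> simp
  -- The terms of the two chain sums which start with `I ⊃ K`, by induction: the chain sum over `K`
  -- jumps at the walls of `L ⊂ K`, and the condition on `K` itself at the wall of `K`.
  have eI : H t I - H0 I = ∑ K ∈ properParts I, W K *
      (h0 K * (∑ L ∈ properParts K, if wallTime z g L < t then J K L else 0) +
        (if wallTime z g K < t then crossSign R g K else 0) * H t K) := by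
    simp only [hH, hH0]
    rw [chainSum_eq, chainSum_eq, add_sub_add_left_eq_sub, ← Finset.sum_sub_distrib]
    refine Finset.sum_congr rfl fun K hK => ?_
    rw [← ih' K hK t (fun L hL => ht L (properParts_trans hK hL))]
    rw [mulind, mulind (∑ i ∈ K, -g i < 0), indicator_at z g (hg K hK) (ht K hK)]
    simp only [hH, hH0, hh0, hW]
    ring
  -- The jump at the wall of `L`, with the chain sum over `I \ L` expanded. The subsets of `I \ L`
  -- are written `K \ L` with `L ⊂ K`, and the cocycle relation makes the jump of `K` at `L` appear.
  have eL : ∀ L ∈ properParts I, J I L = crossSign R g L * W L * H (wallTime z g L) L +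
      ∑ K ∈ (properParts I).filter (L ∈ properParts ·),
        (h0 K + if wallTime z g K < wallTime z g L then crossSign R g K else 0) * W K *
          J K L := by
    intro L hL
    simp only [hJ]
    rw [chainSum_sdiff Q b _ hL (sum_at_wallTime z g (hg L hL))]
    rw [mul_add, add_mul]
    congr 1
    · simp only [hH, hW]; ring
    · rw [Finset.mul_sum, Finset.sum_mul]
      refine Finset.sum_congr rfl fun K hK => ?_
      rw [Finset.mem_filter] at hK
      rw [mulind, indicator_at z g (hg K hK.1) (hd K hK.1 L hK.2)]
      have hKI := (mem_properParts.1 hK.1).1.1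
      have hLK := (mem_properParts.1 hK.2).1.1
      have q := hQ (I \ K) (K \ L) L
        (Finset.disjoint_of_subset_right Finset.sdiff_subset Finset.sdiff_disjoint)
        (Finset.disjoint_of_subset_right hLK Finset.sdiff_disjoint) Finset.sdiff_disjoint
      rw [Finset.sdiff_union_of_subset hLK, Finset.sdiff_union_sdiff_cancel hKI hLK] at q
      simp only [hW, hh0]
      linear_combination (-((if ∑ i ∈ K, -g i < 0 then (1 : R) else 0) +
        if wallTime z g K < wallTime z g L then crossSign R g K else 0) * b (I \ K) *
        crossSign R g L * chainSum Q b (fun i => z i + wallTime z g L * g i) (K \ L) *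
        chainSum Q b (fun i => z i + wallTime z g L * g i) L) * q
  change H t I - H0 I = ∑ L ∈ properParts I, if wallTime z g L < t then J I L else 0
  rw [eI]
  -- Exchange the sums over `L` and `K`, in order to compare the two sides for each `K`.
  have e3 : (∑ L ∈ properParts I, if wallTime z g L < t then J I L else 0) =
      ∑ L ∈ properParts I, (if wallTime z g L < t then
        crossSign R g L * W L * H (wallTime z g L) L else 0) +
      ∑ K ∈ properParts I, ∑ L ∈ properParts K, (if wallTime z g L < t then
        (h0 K + if wallTime z g K < wallTime z g L then crossSign R g K else 0) * W K *
          J K L else 0) := by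
    rw [Finset.sum_comm' (s := properParts I) (t := properParts) (t' := properParts I)
      (s' := fun L => (properParts I).filter (L ∈ properParts ·)), ← Finset.sum_add_distrib]
    · refine Finset.sum_congr rfl fun L hL => ?_
      rw [eL L hL]
      split_ifs
      · rfl
      · simp
    · intro K L
      rw [Finset.mem_filter]
      exact ⟨fun h => ⟨h, properParts_trans h.1 h.2⟩, fun h => h.1⟩
  rw [e3, ← Finset.sum_add_distrib]
  refine Finset.sum_congr rfl fun K hK => ?_
  -- Before the wall of `K` both sides are equal. After it, the left side contains the chain sum at
  -- time `t` and the right side the one at the crossing of the wall of `K`: the difference is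
  -- made up of the jumps at the walls of the `L ⊂ K` which are crossed in between.
  by_cases hKt : wallTime z g K < t
  · have i1 := ih' K hK t (fun L hL => ht L (properParts_trans hK hL))
    have i2 := ih' K hK (wallTime z g K) (fun L hL => (hd K hK L hL).symm)
    rw [if_pos hKt, if_pos hKt]
    have : H t K = H (wallTime z g K) K + ∑ L ∈ properParts K, if wallTime z g L < t then
        (if wallTime z g K < wallTime z g L then J K L else 0) else 0 := by
      rw [sub_eq_iff_eq_add] at i1 i2
      rw [i1, i2, add_right_comm, ← Finset.sum_add_distrib]
      congr 1
      refine Finset.sum_congr rfl fun L hL => ?_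
      rcases lt_or_gt_of_ne (hd K hK L hL) with h | h
      · rw [if_pos (h.trans hKt), if_pos h, if_neg h.not_gt, if_pos (h.trans hKt), add_zero]
      · rw [if_neg h.not_gt, if_pos h, zero_add]
    have split : ∑ L ∈ properParts K, (if wallTime z g L < t then
        (h0 K + if wallTime z g K < wallTime z g L then crossSign R g K else 0) * W K *
          J K L else 0) = W K * (h0 K * ∑ L ∈ properParts K,
            if wallTime z g L < t then J K L else 0) + W K * (crossSign R g K *
          ∑ L ∈ properParts K, if wallTime z g L < t then
            if wallTime z g K < wallTime z g L then J K L else 0 else 0) := by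
      simp only [Finset.mul_sum]
      rw [← Finset.sum_add_distrib]
      refine Finset.sum_congr rfl fun L hL => ?_
      split_ifs <;> ring
    rw [this, split]
    ring
  · rw [if_neg hKt, if_neg hKt, zero_mul, add_zero, zero_add, Finset.mul_sum, Finset.mul_sum]
    refine Finset.sum_congr rfl fun L hL => ?_
    split_ifs with h1 h2
    · exact absurd (h2.trans h1) hKt
    · ring
    · simp

end FlowTrees

/-! ### Binary trees and the sum over attractor flow trees -/

/-- Planar binary trees with labelled leaves. -/
inductive BinTree (ι : Type*)
  | leaf (i : ι) : BinTree ι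
  | node (S T : BinTree ι) : BinTree ι

/-- The value `w(J, K) = ∑_{j ∈ J} ∑_{k ∈ K} w(j, k)` of a bilinear form. -/
def pairing {ι : Type*} (w : ι → ι → ℝ) (J K : Finset ι) : ℝ := ∑ j ∈ J, ∑ k ∈ K, w j k

section FlowTrees

variable {ι R : Type*} [DecidableEq ι] [CommRing R]

/-- The set of labels of the leaves. -/
def BinTree.leaves : BinTree ι → Finset ι
  | .leaf i => {i}
  | .node S T => S.leaves ∪ T.leaves

open Classical in
/-- The binary trees whose leaves are labelled by `I`, each label being used once. -/
def binTrees (I : Finset ι) : Finset (BinTree ι) :=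
  (I.filter (fun i => I = {i})).image BinTree.leaf ∪
    (properParts I).attach.biUnion fun L =>
      (binTrees (I \ L.1) ×ˢ binTrees L.1).image fun p => BinTree.node p.1 p.2
termination_by I.card
decreasing_by
  · exact properParts_card_lt (properParts_sdiff L.2)
  · exact properParts_card_lt L.2

theorem leaf_mem_binTrees {I : Finset ι} {i : ι} : BinTree.leaf i ∈ binTrees I ↔ I = {i} := by
  rw [binTrees]
  simp only [Finset.mem_union, Finset.mem_image, Finset.mem_filter, Finset.mem_biUnion]
  constructor
  · rintro (⟨j, hj, h⟩ | ⟨_, _, _, _, h⟩)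
    · cases h; exact hj.2
    · cases h
  · intro h
    exact Or.inl ⟨i, ⟨by simp [h], h⟩, rfl⟩

theorem node_mem_binTrees {I : Finset ι} {S T : BinTree ι} : BinTree.node S T ∈ binTrees I ↔
    ∃ L ∈ properParts I, S ∈ binTrees (I \ L) ∧ T ∈ binTrees L := by
  rw [binTrees]
  simp only [Finset.mem_union, Finset.mem_image, Finset.mem_filter, Finset.mem_biUnion,
    Finset.mem_product]
  constructor
  · rintro (⟨j, hj, h⟩ | ⟨L, _, ⟨S', T'⟩, h, h'⟩)
    · cases h
    · cases h'; exact ⟨L.1, L.2, h⟩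
  · rintro ⟨L, hL, h⟩
    exact Or.inr ⟨⟨L, hL⟩, Finset.mem_attach _ _, ⟨S, T⟩, h, rfl⟩

theorem leaves_of_mem_binTrees {T : BinTree ι} {I : Finset ι} (h : T ∈ binTrees I) :
    T.leaves = I := by
  induction T generalizing I with
  | leaf i => exact (leaf_mem_binTrees.1 h).symm
  | node S T hS hT =>
    obtain ⟨L, hL, h1, h2⟩ := node_mem_binTrees.1 h
    rw [BinTree.leaves, hS h1, hT h2]
    exact Finset.sdiff_union_of_subset (mem_properParts.1 hL).1.1

theorem node_mem_binTrees_iff {I : Finset ι} {S T : BinTree ι} : BinTree.node S T ∈ binTrees I ↔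
    Disjoint S.leaves T.leaves ∧ S.leaves.Nonempty ∧ T.leaves.Nonempty ∧
      S.leaves ∪ T.leaves = I ∧ S ∈ binTrees S.leaves ∧ T ∈ binTrees T.leaves := by
  rw [node_mem_binTrees]
  constructor
  · rintro ⟨L, hL, h1, h2⟩
    rw [leaves_of_mem_binTrees h1, leaves_of_mem_binTrees h2]
    exact ⟨Finset.sdiff_disjoint, (mem_properParts.1 (properParts_sdiff hL)).2,
      (mem_properParts.1 hL).2, Finset.sdiff_union_of_subset (mem_properParts.1 hL).1.1, h1, h2⟩
  · rintro ⟨hd, hS, hT, h, h1, h2⟩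
    have e : I \ T.leaves = S.leaves := by
      rw [← h, Finset.union_sdiff_right, Finset.sdiff_eq_self_of_disjoint hd]
    refine ⟨T.leaves, ?_, by rwa [e], h2⟩
    rw [mem_properParts]
    refine ⟨⟨h ▸ Finset.subset_union_right, fun h' => ?_⟩, hT⟩
    obtain ⟨s, hs⟩ := hS
    rw [← h] at h'
    exact Finset.disjoint_left.1 hd hs (h' (Finset.mem_union_left _ hs))

theorem binTrees_nonempty {I : Finset ι} (hI : I.Nonempty) : (binTrees I).Nonempty := by
  induction' hn : I.card using Nat.strong_induction_on with n ih generalizing I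
  obtain ⟨i, hi⟩ := hI
  by_cases h : I = {i}
  · exact ⟨_, leaf_mem_binTrees.2 h⟩
  · have hL : {i} ∈ properParts I := by
      rw [mem_properParts]
      exact ⟨(Finset.singleton_subset_iff.2 hi).ssubset_of_ne (Ne.symm h),
        Finset.singleton_nonempty i⟩
    obtain ⟨S, hS⟩ := ih _ (hn ▸ properParts_card_lt (properParts_sdiff hL))
      (mem_properParts.1 (properParts_sdiff hL)).2 rfl
    obtain ⟨T, hT⟩ := ih _ (hn ▸ properParts_card_lt hL) (mem_properParts.1 hL).2 rfl
    exact ⟨_, node_mem_binTrees.2 ⟨_, hL, hS, hT⟩⟩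

theorem sum_binTrees_singleton (i : ι) (f : BinTree ι → R) :
    ∑ T ∈ binTrees {i}, f T = f (.leaf i) := by
  have : binTrees {i} = {BinTree.leaf i} := by
    ext T
    rw [Finset.mem_singleton]
    cases T with
    | leaf j =>
      rw [leaf_mem_binTrees, Finset.singleton_inj, BinTree.leaf.injEq]
      exact eq_comm
    | node S T =>
      rw [node_mem_binTrees]
      simp only [reduceCtorEq, iff_false]
      rintro ⟨L, hL, -⟩
      have h1 := properParts_card_lt hL
      have h2 := (mem_properParts.1 hL).2.card_pos
      rw [Finset.card_singleton] at h1
      omega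
  rw [this, Finset.sum_singleton]

open Classical in
theorem sum_binTrees {I : Finset ι} (hI : I.card ≠ 1) (f : BinTree ι → R) :
    ∑ T ∈ binTrees I, f T =
      ∑ L ∈ properParts I, ∑ S ∈ binTrees (I \ L), ∑ T ∈ binTrees L, f (.node S T) := by
  have h0 : I.filter (fun i => I = {i}) = ∅ := by
    refine Finset.filter_eq_empty_iff.2 fun i _ h => hI ?_
    rw [h, Finset.card_singleton]
  have hinj : ∀ L, Set.InjOn (fun p : BinTree ι × BinTree ι => BinTree.node p.1 p.2)
      ((binTrees (I \ L) ×ˢ binTrees L : Finset _) : Set (BinTree ι × BinTree ι)) := by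
    rintro L ⟨a, b⟩ _ ⟨c, d⟩ _ h
    cases h; rfl
  rw [binTrees, h0, Finset.image_empty, Finset.empty_union, Finset.sum_biUnion]
  · rw [← Finset.sum_attach (properParts I)]
    refine Finset.sum_congr rfl fun L _ => ?_
    rw [Finset.sum_image (hinj L.1), Finset.sum_product]
  · intro L _ L' _ hne
    rw [Function.onFun, Finset.disjoint_left]
    intro T h1 h2
    simp only [Finset.mem_image, Finset.mem_product] at h1 h2
    obtain ⟨p, hp, rfl⟩ := h1
    obtain ⟨p', hp', h⟩ := h2
    have h := (BinTree.node.injEq _ _ _ _ ▸ h).2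
    rw [← h] at hp
    exact hne (Subtype.ext ((leaves_of_mem_binTrees hp.2).symm.trans
      (leaves_of_mem_binTrees hp'.2)))

/-- The commutator factor of a vertex at which `J ∪ K` splits into `J` and `K`. -/
def commutator (Q : Finset ι → Finset ι → R) (J K : Finset ι) : R := Q J K - Q K J

/-- The product of the commutator factors of the vertices of a tree. -/
def BinTree.mult (Q : Finset ι → Finset ι → R) : BinTree ι → R
  | .leaf _ => 1
  | .node S T => commutator Q S.leaves T.leaves * S.mult Q * T.mult Q

/-- The value of `y` at the point where the flow of the cluster `J ∪ K`, which moves `y` along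
the direction `-w(·, J ∪ K)`, meets the wall `y(J) = 0`. The time needed is `y(J) / w(J, K)`, for
an antisymmetric form `w`. -/
def advance (w : ι → ι → ℝ) (y : ι → ℝ) (J K : Finset ι) (i : ι) : ℝ :=
  y i - (∑ j ∈ J, y j) / pairing w J K * ∑ k ∈ J ∪ K, w i k

/-- At every vertex of the tree, the two branches are ordered so that the form `w` is positive. -/
def BinTree.Ordered (w : ι → ι → ℝ) : BinTree ι → Prop
  | .leaf _ => True
  | .node S T => 0 < pairing w S.leaves T.leaves ∧ S.Ordered w ∧ T.Ordered w

/-- The tree is ordered, and all its edges, the root edge included, have positive lengths when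
the flow starts from `y`. -/
def BinTree.Positive (w : ι → ι → ℝ) : BinTree ι → (ι → ℝ) → Prop
  | .leaf _, _ => True
  | .node S T, y => 0 < pairing w S.leaves T.leaves ∧ 0 < ∑ i ∈ S.leaves, y i ∧
      S.Positive w (advance w y S.leaves T.leaves) ∧ T.Positive w (advance w y S.leaves T.leaves)

/-- The tree is ordered, and all its edges except possibly the root edge have positive lengths. -/
def BinTree.TopPositive (w : ι → ι → ℝ) : BinTree ι → (ι → ℝ) → Prop
  | .leaf _, _ => True
  | .node S T, y => 0 < pairing w S.leaves T.leaves ∧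
      S.Positive w (advance w y S.leaves T.leaves) ∧ T.Positive w (advance w y S.leaves T.leaves)

/-- Some edge of the tree has negative length, if the tree is ordered. -/
def BinTree.Negative (w : ι → ι → ℝ) : BinTree ι → (ι → ℝ) → Prop
  | .leaf _, _ => False
  | .node S T, y => ∑ i ∈ S.leaves, y i < 0 ∨
      S.Negative w (advance w y S.leaves T.leaves) ∨ T.Negative w (advance w y S.leaves T.leaves)

/-- Some edge of the tree other than the root edge has negative length, if the tree is ordered. -/
def BinTree.TopNegative (w : ι → ι → ℝ) : BinTree ι → (ι → ℝ) → Prop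
  | .leaf _, _ => False
  | .node S T, y =>
      S.Negative w (advance w y S.leaves T.leaves) ∨ T.Negative w (advance w y S.leaves T.leaves)

open Classical in
/-- The sum of the multiplicities of the flow trees with leaves `I` that start from `y`: the root
edge, which follows the flow line forward, has to reach the first vertex. -/
def treeSum (w : ι → ι → ℝ) (Q : Finset ι → Finset ι → R) (I : Finset ι) (y : ι → ℝ) : R :=
  ∑ T ∈ binTrees I, if T.Positive w y then T.mult Q else 0

open Classical in
/-- The sum of the multiplicities of the flow trees with leaves `I` whose root edge lies on the
flow line through `y`; the first vertex may lie on either side of `y`. -/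
def topTreeSum (w : ι → ι → ℝ) (Q : Finset ι → Finset ι → R) (I : Finset ι) (y : ι → ℝ) : R :=
  ∑ T ∈ binTrees I, if T.TopPositive w y then T.mult Q else 0

theorem treeSum_singleton (w : ι → ι → ℝ) (Q : Finset ι → Finset ι → R) (i : ι) (y : ι → ℝ) :
    treeSum w Q {i} y = 1 := by
  rw [treeSum, sum_binTrees_singleton, BinTree.Positive, if_pos trivial, BinTree.mult]

theorem treeSum_eq (w : ι → ι → ℝ) (Q : Finset ι → Finset ι → R) {I : Finset ι}
    (hI : I.card ≠ 1) (y : ι → ℝ) :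
    treeSum w Q I y = ∑ L ∈ properParts I,
      if 0 < pairing w (I \ L) L ∧ 0 < ∑ i ∈ I \ L, y i then
        commutator Q (I \ L) L * (treeSum w Q (I \ L) (advance w y (I \ L) L) *
          treeSum w Q L (advance w y (I \ L) L)) else 0 := by
  classical
  rw [treeSum, sum_binTrees hI]
  refine Finset.sum_congr rfl fun L _ => ?_
  have key : ∀ S ∈ binTrees (I \ L), ∀ T ∈ binTrees L,
      (if (BinTree.node S T).Positive w y then (BinTree.node S T).mult Q else 0) =
      if 0 < pairing w (I \ L) L ∧ 0 < ∑ i ∈ I \ L, y i then commutator Q (I \ L) L *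
        ((if S.Positive w (advance w y (I \ L) L) then S.mult Q else 0) *
        (if T.Positive w (advance w y (I \ L) L) then T.mult Q else 0)) else 0 := by
    intro S hS T hT
    rw [BinTree.Positive, BinTree.mult, leaves_of_mem_binTrees hS, leaves_of_mem_binTrees hT]
    by_cases h1 : 0 < pairing w (I \ L) L ∧ 0 < ∑ i ∈ I \ L, y i <;>
      by_cases h2 : S.Positive w (advance w y (I \ L) L) <;>
      by_cases h3 : T.Positive w (advance w y (I \ L) L) <;>
      simp [h1, h2, h3, mul_assoc]
  rw [Finset.sum_congr rfl fun S hS => Finset.sum_congr rfl fun T hT => key S hS T hT]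
  rw [treeSum, treeSum, Finset.sum_mul_sum]
  split_ifs
  · simp only [Finset.mul_sum]
  · simp

theorem topTreeSum_eq (w : ι → ι → ℝ) (Q : Finset ι → Finset ι → R) {I : Finset ι}
    (hI : I.card ≠ 1) (y : ι → ℝ) :
    topTreeSum w Q I y = ∑ L ∈ properParts I,
      if 0 < pairing w (I \ L) L then
        commutator Q (I \ L) L * (treeSum w Q (I \ L) (advance w y (I \ L) L) *
          treeSum w Q L (advance w y (I \ L) L)) else 0 := by
  classical
  rw [topTreeSum, sum_binTrees hI]
  refine Finset.sum_congr rfl fun L _ => ?_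
  have key : ∀ S ∈ binTrees (I \ L), ∀ T ∈ binTrees L,
      (if (BinTree.node S T).TopPositive w y then (BinTree.node S T).mult Q else 0) =
      if 0 < pairing w (I \ L) L then commutator Q (I \ L) L *
        ((if S.Positive w (advance w y (I \ L) L) then S.mult Q else 0) *
        (if T.Positive w (advance w y (I \ L) L) then T.mult Q else 0)) else 0 := by
    intro S hS T hT
    rw [BinTree.TopPositive, BinTree.mult, leaves_of_mem_binTrees hS, leaves_of_mem_binTrees hT]
    by_cases h1 : 0 < pairing w (I \ L) L <;>
      by_cases h2 : S.Positive w (advance w y (I \ L) L) <;>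
      by_cases h3 : T.Positive w (advance w y (I \ L) L) <;>
      simp [h1, h2, h3, mul_assoc]
  rw [Finset.sum_congr rfl fun S hS => Finset.sum_congr rfl fun T hT => key S hS T hT]
  rw [treeSum, treeSum, Finset.sum_mul_sum]
  split_ifs
  · simp only [Finset.mul_sum]
  · simp

/-! ### Antisymmetric forms -/

theorem pairing_swap {ι : Type*} {w : ι → ι → ℝ} (hw : ∀ i j, w i j = -w j i) (J K : Finset ι) :
    pairing w J K = -pairing w K J := by
  rw [pairing, pairing, Finset.sum_comm, ← Finset.sum_neg_distrib]
  refine Finset.sum_congr rfl fun j _ => ?_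
  rw [← Finset.sum_neg_distrib]
  exact Finset.sum_congr rfl fun k _ => hw _ _

theorem pairing_self {ι : Type*} {w : ι → ι → ℝ} (hw : ∀ i j, w i j = -w j i) (J : Finset ι) :
    pairing w J J = 0 := by
  have := pairing_swap hw J J
  linarith

theorem pairing_sdiff {w : ι → ι → ℝ} (hw : ∀ i j, w i j = -w j i) {I L : Finset ι}
    (h : L ⊆ I) : pairing w (I \ L) L = -∑ l ∈ L, ∑ i ∈ I, w l i := by
  rw [pairing_swap hw, pairing]
  have h0 := pairing_self hw L
  rw [pairing] at h0
  have : ∀ l, ∑ i ∈ I, w l i = ∑ i ∈ I \ L, w l i + ∑ i ∈ L, w l i := fun l => by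
    rw [Finset.sum_sdiff h]
  simp only [this, Finset.sum_add_distrib, h0, add_zero]

/-- If `y(I) = 0`, the flow of `I` meets the wall of `L ⊂ I` at the `wallTime` of the line
through `y` with direction `w(·, I)`. The flow follows this line backwards. -/
theorem advance_sdiff {w : ι → ι → ℝ} (hw : ∀ i j, w i j = -w j i) {I L : Finset ι}
    (h : L ⊆ I) {y : ι → ℝ} (hy : ∑ i ∈ I, y i = 0) :
    advance w y (I \ L) L =
      fun i => y i + wallTime y (fun l => ∑ i ∈ I, w l i) L * ∑ k ∈ I, w i k := by
  funext i
  rw [advance, pairing_sdiff hw h, sum_sdiff_part y h, hy, wallTime,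
    Finset.sdiff_union_of_subset h, zero_sub, neg_div_neg_eq, neg_div]
  ring

theorem advance_sdiff_swap {w : ι → ι → ℝ} (hw : ∀ i j, w i j = -w j i) {I L : Finset ι}
    (h : L ⊆ I) {y : ι → ℝ} (hy : ∑ i ∈ I, y i = 0) :
    advance w y L (I \ L) = advance w y (I \ L) L := by
  funext i
  rw [advance, advance, pairing_swap hw L, sum_sdiff_part y h, hy, Finset.union_comm, zero_sub,
    div_neg, neg_div]

/-- A sum of commutators over the decompositions of `I` in two ordered parts, when the other factor
does not depend on the order: the second term of the commutator is moved to the opposite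
decomposition. -/
theorem sum_commutator (Q : Finset ι → Finset ι → R) (I : Finset ι) (c : Finset ι → Prop)
    [DecidablePred c] (f : Finset ι → R) (hf : ∀ L ∈ properParts I, f (I \ L) = f L) :
    (∑ L ∈ properParts I, if c L then commutator Q (I \ L) L * f L else 0) =
      ∑ L ∈ properParts I, ((if c L then 1 else 0) - (if c (I \ L) then 1 else 0)) *
        Q (I \ L) L * f L := by
  have hs : ∀ L ∈ properParts I, I \ (I \ L) = L := fun L hL =>
    Finset.sdiff_sdiff_eq_self (mem_properParts.1 hL).1.1
  have e : (∑ L ∈ properParts I, (if c (I \ L) then (1 : R) else 0) * Q (I \ L) L * f L) =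
      ∑ L ∈ properParts I, (if c L then (1 : R) else 0) * Q L (I \ L) * f L := by
    refine Finset.sum_bij' (fun L _ => I \ L) (fun L _ => I \ L) (fun L => properParts_sdiff)
      (fun L => properParts_sdiff) hs hs fun L hL => ?_
    rw [hs L hL, hf L hL]
  simp only [sub_mul, Finset.sum_sub_distrib]
  rw [e, ← Finset.sum_sub_distrib]
  refine Finset.sum_congr rfl fun L _ => ?_
  rw [commutator]
  split_ifs <;> ring

/-! ### Generic values -/

/-- The family `y`, restricted to `I`, has sum zero and satisfies no other linear relation with
rational coefficients. -/
def RatGeneric (I : Finset ι) (y : ι → ℝ) : Prop :=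
  ∑ i ∈ I, y i = 0 ∧ ∀ c : ι → ℚ, ∑ i ∈ I, (c i : ℝ) * y i = 0 → ∀ i ∈ I, ∀ j ∈ I, c i = c j

theorem sum_indicator_mul {I K : Finset ι} (h : K ⊆ I) (c : ι → ℚ) (y : ι → ℝ) :
    ∑ i ∈ I, ((if i ∈ K then c i else 0 : ℚ) : ℝ) * y i = ∑ i ∈ K, (c i : ℝ) * y i := by
  have e : ∀ i, ((if i ∈ K then c i else 0 : ℚ) : ℝ) * y i =
      if i ∈ K then (c i : ℝ) * y i else 0 := fun i => by
    split_ifs <;> simp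
  simp only [e]
  rw [← Finset.sum_filter, Finset.filter_mem_eq_inter, Finset.inter_eq_right.2 h]

theorem RatGeneric.sum_ne_zero {I : Finset ι} {y : ι → ℝ} (h : RatGeneric I y) {K : Finset ι}
    (hK : K ∈ properParts I) : ∑ i ∈ K, y i ≠ 0 := by
  intro h0
  rw [mem_properParts] at hK
  obtain ⟨x, hx, hx'⟩ := Finset.exists_of_ssubset hK.1
  obtain ⟨k, hk⟩ := hK.2
  have := h.2 (fun i => if i ∈ K then 1 else 0) (by
    rw [sum_indicator_mul hK.1.1 (fun _ => 1)]
    simpa using h0)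
    k (hK.1.1 hk) x hx
  simp [hk, hx'] at this

/-- The walls of nested subsets are crossed at different times. -/
theorem RatGeneric.wallTime_ne {I : Finset ι} {y : ι → ℝ} (h : RatGeneric I y) (g : ι → ℚ)
    (hg : ∀ K ∈ properParts I, ∑ i ∈ K, (g i : ℝ) ≠ 0) {K L : Finset ι}
    (hK : K ∈ properParts I) (hL : L ∈ properParts K) :
    wallTime y (fun i => (g i : ℝ)) L ≠ wallTime y (fun i => (g i : ℝ)) K := by
  intro h0
  have hgK := hg K hK
  have hgL := hg L (properParts_trans hK hL)
  have hgq : ∑ i ∈ L, g i ≠ 0 := by exact_mod_cast hgL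
  rw [wallTime, wallTime, div_eq_div_iff hgL hgK] at h0
  have hK' := (mem_properParts.1 hK)
  have hL' := (mem_properParts.1 hL)
  have hc := h.2 (fun i => (if i ∈ L then ∑ i ∈ K, g i else 0) -
    (if i ∈ K then ∑ i ∈ L, g i else 0)) (by
    simp only [Rat.cast_sub, sub_mul, Finset.sum_sub_distrib]
    rw [sum_indicator_mul (hL'.1.1.trans hK'.1.1) (fun _ => ∑ i ∈ K, g i),
      sum_indicator_mul hK'.1.1 (fun _ => ∑ i ∈ L, g i), ← Finset.mul_sum, ← Finset.mul_sum]
    push_cast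
    linarith)
  obtain ⟨x, hx, hx'⟩ := Finset.exists_of_ssubset hK'.1
  obtain ⟨k, hk, hk'⟩ := Finset.exists_of_ssubset hL'.1
  have := hc k (hK'.1.1 hk) x hx
  have hxL : x ∉ L := fun h => hx' (hL'.1.1 h)
  simp only [hk, hk', hx', hxL, if_true, if_false] at this
  exact hgq (by linarith)

/-- The flow stopped at the wall of `L` preserves genericity. -/
theorem RatGeneric.at_wallTime {I : Finset ι} {y : ι → ℝ} (h : RatGeneric I y) (g : ι → ℚ)
    {L : Finset ι} (hL : L ∈ properParts I) (hg : ∑ i ∈ L, (g i : ℝ) ≠ 0) :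
    RatGeneric L (fun i => y i + wallTime y (fun i => (g i : ℝ)) L * g i) := by
  refine ⟨sum_at_wallTime y _ hg, fun c hc i hi j hj => ?_⟩
  have hL' := (mem_properParts.1 hL)
  obtain ⟨x, hx, hx'⟩ := Finset.exists_of_ssubset hL'.1
  have hgq : ∑ i ∈ L, g i ≠ 0 := by exact_mod_cast hg
  have hc' := h.2 (fun i => if i ∈ L then c i - (∑ i ∈ L, c i * g i) / ∑ i ∈ L, g i else 0) (by
    rw [sum_indicator_mul hL'.1.1 (fun i => c i - (∑ i ∈ L, c i * g i) / ∑ i ∈ L, g i)]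
    push_cast
    simp only [mul_add, Finset.sum_add_distrib] at hc
    simp only [sub_mul, Finset.sum_sub_distrib, ← Finset.mul_sum]
    have e : ∑ i ∈ L, (c i : ℝ) * (wallTime y (fun i => (g i : ℝ)) L * g i) =
        wallTime y (fun i => (g i : ℝ)) L * ∑ i ∈ L, (c i : ℝ) * g i := by
      rw [Finset.mul_sum]
      exact Finset.sum_congr rfl fun _ _ => by ring
    rw [e, wallTime] at hc
    rw [← hc]
    ring)
  have e1 := hc' i (hL'.1.1 hi) x hx
  have e2 := hc' j (hL'.1.1 hj) x hx
  simp only [hi, hj, hx', if_true, if_false] at e1 e2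
  linarith

/-- For a rational form without zeros and a generic starting point, the sum over flow trees is a
chain sum: both satisfy the same recursion, by the formula for the jumps of chain sums. -/
theorem treeSum_eq_chainSum (wq : ι → ι → ℚ) (hw : ∀ i j, wq i j = -wq j i) (n : ℕ)
    (Q : Finset ι → Finset ι → R) (hQ : IsCocycle Q) (b : Finset ι → R)
    (hb : ∀ I : Finset ι, I.card ≤ n →
      chainSum Q b (fun l => -∑ i ∈ I, (wq l i : ℝ)) I = if I.card = 1 then 1 else 0)
    (I : Finset ι) (hI : I.Nonempty) (hIn : I.card ≤ n)
    (hg : ∀ K ⊆ I, ∀ L ∈ properParts K, ∑ l ∈ L, ∑ i ∈ K, (wq l i : ℝ) ≠ 0)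
    (y : ι → ℝ) (hy : RatGeneric I y) :
    treeSum (fun i j => (wq i j : ℝ)) Q I y = chainSum Q b y I ∧
      ∀ L ∈ properParts I,
        treeSum (fun i j => (wq i j : ℝ)) Q L
          (advance (fun i j => (wq i j : ℝ)) y (I \ L) L) =
            chainSum Q b (advance (fun i j => (wq i j : ℝ)) y (I \ L) L) L ∧
        treeSum (fun i j => (wq i j : ℝ)) Q (I \ L)
          (advance (fun i j => (wq i j : ℝ)) y (I \ L) L) =
            chainSum Q b (advance (fun i j => (wq i j : ℝ)) y (I \ L) L) (I \ L) := by
  induction' hm : I.card using Nat.strong_induction_on with m ih generalizing I y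
  have hw' : ∀ i j, (wq i j : ℝ) = -(wq j i : ℝ) := fun i j => by rw [hw]; push_cast; rfl
  set w : ι → ι → ℝ := fun i j => (wq i j : ℝ) with hwdef
  set gq : ι → ℚ := fun l => ∑ i ∈ I, wq l i with hgq
  have hgr : (fun l => ∑ i ∈ I, w l i) = fun i => (gq i : ℝ) := by
    funext l; simp [hgq, hwdef]
  have hgI : ∀ K ∈ properParts I, ∑ i ∈ K, (gq i : ℝ) ≠ 0 := fun K hK => by
    have := hg I subset_rfl K hK
    simpa [hgq] using this
  have hadv : ∀ L ∈ properParts I, advance w y (I \ L) L =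
      fun i => y i + wallTime y (fun i => (gq i : ℝ)) L * gq i := fun L hL => by
    rw [advance_sdiff hw' (mem_properParts.1 hL).1.1 hy.1, hgr]
    funext i
    rw [← congrFun hgr i]
  have hgen : ∀ L ∈ properParts I, RatGeneric L (advance w y (I \ L) L) := fun L hL => by
    rw [hadv L hL]
    exact hy.at_wallTime gq hL (hgI L hL)
  have hsub : ∀ L ∈ properParts I, treeSum w Q L (advance w y (I \ L) L) =
      chainSum Q b (advance w y (I \ L) L) L := fun L hL => by
    have hlt := properParts_card_lt hL
    exact (ih L.card (hm ▸ hlt) L (mem_properParts.1 hL).2 (by omega)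
      (fun K hK => hg K (hK.trans (mem_properParts.1 hL).1.1)) _ (hgen L hL) rfl).1
  have hs : ∀ L ∈ properParts I, I \ (I \ L) = L := fun L hL =>
    Finset.sdiff_sdiff_eq_self (mem_properParts.1 hL).1.1
  have hswap : ∀ L ∈ properParts I, advance w y (I \ (I \ L)) (I \ L) =
      advance w y (I \ L) L := fun L hL => by
    rw [hs L hL, advance_sdiff_swap hw' (mem_properParts.1 hL).1.1 hy.1]
  have hsub' : ∀ L ∈ properParts I, treeSum w Q (I \ L) (advance w y (I \ L) L) =
      chainSum Q b (advance w y (I \ L) L) (I \ L) := fun L hL => by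
    have := hsub (I \ L) (properParts_sdiff hL)
    rwa [hswap L hL] at this
  refine ⟨?_, fun L hL => ⟨hsub L hL, hsub' L hL⟩⟩
  by_cases h1 : I.card = 1
  · have hb1 := hb I hIn
    rw [if_pos h1] at hb1
    obtain ⟨i, rfl⟩ := Finset.card_eq_one.1 h1
    rw [treeSum_singleton, ← hb1]
    refine chainSum_congr Q _ (fun _ _ => rfl) fun K hK => ?_
    have h2 := properParts_card_lt hK
    have h3 := (mem_properParts.1 hK).2.card_pos
    omega
  · -- The chain sum at `y` is the sum of the jumps before time `0`, as its initial value is zero.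
    have hflow := chainSum_sub_eq_sum_jumps Q hQ b y (fun i => (gq i : ℝ)) I hgI
      (fun K hK L hL => hy.wallTime_ne gq hgI hK hL) 0 (fun K hK => by
        rw [wallTime, ne_comm, div_ne_zero_iff, neg_ne_zero]
        exact ⟨hy.sum_ne_zero hK, hgI K hK⟩)
    have hb1 := hb I hIn
    rw [if_neg h1] at hb1
    have hneg : (fun l => -∑ i ∈ I, (wq l i : ℝ)) = fun i => -(gq i : ℝ) := by
      funext l; rw [← congrFun hgr l]
    rw [hneg] at hb1
    rw [hb1, sub_zero] at hflow
    simp only [zero_mul, add_zero] at hflow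
    rw [hflow, treeSum_eq w Q h1, sum_commutator Q I
      (fun L => 0 < pairing w (I \ L) L ∧ 0 < ∑ i ∈ I \ L, y i)
      (fun L => treeSum w Q (I \ L) (advance w y (I \ L) L) *
          treeSum w Q L (advance w y (I \ L) L))]
    · refine Finset.sum_congr rfl fun L hL => ?_
      rw [hs L hL, hsub L hL, hsub' L hL, hadv L hL, pairing_swap hw' L,
        pairing_sdiff hw' (mem_properParts.1 hL).1.1, sum_sdiff_part y (mem_properParts.1 hL).1.1,
        hy.1, zero_sub, neg_neg]
      have hgl : ∑ l ∈ L, ∑ i ∈ I, w l i = ∑ i ∈ L, (gq i : ℝ) :=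
        Finset.sum_congr rfl fun l _ => congrFun hgr l
      rw [hgl, wallTime, crossSign]
      have n1 := hgI L hL
      have n2 := hy.sum_ne_zero hL
      generalize ∑ i ∈ L, (gq i : ℝ) = u at *
      generalize ∑ i ∈ L, y i = v at *
      -- The two indicators in the symmetrized recursion of the tree sums add up to the indicator of
      -- a negative wall time, multiplied by the crossing sign.
      rcases lt_or_gt_of_ne n1 with hu | hu <;> rcases lt_or_gt_of_ne n2 with hv | hv
      · have : -v / u < 0 := div_neg_of_pos_of_neg (by linarith) hu
        simp only [this, if_true, hu, hu.not_gt, hv, hv.not_gt, and_false, if_false,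
          Left.neg_pos_iff, and_true]
        ring
      · have : ¬ -v / u < 0 := (div_pos_of_neg_of_neg (by linarith) hu).not_gt
        simp [this, hu, hu.not_gt, hv, hv.not_gt]
      · have : ¬ -v / u < 0 := (div_pos (by linarith) hu).not_gt
        simp [this, hu, hu.not_gt, hv, hv.not_gt]
      · have : -v / u < 0 := div_neg_of_neg_of_pos (by linarith) hu
        simp only [this, if_true, hu, hu.not_gt, hv, hv.not_gt, and_false, if_false,
          Left.neg_pos_iff, and_true]
        ring
    · intro L hL
      rw [hswap L hL, hs L hL, mul_comm]

/-- For a fixed rational form without zeros, the sum over the flow trees on a whole flow line does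
not depend on the flow line, as long as it is generic. -/
theorem topTreeSum_const (wq : ι → ι → ℚ) (hw : ∀ i j, wq i j = -wq j i)
    (Q : Finset ι → Finset ι → R) (hQ : IsCocycle Q)
    (I : Finset ι) (hI : 2 ≤ I.card)
    (hg : ∀ J K : Finset ι, J.Nonempty → K.Nonempty → Disjoint J K →
      pairing (fun i j => (wq i j : ℝ)) J K ≠ 0) :
    ∃ C : R, ∀ y, RatGeneric I y → topTreeSum (fun i j => (wq i j : ℝ)) Q I y = C := by
  -- On a flow line of any `I`, the tree sum is zero behind the last wall, unless `I` is a
  -- singleton. The coefficients are chosen so that the chain sums have the same values there.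
  obtain ⟨b, hb⟩ := exists_chainSum_eq Q (fun I l => -∑ i ∈ I, (wq l i : ℝ))
    (fun I => if I.card = 1 then 1 else 0) I.card
  refine ⟨chainSum Q b (fun l => ∑ i ∈ I, (wq l i : ℝ)) I -
    chainSum Q b (fun l => -∑ i ∈ I, (wq l i : ℝ)) I, fun y hy => ?_⟩
  have hw' : ∀ i j, (wq i j : ℝ) = -(wq j i : ℝ) := fun i j => by rw [hw]; push_cast; rfl
  have hg' : ∀ K ⊆ I, ∀ L ∈ properParts K, ∑ l ∈ L, ∑ i ∈ K, (wq l i : ℝ) ≠ 0 := by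
    intro K _ L hL
    have := hg (K \ L) L (mem_properParts.1 (properParts_sdiff hL)).2 (mem_properParts.1 hL).2
      Finset.sdiff_disjoint
    rw [pairing_sdiff hw' (mem_properParts.1 hL).1.1] at this
    exact fun h => this (by rw [h, neg_zero])
  have main := (treeSum_eq_chainSum wq hw I.card Q hQ b hb I (Finset.card_pos.1 (by omega)) le_rfl
    hg' y hy).2
  set w : ι → ι → ℝ := fun i j => (wq i j : ℝ) with hwdef
  set gq : ι → ℚ := fun l => ∑ i ∈ I, wq l i with hgq
  have hgr : (fun l => ∑ i ∈ I, w l i) = fun i => (gq i : ℝ) := by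
    funext l; simp [hgq, hwdef]
  have hneg : (fun l => -∑ i ∈ I, (wq l i : ℝ)) = fun i => -(gq i : ℝ) := by
    funext l; rw [← congrFun hgr l]
  have hpos : (fun l => ∑ i ∈ I, (wq l i : ℝ)) = fun i => (gq i : ℝ) := hgr
  have hgI : ∀ K ∈ properParts I, ∑ i ∈ K, (gq i : ℝ) ≠ 0 := fun K hK => by
    have := hg' I subset_rfl K hK
    simpa [hgq] using this
  have hadv : ∀ L ∈ properParts I, advance w y (I \ L) L =
      fun i => y i + wallTime y (fun i => (gq i : ℝ)) L * gq i := fun L hL => by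
    rw [advance_sdiff hw' (mem_properParts.1 hL).1.1 hy.1, hgr]
    funext i
    rw [← congrFun hgr i]
  have hs : ∀ L ∈ properParts I, I \ (I \ L) = L := fun L hL =>
    Finset.sdiff_sdiff_eq_self (mem_properParts.1 hL).1.1
  have hswap : ∀ L ∈ properParts I, advance w y (I \ (I \ L)) (I \ L) =
      advance w y (I \ L) L := fun L hL => by
    rw [hs L hL, advance_sdiff_swap hw' (mem_properParts.1 hL).1.1 hy.1]
  -- After the time `t` all the walls are crossed, and the line lies on the same sides as `g`.
  obtain ⟨t, ht⟩ : ∃ t : ℝ, ∀ K ∈ properParts I, wallTime y (fun i => (gq i : ℝ)) K < t := by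
    obtain ⟨M, hM⟩ := ((properParts I).image (wallTime y (fun i => (gq i : ℝ)))).exists_le
    exact ⟨M + 1, fun K hK => (hM _ (Finset.mem_image_of_mem _ hK)).trans_lt (lt_add_one M)⟩
  have hflow := chainSum_sub_eq_sum_jumps Q hQ b y (fun i => (gq i : ℝ)) I hgI
      (fun K hK L hL => hy.wallTime_ne gq hgI hK hL) t (fun K hK => (ht K hK).ne')
  rw [hneg, hpos]
  have e : chainSum Q b (fun i => (gq i : ℝ)) I =
      chainSum Q b (fun i => y i + t * (gq i : ℝ)) I := by
    refine chainSum_congr Q I (fun _ _ => rfl) fun K hK => ?_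
    rw [sum_at]
    have h1 := ht K hK
    have h2 := hgI K hK
    rw [wallTime] at h1
    generalize ∑ i ∈ K, (gq i : ℝ) = u at *
    generalize ∑ i ∈ K, y i = v at *
    rcases lt_or_gt_of_ne h2 with hu | hu
    · rw [div_lt_iff_of_neg hu] at h1
      exact ⟨fun _ => by linarith, fun _ => hu⟩
    · rw [div_lt_iff₀ hu] at h1
      exact ⟨fun h => absurd h hu.not_gt, fun h => by linarith⟩
  rw [e, hflow, topTreeSum_eq w Q (by omega), sum_commutator Q I
    (fun L => 0 < pairing w (I \ L) L)
    (fun L => treeSum w Q (I \ L) (advance w y (I \ L) L) *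
          treeSum w Q L (advance w y (I \ L) L))]
  · refine Finset.sum_congr rfl fun L hL => ?_
    rw [if_pos (ht L hL), hs L hL, (main L hL).1, (main L hL).2, hadv L hL, pairing_swap hw' L,
      pairing_sdiff hw' (mem_properParts.1 hL).1.1, neg_neg]
    have hgl : ∑ l ∈ L, ∑ i ∈ I, w l i = ∑ i ∈ L, (gq i : ℝ) :=
      Finset.sum_congr rfl fun l _ => congrFun hgr l
    rw [hgl, crossSign]
    have n1 := hgI L hL
    generalize ∑ i ∈ L, (gq i : ℝ) = u at *
    rcases lt_or_gt_of_ne n1 with hu | hu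
    · simp only [hu, hu.not_gt, Left.neg_pos_iff, if_true, if_false]
      ring
    · simp only [hu, hu.not_gt, Left.neg_pos_iff, if_true, if_false]
      ring
  · intro L hL
    rw [hswap L hL, hs L hL, mul_comm]

end FlowTrees

section FlowTrees

variable {ι R : Type*} [DecidableEq ι] [CommRing R]

open Filter Topology

/-! ### Stability under perturbation -/

theorem continuous_pairing {ι : Type*} (J K : Finset ι) :
    Continuous fun w : ι → ι → ℝ => pairing w J K := by
  unfold pairing
  fun_prop

theorem tendsto_advance (w : ι → ι → ℝ) (y : ι → ℝ) (J K : Finset ι) (h : pairing w J K ≠ 0) :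
    Tendsto (fun p : (ι → ι → ℝ) × (ι → ℝ) => (p.1, advance p.1 p.2 J K)) (𝓝 (w, y))
      (𝓝 (w, advance w y J K)) := by
  have hp : ContinuousAt (fun p : (ι → ι → ℝ) × (ι → ℝ) => pairing p.1 J K) (w, y) :=
    ((continuous_pairing J K).comp continuous_fst).continuousAt
  refine ContinuousAt.tendsto (x := (w, y))
    (f := fun p : (ι → ι → ℝ) × (ι → ℝ) => (p.1, advance p.1 p.2 J K)) ?_
  refine continuousAt_fst.prodMk (continuousAt_pi.2 fun i => ?_)
  unfold advance
  refine ContinuousAt.sub (by fun_prop) (ContinuousAt.mul (ContinuousAt.div (by fun_prop) hp h)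
    (by fun_prop))

theorem eventually_pairing_pos {ι : Type*} {w : ι → ι → ℝ} (y : ι → ℝ) {J K : Finset ι}
    (h : 0 < pairing w J K) : ∀ᶠ p : (ι → ι → ℝ) × (ι → ℝ) in 𝓝 (w, y), 0 < pairing p.1 J K :=
  ((continuous_pairing J K).comp continuous_fst).continuousAt.eventually_const_lt h

theorem eventually_sum_pos {ι : Type*} (w : ι → ι → ℝ) {y : ι → ℝ} {J : Finset ι}
    (h : 0 < ∑ i ∈ J, y i) : ∀ᶠ p : (ι → ι → ℝ) × (ι → ℝ) in 𝓝 (w, y), 0 < ∑ i ∈ J, p.2 i :=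
  (show ContinuousAt (fun p : (ι → ι → ℝ) × (ι → ℝ) => ∑ i ∈ J, p.2 i) (w, y) by
    fun_prop).eventually_const_lt h

theorem eventually_sum_neg {ι : Type*} (w : ι → ι → ℝ) {y : ι → ℝ} {J : Finset ι}
    (h : ∑ i ∈ J, y i < 0) : ∀ᶠ p : (ι → ι → ℝ) × (ι → ℝ) in 𝓝 (w, y), ∑ i ∈ J, p.2 i < 0 :=
  (show ContinuousAt (fun p : (ι → ι → ℝ) × (ι → ℝ) => ∑ i ∈ J, p.2 i) (w, y) by
    fun_prop).eventually_lt_const h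

theorem BinTree.Positive.eventually {w : ι → ι → ℝ} {T : BinTree ι} {y : ι → ℝ}
    (h : T.Positive w y) :
    ∀ᶠ p : (ι → ι → ℝ) × (ι → ℝ) in 𝓝 (w, y), T.Positive p.1 p.2 := by
  induction T generalizing y with
  | leaf i => exact Eventually.of_forall fun _ => trivial
  | node S T hS hT =>
    obtain ⟨h1, h2, h3, h4⟩ := h
    have ht := tendsto_advance w y _ _ h1.ne'
    filter_upwards [eventually_pairing_pos y h1, eventually_sum_pos w h2,
      ht.eventually (hS h3), ht.eventually (hT h4)] with p a b c d using ⟨a, b, c, d⟩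

theorem BinTree.TopPositive.eventually {w : ι → ι → ℝ} {T : BinTree ι} {y : ι → ℝ}
    (h : T.TopPositive w y) :
    ∀ᶠ p : (ι → ι → ℝ) × (ι → ℝ) in 𝓝 (w, y), T.TopPositive p.1 p.2 := by
  cases T with
  | leaf i => exact Eventually.of_forall fun _ => trivial
  | node S T =>
    obtain ⟨h1, h3, h4⟩ := h
    have ht := tendsto_advance w y _ _ h1.ne'
    filter_upwards [eventually_pairing_pos y h1, ht.eventually h3.eventually,
      ht.eventually h4.eventually] with p a c d using ⟨a, c, d⟩

theorem BinTree.Negative.eventually {w : ι → ι → ℝ} {T : BinTree ι} {y : ι → ℝ}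
    (hT : T.Ordered w) (h : T.Negative w y) :
    ∀ᶠ p : (ι → ι → ℝ) × (ι → ℝ) in 𝓝 (w, y), T.Negative p.1 p.2 := by
  induction T generalizing y with
  | leaf i => exact h.elim
  | node S T ihS ihT =>
    have ht := tendsto_advance w y _ _ hT.1.ne'
    rcases h with h | h | h
    · filter_upwards [eventually_sum_neg w h] with p a using Or.inl a
    · filter_upwards [ht.eventually (ihS hT.2.1 h)] with p a using Or.inr (Or.inl a)
    · filter_upwards [ht.eventually (ihT hT.2.2 h)] with p a using Or.inr (Or.inr a)

theorem BinTree.TopNegative.eventually {w : ι → ι → ℝ} {T : BinTree ι} {y : ι → ℝ}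
    (hT : T.Ordered w) (h : T.TopNegative w y) :
    ∀ᶠ p : (ι → ι → ℝ) × (ι → ℝ) in 𝓝 (w, y), T.TopNegative p.1 p.2 := by
  cases T with
  | leaf i => exact h.elim
  | node S T =>
    have ht := tendsto_advance w y _ _ hT.1.ne'
    rcases h with h | h
    · filter_upwards [ht.eventually (h.eventually hT.2.1)] with p a using Or.inl a
    · filter_upwards [ht.eventually (h.eventually hT.2.2)] with p a using Or.inr a

theorem BinTree.Positive.not_negative {w : ι → ι → ℝ} {T : BinTree ι} {y : ι → ℝ}
    (h : T.Positive w y) : ¬ T.Negative w y := by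
  induction T generalizing y with
  | leaf i => exact fun h => h
  | node S T hS hT =>
    obtain ⟨h1, h2, h3, h4⟩ := h
    rintro (h | h | h)
    · exact h2.not_gt h
    · exact hS h3 h
    · exact hT h4 h

theorem BinTree.TopPositive.not_topNegative {w : ι → ι → ℝ} {T : BinTree ι} {y : ι → ℝ}
    (h : T.TopPositive w y) : ¬ T.TopNegative w y := by
  cases T with
  | leaf i => exact fun h => h
  | node S T => exact fun h' => h'.elim h.2.1.not_negative h.2.2.not_negative

theorem BinTree.Positive.ordered {w : ι → ι → ℝ} {T : BinTree ι} {y : ι → ℝ}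
    (h : T.Positive w y) : T.Ordered w := by
  induction T generalizing y with
  | leaf i => trivial
  | node S T hS hT => exact ⟨h.1, hS h.2.2.1, hT h.2.2.2⟩

theorem BinTree.TopPositive.ordered {w : ι → ι → ℝ} {T : BinTree ι} {y : ι → ℝ}
    (h : T.TopPositive w y) : T.Ordered w := by
  cases T with
  | leaf i => trivial
  | node S T => exact ⟨h.1, h.2.1.ordered, h.2.2.ordered⟩

/-- A tree with a non-zero multiplicity is either ordered, or not ordered for all the forms close
to `w`: the form does not vanish at its vertices. -/
theorem BinTree.ordered_or_eventually_not {w : ι → ι → ℝ} {Q : Finset ι → Finset ι → R}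
    {T : BinTree ι} {I : Finset ι} (hT : T ∈ binTrees I)
    (hQ : ∀ J K : Finset ι, J.Nonempty → K.Nonempty → Disjoint J K → J ∪ K ⊆ I →
      pairing w J K = 0 → commutator Q J K = 0) (hm : T.mult Q ≠ 0) (y : ι → ℝ) :
    T.Ordered w ∨ ∀ᶠ p : (ι → ι → ℝ) × (ι → ℝ) in 𝓝 (w, y), ¬ T.Ordered p.1 := by
  induction T generalizing I with
  | leaf i => exact Or.inl trivial
  | node S T ihS ihT =>
    obtain ⟨hd, hS, hT, hU, h1, h2⟩ := node_mem_binTrees_iff.1 hT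
    have n1 : commutator Q S.leaves T.leaves ≠ 0 := fun h => hm (by rw [BinTree.mult, h]; ring)
    have n2 : S.mult Q ≠ 0 := fun h => hm (by rw [BinTree.mult, h]; ring)
    have n3 : T.mult Q ≠ 0 := fun h => hm (by rw [BinTree.mult, h]; ring)
    have hp : pairing w S.leaves T.leaves ≠ 0 := fun h => n1 (hQ _ _ hS hT hd hU.subset h)
    rcases lt_or_gt_of_ne hp with h | h
    · right
      have : ∀ᶠ p : (ι → ι → ℝ) × (ι → ℝ) in 𝓝 (w, y), pairing p.1 S.leaves T.leaves < 0 :=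
        ((continuous_pairing _ _).comp continuous_fst).continuousAt.eventually_lt_const h
      filter_upwards [this] with p a b using a.not_gt b.1
    · rcases ihS h1 (fun J K a b c d => hQ J K a b c
        (d.trans (hU ▸ Finset.subset_union_left))) n2 with hS | hS
      · rcases ihT h2 (fun J K a b c d => hQ J K a b c
          (d.trans (hU ▸ Finset.subset_union_right))) n3 with hT | hT
        · exact Or.inl ⟨h, hS, hT⟩
        · right
          filter_upwards [hT] with p a b using a b.2.2
      · right
        filter_upwards [hS] with p a b using a b.2.1

/-- The sum over flow trees is locally constant in the form and the starting point: the trees of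
non-zero multiplicity which are ordered have edges of non-zero lengths, so that the signs of these
lengths do not change. -/
theorem eventually_topTreeSum_eq {w : ι → ι → ℝ} {Q : Finset ι → Finset ι → R} {I : Finset ι}
    (hQ : ∀ J K : Finset ι, J.Nonempty → K.Nonempty → Disjoint J K → J ∪ K ⊆ I →
      pairing w J K = 0 → commutator Q J K = 0) {y : ι → ℝ}
    (hy : ∀ T ∈ binTrees I, T.Ordered w → T.TopPositive w y ∨ T.TopNegative w y) :
    ∀ᶠ p : (ι → ι → ℝ) × (ι → ℝ) in 𝓝 (w, y), topTreeSum p.1 Q I p.2 = topTreeSum w Q I y := by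
  classical
  have key : ∀ T ∈ binTrees I, ∀ᶠ p : (ι → ι → ℝ) × (ι → ℝ) in 𝓝 (w, y),
      (if T.TopPositive p.1 p.2 then T.mult Q else 0) =
        if T.TopPositive w y then T.mult Q else 0 := by
    intro T hT
    by_cases hm : T.mult Q = 0
    · simp [hm]
    rcases BinTree.ordered_or_eventually_not hT hQ hm y with ho | hn
    · rcases hy T hT ho with h | h
      · filter_upwards [h.eventually] with p hp
        rw [if_pos h, if_pos hp]
      · filter_upwards [h.eventually ho] with p hp
        rw [if_neg fun h' => h'.not_topNegative hp, if_neg fun h' => h'.not_topNegative h]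
    · have : ¬ T.Ordered w := hn.self_of_nhds
      filter_upwards [hn] with p hp
      rw [if_neg fun h' => hp h'.ordered, if_neg fun h' => this h'.ordered]
  rw [← Filter.eventually_all_finset] at key
  filter_upwards [key] with p hp
  exact Finset.sum_congr rfl hp

/-! ### Existence of generic data -/

/-- Generic values are obtained from real numbers that are linearly independent over `ℚ`. -/
theorem exists_ratGeneric (I : Finset ι) : ∃ u : ι → ℝ, RatGeneric I u := by
  rcases I.eq_empty_or_nonempty with rfl | ⟨i₀, hi₀⟩
  · exact ⟨0, by simp, by simp⟩
  obtain ⟨s, hs, hli⟩ := (le_rank_iff_exists_linearIndependent_finset (K := ℚ) (V := ℝ)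
    (n := I.card)).1 (by
      rw [Real.rank_rat_real]
      exact (Cardinal.natCast_lt_aleph0).le.trans Cardinal.aleph0_le_continuum)
  let φ : I ≃ s := Finset.equivOfCardEq hs.symm
  have hli' := (linearIndependent_equiv φ).2 hli
  let v : ι → ℝ := fun i => if h : i ∈ I then φ ⟨i, h⟩ else 0
  have hv : ∀ c : ι → ℚ, ∑ i ∈ I, (c i : ℝ) * v i = 0 → ∀ i ∈ I, c i = 0 := by
    intro c hc i hi
    rw [Fintype.linearIndependent_iff] at hli'
    refine hli' (fun i => c i.1) ?_ ⟨i, hi⟩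
    rw [← Finset.sum_attach] at hc
    rw [← hc, Finset.univ_eq_attach]
    refine Finset.sum_congr rfl fun j _ => ?_
    simp only [v, j.2, dif_pos, Function.comp_apply, Rat.smul_def]
  -- The value at `i₀` is changed to make the sum zero.
  refine ⟨fun i => if i = i₀ then -∑ j ∈ I.erase i₀, v j else v i, ?_, fun c hc => ?_⟩
  · rw [← Finset.add_sum_erase _ _ hi₀, if_pos rfl]
    rw [Finset.sum_congr rfl fun j hj => if_neg (Finset.ne_of_mem_erase hj)]
    ring
  · rw [← Finset.add_sum_erase _ _ hi₀] at hc
    simp only [if_true] at hc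
    have e : ∑ x ∈ I.erase i₀, (c x : ℝ) * (if x = i₀ then -∑ j ∈ I.erase i₀, v j else v x) =
        ∑ x ∈ I.erase i₀, (c x : ℝ) * v x :=
      Finset.sum_congr rfl fun j hj => by rw [if_neg (Finset.ne_of_mem_erase hj)]
    rw [e] at hc
    have h1 := hv (fun i => c i - c i₀) (by
      rw [← Finset.add_sum_erase _ _ hi₀, ← hc]
      simp only [sub_self, Rat.cast_zero, zero_mul, zero_add, Rat.cast_sub, sub_mul,
        Finset.sum_sub_distrib, ← Finset.mul_sum]
      ring)
    intro i hi j hj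
    have e1 := h1 i hi
    have e2 := h1 j hj
    linarith

/-- The generic values are dense among the values with sum zero. -/
theorem frequently_ratGeneric [Finite ι] (I : Finset ι) {y : ι → ℝ} (hy : ∑ i ∈ I, y i = 0) :
    ∃ᶠ y' in 𝓝 y, RatGeneric I y' := by
  obtain ⟨u, hu⟩ := exists_ratGeneric I
  -- On the line through `y` with a generic direction `u`, only countably many points are not
  -- generic.
  have hc : (⋃ c ∈ {c : ι → ℚ | ¬ ∀ i ∈ I, ∀ j ∈ I, c i = c j},
      {s : ℝ | ∑ i ∈ I, (c i : ℝ) * (y i + s * u i) = 0}).Countable := by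
    refine Set.Countable.biUnion (Set.to_countable _) fun c hc => Set.Subsingleton.countable ?_
    intro s hs s' hs'
    have hcu : ∑ i ∈ I, (c i : ℝ) * u i ≠ 0 := fun h => hc (hu.2 c h)
    have e : ∀ s : ℝ, ∑ i ∈ I, (c i : ℝ) * (y i + s * u i) =
        ∑ i ∈ I, (c i : ℝ) * y i + s * ∑ i ∈ I, (c i : ℝ) * u i := fun s => by
      rw [Finset.mul_sum, ← Finset.sum_add_distrib]
      exact Finset.sum_congr rfl fun _ _ => by ring
    rw [Set.mem_ofPred_eq, e] at hs hs'
    exact mul_right_cancel₀ hcu (by linarith)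
  have hd := hc.dense_compl ℝ
  have ht : Tendsto (fun s : ℝ => fun i => y i + s * u i) (𝓝 0) (𝓝 y) := by
    have : ContinuousAt (fun s : ℝ => fun i => y i + s * u i) 0 := by fun_prop
    simpa [ContinuousAt] using this
  refine ht.frequently ?_
  rw [Filter.frequently_iff]
  intro U hU
  obtain ⟨s, hs, hsU⟩ := (mem_closure_iff_nhds.1 (hd 0)) U hU
  refine ⟨s, hs, ?_, fun c h => ?_⟩
  · rw [sum_at, hy, hu.1]; ring
  · by_contra hc
    exact hsU (Set.mem_biUnion (x := c) hc h)

/-- A rational antisymmetric form which vanishes on no pair of disjoint non-empty sets exists, since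
each pair excludes a proper subspace of the forms only. -/
theorem exists_pairing_ne_zero [Finite ι] : ∃ η : ι → ι → ℚ, (∀ i j, η i j = -η j i) ∧
    ∀ J K : Finset ι, J.Nonempty → K.Nonempty → Disjoint J K →
      pairing (fun i j => (η i j : ℝ)) J K ≠ 0 := by
  let X := {p : Finset ι × Finset ι // p.1.Nonempty ∧ p.2.Nonempty ∧ Disjoint p.1 p.2}
  let f : X → Module.Dual ℚ (ι × ι → ℚ) := fun p => ∑ j ∈ p.1.1, ∑ k ∈ p.1.2,
    ((LinearMap.proj (j, k) : (ι × ι → ℚ) →ₗ[ℚ] ℚ) - LinearMap.proj (k, j))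
  obtain ⟨x, hx⟩ := Module.Dual.exists_forall_ne_zero_of_forall_exists f (by
    rintro ⟨⟨J, K⟩, ⟨j, hj⟩, ⟨k, hk⟩, hd⟩
    refine ⟨Pi.single (j, k) 1, ?_⟩
    have hne : ∀ j' ∈ J, ∀ k' ∈ K, ¬ (k' = j ∧ j' = k) := fun j' hj' k' hk' h =>
      Finset.disjoint_left.1 hd hj' (h.2 ▸ hk)
    have e : ∀ j' ∈ J, ∀ k' ∈ K, (Pi.single (j, k) (1 : ℚ) : ι × ι → ℚ) (j', k') -
        (Pi.single (j, k) (1 : ℚ) : ι × ι → ℚ) (k', j') = if j' = j then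
          (if k' = k then 1 else 0) else 0 := by
      intro j' hj' k' hk'
      have := hne j' hj' k' hk'
      simp only [Pi.single_apply, Prod.mk.injEq, this, if_false, sub_zero, ite_and]
    have : f ⟨(J, K), ⟨j, hj⟩, ⟨k, hk⟩, hd⟩ (Pi.single (j, k) 1) = 1 := by
      simp only [f, LinearMap.sum_apply, LinearMap.sub_apply, LinearMap.proj_apply]
      rw [Finset.sum_congr rfl fun j' hj' => Finset.sum_congr rfl fun k' hk' => e j' hj' k' hk']
      rw [Finset.sum_eq_single_of_mem j hj (fun j' _ h => by simp [h])]
      simp only [if_true]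
      rw [Finset.sum_ite_eq' K k, if_pos hk]
    rw [this]
    exact one_ne_zero)
  refine ⟨fun i j => x (i, j) - x (j, i), fun i j => by ring, fun J K hJ hK hd => ?_⟩
  have := hx ⟨(J, K), hJ, hK, hd⟩
  simp only [f, LinearMap.sum_apply, LinearMap.sub_apply, LinearMap.proj_apply] at this
  simp only [pairing]
  exact_mod_cast this

/-- Rational antisymmetric forms without zeros are dense among the rational antisymmetric forms. -/
theorem exists_seq_pairing_ne_zero [Finite ι] (wq : ι → ι → ℚ) (hw : ∀ i j, wq i j = -wq j i) :
    ∃ W : ℕ → ι → ι → ℚ, Tendsto (fun n i j => (W n i j : ℝ)) atTop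
        (𝓝 (fun i j => (wq i j : ℝ))) ∧ (∀ n i j, W n i j = -W n j i) ∧
      ∀ᶠ n in atTop, ∀ J K : Finset ι, J.Nonempty → K.Nonempty → Disjoint J K →
        pairing (fun i j => (W n i j : ℝ)) J K ≠ 0 := by
  obtain ⟨η, hη, hη0⟩ := exists_pairing_ne_zero (ι := ι)
  have hlim : Tendsto (fun (n : ℕ) i j => ((wq i j + 1 / ((n : ℚ) + 1) * η i j : ℚ) : ℝ)) atTop
        (𝓝 (fun i j => (wq i j : ℝ))) := by
    rw [tendsto_pi_nhds]; intro i
    rw [tendsto_pi_nhds]; intro j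
    have := (tendsto_one_div_add_atTop_nhds_zero_nat (𝕜 := ℝ)).mul_const (η i j : ℝ)
    have := this.const_add (wq i j : ℝ)
    simpa using this
  refine ⟨fun n i j => wq i j + 1 / ((n : ℚ) + 1) * η i j, hlim, fun n i j => ?_, ?_⟩
  · simp only
    rw [hw i j, hη i j]; ring
  rw [eventually_all]; intro J
  rw [eventually_all]; intro K
  by_cases h : pairing (fun i j => (wq i j : ℝ)) J K = 0
  · refine Eventually.of_forall fun n hJ hK hd h0 => ?_
    have e : pairing (fun i j => ((wq i j + 1 / ((n : ℚ) + 1) * η i j : ℚ) : ℝ)) J K =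
        pairing (fun i j => (wq i j : ℝ)) J K +
          1 / ((n : ℝ) + 1) * pairing (fun i j => (η i j : ℝ)) J K := by
      simp only [pairing, Finset.mul_sum, ← Finset.sum_add_distrib]
      push_cast
      rfl
    rw [e, h, zero_add] at h0
    rcases mul_eq_zero.1 h0 with h1 | h1
    · have : (0 : ℝ) < 1 / ((n : ℝ) + 1) := by positivity
      exact this.ne' h1
    · exact hη0 J K hJ hK hd h1
  · have h1 : Tendsto (fun n : ℕ => pairing
        (fun i j => ((wq i j + 1 / ((n : ℚ) + 1) * η i j : ℚ) : ℝ)) J K) atTop (𝓝 _) :=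
      ((continuous_pairing J K).tendsto _).comp hlim
    filter_upwards [h1.eventually_ne h] with n hn _ _ _ using hn

/-- The weighted number of flow trees on a flow line is the same for all the flow lines which
carry no degenerate flow tree. -/
theorem exists_topTreeSum_eq [Finite ι] (wq : ι → ι → ℚ) (hw : ∀ i j, wq i j = -wq j i)
    (Q : Finset ι → Finset ι → R) (hQ : IsCocycle Q) (I : Finset ι) (hI : 2 ≤ I.card)
    (hQ0 : ∀ J K : Finset ι, J.Nonempty → K.Nonempty → Disjoint J K → J ∪ K ⊆ I →
      pairing (fun i j => (wq i j : ℝ)) J K = 0 → commutator Q J K = 0) :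
    ∃ B : R, ∀ y : ι → ℝ, ∑ i ∈ I, y i = 0 →
      (∀ T ∈ binTrees I, T.Ordered (fun i j => (wq i j : ℝ)) →
        T.TopPositive (fun i j => (wq i j : ℝ)) y ∨ T.TopNegative (fun i j => (wq i j : ℝ)) y) →
      topTreeSum (fun i j => (wq i j : ℝ)) Q I y = B := by
  have unique : ∀ y y' : ι → ℝ, ∑ i ∈ I, y i = 0 → ∑ i ∈ I, y' i = 0 →
      (∀ T ∈ binTrees I, T.Ordered (fun i j => (wq i j : ℝ)) →
        T.TopPositive (fun i j => (wq i j : ℝ)) y ∨ T.TopNegative (fun i j => (wq i j : ℝ)) y) →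
      (∀ T ∈ binTrees I, T.Ordered (fun i j => (wq i j : ℝ)) →
        T.TopPositive (fun i j => (wq i j : ℝ)) y' ∨
          T.TopNegative (fun i j => (wq i j : ℝ)) y') →
      topTreeSum (fun i j => (wq i j : ℝ)) Q I y = topTreeSum (fun i j => (wq i j : ℝ)) Q I y' := by
    intro y y' hs hs' hy hy'
    -- Approximate the form first, then the two starting points by generic ones.
    obtain ⟨W, hlim, hWa, hW0⟩ := exists_seq_pairing_ne_zero wq hw
    have e := (eventually_topTreeSum_eq hQ0 hy)
    have e' := (eventually_topTreeSum_eq hQ0 hy')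
    rw [nhds_prod_eq] at e e'
    obtain ⟨n, h1, h2, h3⟩ := ((hlim.eventually e.curry).and
      ((hlim.eventually e'.curry).and hW0)).exists
    obtain ⟨C, hC⟩ := topTreeSum_const (W n) (hWa n) Q hQ I hI h3
    obtain ⟨u, hu, hu'⟩ := ((frequently_ratGeneric I hs).and_eventually h1).exists
    obtain ⟨v, hv, hv'⟩ := ((frequently_ratGeneric I hs').and_eventually h2).exists
    rw [← hu', ← hv', hC u hu, hC v hv]
  by_cases h : ∃ y : ι → ℝ, ∑ i ∈ I, y i = 0 ∧
      ∀ T ∈ binTrees I, T.Ordered (fun i j => (wq i j : ℝ)) →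
        T.TopPositive (fun i j => (wq i j : ℝ)) y ∨ T.TopNegative (fun i j => (wq i j : ℝ)) y
  · obtain ⟨y, hs, hy⟩ := h
    exact ⟨_, fun y' hs' hy' => unique y' y hs' hs hy' hy⟩
  · exact ⟨0, fun y hs hy => absurd ⟨y, hs, hy⟩ h⟩

end FlowTrees

/-! ### Rooted trees -/

/-- A graph presented as a tree with root `r`: every vertex `v ≠ r` has a parent, closer to the
root, and all the edges join a vertex to its parent. The root is its own parent, so that the parent
map can be iterated. -/
structure Rooting {V : Type*} (G : SimpleGraph V) (r : V) where
  parent : V → V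
  depth : V → ℕ
  parent_root : parent r = r
  adj_parent : ∀ v, v ≠ r → G.Adj (parent v) v
  depth_parent : ∀ v, v ≠ r → depth (parent v) < depth v
  eq_parent_of_adj : ∀ u v, G.Adj u v → (v ≠ r ∧ u = parent v) ∨ (u ≠ r ∧ v = parent u)

/-- The parent of a vertex is the next vertex on the path to the root, whose length is the depth. -/
theorem exists_rooting {V : Type*} {G : SimpleGraph V} (hG : G.IsTree) (r : V) :
    Nonempty (Rooting G r) := by
  choose p hp hu using fun v => hG.existsUnique_path v r
  have hr : p r = SimpleGraph.Walk.nil := (hu r _ SimpleGraph.Walk.IsPath.nil).symm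
  have hnil : ∀ v, v ≠ r → ¬ (p v).Nil := fun v hv h => hv h.eq
  have hadj : ∀ v, v ≠ r → G.Adj v (p v).snd := fun v hv => (p v).adj_snd (hnil v hv)
  refine ⟨⟨fun v => (p v).snd, fun v => (p v).length, by simp [hr], fun v hv => (hadj v hv).symm,
    fun v hv => ?_, fun u v huv => ?_⟩⟩
  · have h1 := hu _ _ ((hp v).tail)
    rw [← h1]
    have := SimpleGraph.Walk.length_tail_add_one (hnil v hv)
    omega
  · by_cases h : u ∈ (p v).support
    · refine Or.inl ⟨?_, hG.isAcyclic.eq_snd_of_adj_start (hp v) huv.symm h⟩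
      rintro rfl
      rw [hr] at h
      simp at h
      exact huv.ne h
    · have h' : v ∈ (p u).support := by
        have e : p u = SimpleGraph.Walk.cons huv (p v) :=
          (hu u _ ((SimpleGraph.Walk.cons_isPath_iff _ _).2 ⟨hp v, h⟩)).symm
        rw [e]
        simp
      refine Or.inr ⟨?_, hG.isAcyclic.eq_snd_of_adj_start (hp u) huv h'⟩
      rintro rfl
      rw [hr] at h'
      simp at h'
      exact huv.ne h'.symm

namespace Rooting

variable {V : Type*} {G : SimpleGraph V} {r : V} (ρ : Rooting G r)

theorem iterate_root (k : ℕ) : ρ.parent^[k] r = r := Function.iterate_fixed ρ.parent_root k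

theorem depth_iterate_le (k : ℕ) (v : V) : ρ.depth (ρ.parent^[k] v) ≤ ρ.depth v := by
  induction k generalizing v with
  | zero => exact le_rfl
  | succ k ih =>
    rw [Function.iterate_succ_apply]
    by_cases h : v = r
    · rw [h, ρ.parent_root, ρ.iterate_root]
    · exact (ih _).trans (ρ.depth_parent v h).le

theorem iterate_ne {k : ℕ} {v : V} (hv : v ≠ r) : ρ.parent^[k] (ρ.parent v) ≠ v := by
  intro h
  have h1 := ρ.depth_iterate_le k (ρ.parent v)
  rw [h] at h1
  exact (ρ.depth_parent v hv).not_ge h1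

theorem exists_iterate_eq_root (v : V) : ∃ k, ρ.parent^[k] v = r := by
  induction' hn : ρ.depth v using Nat.strong_induction_on with n ih generalizing v
  by_cases h : v = r
  · exact ⟨0, h⟩
  · obtain ⟨k, hk⟩ := ih _ (hn ▸ ρ.depth_parent v h) (ρ.parent v) rfl
    exact ⟨k + 1, hk⟩

/-- Induction from the leaves of a rooted tree to its root. -/
theorem induction_up [Finite V] {P : V → Prop}
    (h : ∀ v, (∀ w, w ≠ r → ρ.parent w = v → P w) → P v) (v : V) : P v := by
  obtain ⟨M, hM⟩ : ∃ M, ∀ v, ρ.depth v ≤ M := by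
    obtain ⟨M, hM⟩ := (Set.finite_range ρ.depth).bddAbove
    exact ⟨M, fun v => hM ⟨v, rfl⟩⟩
  induction' hn : M - ρ.depth v using Nat.strong_induction_on with n ih generalizing v
  refine h v fun w hw hwv => ih (M - ρ.depth w) ?_ w rfl
  have h1 := ρ.depth_parent w hw
  rw [hwv] at h1
  have h2 := hM w
  omega

/-- The parents are determined by the graph and the root. -/
theorem parent_eq (ρ' : Rooting G r) (v : V) : ρ.parent v = ρ'.parent v := by
  induction' hn : ρ'.depth v using Nat.strong_induction_on with n ih generalizing v
  by_cases h : v = r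
  · rw [h, ρ.parent_root, ρ'.parent_root]
  · rcases ρ.eq_parent_of_adj _ _ (ρ'.adj_parent v h) with h1 | h1
    · exact h1.2.symm
    · have h2 := ih _ (hn ▸ ρ'.depth_parent v h) (ρ'.parent v) rfl
      rw [← h1.2] at h2
      have h3 := ρ'.depth_parent _ h1.1
      have h4 := ρ'.depth_parent _ h
      rw [← h2] at h3
      omega

section Below

variable {X : Type*} [Fintype X] (att : X → V)

open Classical in
/-- For objects `x` attached to the vertices `att x` of a rooted tree: the objects which are
attached to the vertex `v` or to one of its descendants. -/
def below (v : V) : Finset X := Finset.univ.filter fun x => ∃ k, ρ.parent^[k] (att x) = v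

theorem mem_below {v : V} {x : X} : x ∈ ρ.below att v ↔ ∃ k, ρ.parent^[k] (att x) = v := by
  simp [below]

theorem mem_below_att (x : X) : x ∈ ρ.below att (att x) := (ρ.mem_below att).2 ⟨0, rfl⟩

theorem mem_below_root (x : X) : x ∈ ρ.below att r :=
  (ρ.mem_below att).2 (ρ.exists_iterate_eq_root _)

theorem below_subset_parent (v : V) : ρ.below att v ⊆ ρ.below att (ρ.parent v) := by
  intro x hx
  obtain ⟨k, hk⟩ := (ρ.mem_below att).1 hx
  exact (ρ.mem_below att).2 ⟨k + 1, by rw [Function.iterate_succ_apply', hk]⟩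

theorem below_subset_iterate (v : V) (k : ℕ) :
    ρ.below att v ⊆ ρ.below att (ρ.parent^[k] v) := by
  induction k with
  | zero => exact subset_rfl
  | succ k ih =>
    rw [Function.iterate_succ_apply']
    exact ih.trans (ρ.below_subset_parent att _)

/-- Two vertices above the same object are comparable. -/
theorem iterate_of_mem_below {u v : V} {x : X} (hu : x ∈ ρ.below att u)
    (hv : x ∈ ρ.below att v) : (∃ k, ρ.parent^[k] u = v) ∨ ∃ k, ρ.parent^[k] v = u := by
  obtain ⟨k, rfl⟩ := (ρ.mem_below att).1 hu
  obtain ⟨m, rfl⟩ := (ρ.mem_below att).1 hv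
  rcases le_total k m with h | h
  · left
    refine ⟨m - k, ?_⟩
    rw [← Function.iterate_add_apply, Nat.sub_add_cancel h]
  · right
    refine ⟨k - m, ?_⟩
    rw [← Function.iterate_add_apply, Nat.sub_add_cancel h]

variable [Fintype V]

open Classical in
/-- The children of a vertex. -/
def children (v : V) : Finset V := Finset.univ.filter fun w => w ≠ r ∧ ρ.parent w = v

theorem mem_children {v w : V} : w ∈ ρ.children v ↔ w ≠ r ∧ ρ.parent w = v := by
  simp [children]

theorem below_eq [DecidableEq V] [DecidableEq X] (v : V) : ρ.below att v =
    (Finset.univ.filter fun x => att x = v) ∪ (ρ.children v).biUnion (ρ.below att) := by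
  ext x
  simp only [mem_below, Finset.mem_union, Finset.mem_filter, Finset.mem_univ, true_and,
    Finset.mem_biUnion, mem_children]
  constructor
  · rintro ⟨k, hk⟩
    induction k with
    | zero => exact Or.inl hk
    | succ k ih =>
      rw [Function.iterate_succ_apply'] at hk
      by_cases h : ρ.parent^[k] (att x) = r
      · exact ih (by rw [h] at hk ⊢; rw [← hk, ρ.parent_root])
      · exact Or.inr ⟨_, ⟨h, hk⟩, k, rfl⟩
  · rintro (h | ⟨w, ⟨_, h⟩, k, hk⟩)
    · exact ⟨0, h⟩
    · exact ⟨k + 1, by rw [Function.iterate_succ_apply', hk, h]⟩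

theorem disjoint_below_of_children {v w w' : V} (hw : w ∈ ρ.children v) (hw' : w' ∈ ρ.children v)
    (h : w ≠ w') : Disjoint (ρ.below att w) (ρ.below att w') := by
  rw [mem_children] at hw hw'
  have key : ∀ {w w' : V}, ρ.parent w = v → w' ≠ r → ρ.parent w' = v → w ≠ w' →
      ¬ ∃ k, ρ.parent^[k] w = w' := by
    rintro w w' hw hw'' hw' h ⟨k, hk⟩
    cases k with
    | zero => exact h hk
    | succ k =>
      rw [Function.iterate_succ_apply, hw, ← hw'] at hk
      exact ρ.iterate_ne hw'' hk
  rw [Finset.disjoint_left]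
  intro x hx hx'
  rcases ρ.iterate_of_mem_below att hx hx' with h' | h'
  · exact key hw.2 hw'.1 hw'.2 h h'
  · exact key hw'.2 hw.1 hw.2 h.symm h'

theorem ne_of_mem_below_child {v w : V} {x : X} (hw : w ∈ ρ.children v)
    (hx : x ∈ ρ.below att w) : att x ≠ v := by
  rw [mem_children] at hw
  rintro rfl
  obtain ⟨k, hk⟩ := (ρ.mem_below att).1 hx
  rw [← hw.2] at hk
  exact ρ.iterate_ne hw.1 hk

@[to_additive]
theorem prod_below [DecidableEq V] {M : Type*} [CommMonoid M] (f : X → M) (v : V) :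
    ∏ x ∈ ρ.below att v, f x =
      (∏ x with att x = v, f x) * ∏ w ∈ ρ.children v, ∏ x ∈ ρ.below att w, f x := by
  classical
  rw [below_eq, Finset.prod_union, Finset.prod_biUnion]
  · intro w hw w' hw' h
    exact ρ.disjoint_below_of_children att hw hw' h
  · rw [Finset.disjoint_left]
    intro x hx hx'
    obtain ⟨w, hw, hx'⟩ := Finset.mem_biUnion.1 hx'
    exact ρ.ne_of_mem_below_child att hw hx' (Finset.mem_filter.1 hx).2

/-- A quantity attached to the vertices which is additive along the tree is a sum over the objects
below a vertex. -/
theorem eq_sum_below [DecidableEq V] {M : Type*} [AddCommMonoid M] (g : X → M) (f : V → M)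
    (hf : ∀ v, v ≠ r → f v = (∑ x with att x = v, g x) + ∑ w ∈ ρ.children v, f w)
    (v : V) (hv : v ≠ r) : f v = ∑ x ∈ ρ.below att v, g x := by
  revert hv
  induction v using ρ.induction_up with
  | h v ih =>
    intro hv
    rw [hf v hv, sum_below]
    congr 1
    refine Finset.sum_congr rfl fun w hw => ?_
    rw [mem_children] at hw
    exact ih w hw.1 hw.2 hw.1

end Below

open Classical in
/-- The edges at a vertex of a rooted tree with ends: the edges to the children, the edge to the
parent, and the ends. -/
theorem sum_direction {E : Type*} [Fintype E] {k : ℕ} {G : SimpleGraph (Fin k)} {r : Fin k}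
    (ρ : Rooting G r) (att : E → Fin k) (v : Fin k) [hfin : Fintype (Direction G att v)] {M : Type*}
    [AddCommMonoid M] (f : Fin k → M) (g : E → M) :
    ∑ d : Direction G att v, Sum.elim (fun w => f w.1) (fun e => g e.1) d =
      (∑ w ∈ ρ.children v, f w + if v = r then 0 else f (ρ.parent v)) +
        ∑ e with att e = v, g e := by
  have e1 : ∑ d : Direction G att v, Sum.elim (fun w => f w.1) (fun e => g e.1) d =
      ∑ w : {w // G.Adj v w}, f w.1 + ∑ e : {e // att e = v}, g e.1 := by
    rw [Subsingleton.elim hfin (instFintypeSum {w // G.Adj v w} {e // att e = v})]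
    exact Fintype.sum_sum_type _
  rw [e1]
  congr 1
  · rw [← Finset.sum_subtype (Finset.univ.filter fun w => G.Adj v w) (by simp) f]
    have e2 : (Finset.univ.filter fun w => G.Adj v w) =
        ρ.children v ∪ if v = r then ∅ else {ρ.parent v} := by
      ext w
      simp only [Finset.mem_filter, Finset.mem_univ, true_and, Finset.mem_union, mem_children]
      constructor
      · intro h
        rcases ρ.eq_parent_of_adj _ _ h with h | h
        · exact Or.inl ⟨h.1, h.2.symm⟩
        · right; rw [if_neg h.1, h.2]; simp
      · rintro (h | h)
        · rw [← h.2]; exact ρ.adj_parent w h.1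
        · split_ifs at h with hv
          · simp at h
          · rw [Finset.mem_singleton] at h
            rw [h]
            exact (ρ.adj_parent v hv).symm
    rw [e2, Finset.sum_union]
    · congr 1
      split_ifs <;> simp
    · rw [Finset.disjoint_left]
      intro w hw hw'
      split_ifs at hw' with hv
      · simp at hw'
      · rw [Finset.mem_singleton] at hw'
        rw [mem_children] at hw
        exact ρ.iterate_ne (k := 1) hv (by rw [← hw', Function.iterate_one, hw.2])
  · exact (Finset.sum_subtype (Finset.univ.filter fun e => att e = v) (by simp) g).symm

end Rooting

/-! ### Linear algebra of the form and of the bivectors -/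

section Forms

variable {N : Type*} [AddCommGroup N]

theorem twoForm_add_left (ω : TwoForm N) (a b c : N) : ω ![a + b, c] = ω ![a, c] + ω ![b, c] := by
  have key : ∀ x : N, Function.update ![0, c] 0 x = ![x, c] := fun x => by
    ext i; fin_cases i <;> rfl
  have h := ω.map_update_add ![0, c] 0 a b
  rwa [key, key, key] at h

theorem twoForm_add_right (ω : TwoForm N) (a b c : N) : ω ![a, b + c] = ω ![a, b] + ω ![a, c] :=
  map_add (contract ω a) b c

theorem twoForm_self (ω : TwoForm N) (a : N) : ω ![a, a] = 0 := contract_self ω a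

theorem twoForm_swap (ω : TwoForm N) (a b : N) : ω ![a, b] = -ω ![b, a] := by
  have h := twoForm_self ω (a + b)
  rw [twoForm_add_left, twoForm_add_right, twoForm_add_right, twoForm_self, twoForm_self] at h
  linarith

theorem twoForm_neg_right (ω : TwoForm N) (a b : N) : ω ![a, -b] = -ω ![a, b] :=
  map_neg (contract ω a) b

theorem twoForm_neg_left (ω : TwoForm N) (a b : N) : ω ![-a, b] = -ω ![a, b] := by
  rw [twoForm_swap, twoForm_neg_right, twoForm_swap ω a]

theorem twoForm_sum_right (ω : TwoForm N) {ι : Type*} (a : N) (J : Finset ι) (f : ι → N) :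
    ω ![a, ∑ j ∈ J, f j] = ∑ j ∈ J, ω ![a, f j] :=
  map_sum (contract ω a) f J

theorem twoForm_sum_left (ω : TwoForm N) {ι : Type*} (a : N) (J : Finset ι) (f : ι → N) :
    ω ![∑ j ∈ J, f j, a] = ∑ j ∈ J, ω ![f j, a] := by
  rw [twoForm_swap, twoForm_sum_right, ← Finset.sum_neg_distrib]
  exact Finset.sum_congr rfl fun _ _ => (twoForm_swap ω _ _).symm

theorem realContract_add (ω : TwoForm N) (a b : N) :
    realContract ω (a + b) = realContract ω a + realContract ω b := by
  apply LinearMap.restrictScalars_injective ℤ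
  apply TensorProduct.ext'
  intro t x
  change realContract ω (a + b) (t ⊗ₜ x) = realContract ω a (t ⊗ₜ x) + realContract ω b (t ⊗ₜ x)
  simp only [realContract, LinearMap.liftBaseChange_tmul]
  change t • ((ω ![a + b, x] : ℤ) : ℝ) = t • ((ω ![a, x] : ℤ) : ℝ) + t • ((ω ![b, x] : ℤ) : ℝ)
  rw [twoForm_add_left]
  push_cast
  rw [smul_add]

theorem realContract_zero (ω : TwoForm N) : realContract ω 0 = 0 := by
  have := realContract_add ω 0 0
  rw [add_zero] at this
  exact left_eq_add.1 this

theorem realContract_sum (ω : TwoForm N) {ι : Type*} (J : Finset ι) (f : ι → N) (p : RealSpace N) :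
    realContract ω (∑ j ∈ J, f j) p = ∑ j ∈ J, realContract ω (f j) p := by
  classical
  induction J using Finset.induction_on with
  | empty => simp [realContract_zero]
  | insert j J hj ih =>
    rw [Finset.sum_insert hj, Finset.sum_insert hj, realContract_add, LinearMap.add_apply, ih]

theorem wedge_add_left (a b c : N) : wedge (a + b) c = wedge a c + wedge b c := by
  have key : ∀ x : N, Function.update ![0, c] 0 x = ![x, c] := fun x => by
    ext i; fin_cases i <;> rfl
  have h := (exteriorPower.ιMulti ℤ 2 (M := N)).map_update_add ![0, c] 0 a b
  rwa [key, key, key] at h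

theorem wedge_add_right (a b c : N) : wedge a (b + c) = wedge a b + wedge a c := by
  have key : ∀ x : N, Function.update ![a, 0] 1 x = ![a, x] := fun x => by
    ext i; fin_cases i <;> rfl
  have h := (exteriorPower.ιMulti ℤ 2 (M := N)).map_update_add ![a, 0] 1 b c
  rwa [key, key, key] at h

theorem wedge_self (a : N) : wedge a a = 0 :=
  (exteriorPower.ιMulti ℤ 2 (M := N)).map_eq_zero_of_eq ![a, a] (i := 0) (j := 1) (by simp)
    (by decide)

theorem wedge_swap (a b : N) : wedge a b = -wedge b a := by
  have h := wedge_self (a + b)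
  rw [wedge_add_left, wedge_add_right, wedge_add_right, wedge_self, wedge_self, zero_add,
    add_zero] at h
  exact eq_neg_of_add_eq_zero_left h

theorem wedge_neg_right (a b : N) : wedge a (-b) = -wedge a b := by
  have h := wedge_add_right a b (-b)
  have h0 := wedge_add_right a 0 0
  rw [add_zero, left_eq_add] at h0
  rw [add_neg_cancel, h0] at h
  exact eq_neg_of_add_eq_zero_right h.symm

theorem wedge_neg_left (a b : N) : wedge (-a) b = -wedge a b := by
  rw [wedge_swap, wedge_neg_right, wedge_swap a]

/-- A lattice is flat over `ℤ`, so that the inclusion of `ℤ` in `ℝ` remains injective. -/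
theorem incl_injective [Module.Free ℤ N] : Function.Injective (incl N) := by
  have h : Function.Injective ((algebraMap ℤ ℝ).toIntAlgHom.toLinearMap : ℤ →ₗ[ℤ] ℝ) :=
    Int.cast_injective
  have h1 := Module.Flat.rTensor_preserves_injective_linearMap (M := N) _ h
  have e : (incl N : N → RealSpace N) = (LinearMap.rTensor N
      ((algebraMap ℤ ℝ).toIntAlgHom.toLinearMap : ℤ →ₗ[ℤ] ℝ)) ∘ (TensorProduct.lid ℤ N).symm := by
    funext x
    change (1 : ℝ) ⊗ₜ[ℤ] x = _
    simp
  rw [e]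
  exact h1.comp (TensorProduct.lid ℤ N).symm.injective

variable {E : Type*} (Δ : E → N) (ω : TwoForm N)

theorem qPow_add [Fintype E] (a b : ⋀[ℤ]^2 N) : qPow Δ ω (a + b) = qPow Δ ω a * qPow Δ ω b := by
  simp only [qPow, map_add]
  rw [AddMonoidAlgebra.single_mul_single, one_mul]

/-- The commutation factor `q^{n_J ∧ n_K}` of two clusters. -/
def commFactor [Fintype E] (J K : Finset E) : RefinedRing Δ ω :=
  qPow Δ ω (wedge (∑ j ∈ J, Δ j) (∑ k ∈ K, Δ k))

/-- Both sides of the cocycle relation are `q` to the power `n_A ∧ n_B + n_A ∧ n_C + n_B ∧ n_C`. -/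
theorem isCocycle_commFactor [Fintype E] [DecidableEq E] : IsCocycle (commFactor Δ ω) := by
  intro A B C hAB hAC hBC
  simp only [commFactor]
  rw [Finset.sum_union hBC, Finset.sum_union hAB, wedge_add_left, wedge_add_right, ← qPow_add,
    ← qPow_add]
  congr 1
  abel

/-- The matrix of the form in terms of the ends. -/
def endForm (i j : E) : ℝ := (ω ![Δ i, Δ j] : ℝ)

theorem pairing_endForm (J K : Finset E) :
    pairing (endForm Δ ω) J K = (ω ![∑ j ∈ J, Δ j, ∑ k ∈ K, Δ k] : ℝ) := by
  rw [twoForm_sum_left]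
  simp only [twoForm_sum_right]
  push_cast
  rfl

theorem endForm_swap (i j : E) : endForm Δ ω i j = -endForm Δ ω j i := by
  rw [endForm, endForm, twoForm_swap]
  push_cast
  rfl

/-- The defect `μ_e - ω(n_e, p)` of the moment of the end `e` at the point `p`. -/
def defect (μ : E → ℝ) (p : RealSpace N) (e : E) : ℝ := μ e - realContract ω (Δ e) p

theorem sum_defect (μ : E → ℝ) (p : RealSpace N) (J : Finset E) :
    ∑ e ∈ J, defect Δ ω μ p e = ∑ e ∈ J, μ e - realContract ω (∑ e ∈ J, Δ e) p := by
  rw [realContract_sum, ← Finset.sum_sub_distrib]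
  rfl

theorem defect_add_smul (μ : E → ℝ) (p : RealSpace N) (l : ℝ) (J : Finset E) (e : E) :
    defect Δ ω μ (p + l • incl N (∑ k ∈ J, Δ k)) e =
      defect Δ ω μ p e - l * ∑ k ∈ J, endForm Δ ω e k := by
  rw [defect, defect, map_add, map_smul, realContract_incl, twoForm_sum_right]
  push_cast
  rw [smul_eq_mul]
  simp only [endForm]
  ring

variable [DecidableEq E]

theorem sum_defect_add_smul (μ : E → ℝ) (p : RealSpace N) (l : ℝ) (J K : Finset E)
    (h : Disjoint J K) :
    ∑ e ∈ J, defect Δ ω μ (p + l • incl N (∑ k ∈ J ∪ K, Δ k)) e =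
      ∑ e ∈ J, defect Δ ω μ p e - l * pairing (endForm Δ ω) J K := by
  rw [Finset.sum_congr rfl fun e _ => defect_add_smul Δ ω μ p l (J ∪ K) e,
    Finset.sum_sub_distrib, ← Finset.mul_sum,
    Finset.sum_congr rfl fun e _ => Finset.sum_union h (f := endForm Δ ω e),
    Finset.sum_add_distrib]
  have := pairing_self (endForm_swap Δ ω) J
  rw [pairing] at this
  rw [this, zero_add]
  rfl

/-- Following an edge of slope `n_{J ∪ K}` from `p` to the point where the moment of `J` is
reached. -/
theorem advance_defect (μ : E → ℝ) (p : RealSpace N) (l : ℝ) (J K : Finset E)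
    (h : Disjoint J K) (h0 : pairing (endForm Δ ω) J K ≠ 0)
    (hJ : ∑ e ∈ J, defect Δ ω μ (p + l • incl N (∑ k ∈ J ∪ K, Δ k)) e = 0) :
    advance (endForm Δ ω) (defect Δ ω μ p) J K =
      defect Δ ω μ (p + l • incl N (∑ k ∈ J ∪ K, Δ k)) := by
  rw [sum_defect_add_smul _ _ _ _ _ _ _ h, sub_eq_zero] at hJ
  funext e
  rw [advance, hJ, mul_div_cancel_right₀ _ h0, defect_add_smul]

end Forms

/-- The sets of leaves of the subtrees with at least two leaves. -/
def BinTree.nodes {ι : Type*} [DecidableEq ι] : BinTree ι → Finset (Finset ι)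
  | .leaf _ => ∅
  | .node S T => insert (S.leaves ∪ T.leaves) (S.nodes ∪ T.nodes)

/-- `J` is the least element of the family `L` which strictly contains `X`. -/
def IsParentIn {ι : Type*} (L : Finset (Finset ι)) (X J : Finset ι) : Prop :=
  J ∈ L ∧ X ⊂ J ∧ ∀ J' ∈ L, X ⊂ J' → J ⊆ J'

theorem IsParentIn.unique {ι : Type*} {L : Finset (Finset ι)} {X J J' : Finset ι}
    (h : IsParentIn L X J) (h' : IsParentIn L X J') : J = J' :=
  (h.2.2 _ h'.1 h'.2.1).antisymm (h'.2.2 _ h.1 h.2.1)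

/-! ### The clusters of ends of a rooted curve -/

namespace Curve

variable {E N : Type*} [Fintype E] [AddCommGroup N] {Δ : E → N}

section Slopes

variable (c : Curve Δ)

open Classical in
/-- The slope of the edge from `u` to `v`, and zero if there is none. -/
def edgeSlope (u v : Fin c.numVert) : N := if h : c.graph.Adj u v then c.slope h else 0

open Classical in
/-- The length of the edge from `u` to `v`, and zero if there is none. -/
def edgeLen (u v : Fin c.numVert) : ℝ := if h : c.graph.Adj u v then c.length h else 0

theorem edgeLen_pos {u v : Fin c.numVert} (h : c.graph.Adj u v) : 0 < c.edgeLen u v := by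
  rw [edgeLen, dif_pos h]
  exact c.length_pos h

theorem edgeLen_symm (u v : Fin c.numVert) : c.edgeLen u v = c.edgeLen v u := by
  by_cases h : c.graph.Adj u v
  · rw [edgeLen, edgeLen, dif_pos h, dif_pos h.symm, c.length_symm]
  · rw [edgeLen, edgeLen, dif_neg h, dif_neg fun h' => h h'.symm]

theorem pos_eq {u v : Fin c.numVert} (h : c.graph.Adj u v) :
    c.pos v = c.pos u + c.edgeLen u v • incl N (c.edgeSlope u v) := by
  rw [edgeLen, edgeSlope, dif_pos h, dif_pos h]
  exact c.affine h

/-- The two slopes of an edge are determined by the positions of its vertices, as its length is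
positive. -/
theorem edgeSlope_symm [Module.Free ℤ N] (u v : Fin c.numVert) :
    c.edgeSlope v u = -c.edgeSlope u v := by
  by_cases h : c.graph.Adj u v
  · have h1 := c.pos_eq h
    have h2 := c.pos_eq h.symm
    rw [c.edgeLen_symm v u] at h2
    have h3 : c.edgeLen u v • incl N (c.edgeSlope u v + c.edgeSlope v u) = 0 := by
      rw [map_add, smul_add]
      have : c.pos u = c.pos u + (c.edgeLen u v • incl N (c.edgeSlope u v) +
          c.edgeLen u v • incl N (c.edgeSlope v u)) := by
        rw [← add_assoc, ← h1]
        exact h2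
      exact left_eq_add.1 this
    rw [smul_eq_zero_iff_right (c.edgeLen_pos h).ne'] at h3
    have h4 := incl_injective (h3.trans (map_zero _).symm)
    exact eq_neg_of_add_eq_zero_right h4
  · rw [edgeSlope, edgeSlope, dif_neg h, dif_neg fun h' => h h'.symm, neg_zero]

open Classical in
theorem sum_edgeSlope (v : Fin c.numVert) {r : Fin c.numVert} (ρ : Rooting c.graph r) :
    ∑ w ∈ ρ.children v, c.edgeSlope v w + (if v = r then 0 else c.edgeSlope v (ρ.parent v)) +
      ∑ e with c.endVert e = v, Δ e = 0 := by
  rw [← ρ.sum_direction c.endVert v (c.edgeSlope v) Δ, ← c.balanced v]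
  refine Finset.sum_congr rfl fun d _ => ?_
  rcases d with ⟨w, hw⟩ | e
  · simp only [Sum.elim_inl, edgeSlope, dif_pos hw]
  · rfl

theorem edgeSlope_parent_eq [Module.Free ℤ N] {r : Fin c.numVert} (ρ : Rooting c.graph r)
    (v : Fin c.numVert) (hv : v ≠ r) :
    c.edgeSlope (ρ.parent v) v = (∑ e with c.endVert e = v, Δ e) +
      ∑ w ∈ ρ.children v, c.edgeSlope (ρ.parent w) w := by
  have h := c.sum_edgeSlope v ρ
  rw [if_neg hv, c.edgeSlope_symm (ρ.parent v) v] at h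
  have e : ∑ w ∈ ρ.children v, c.edgeSlope (ρ.parent w) w =
      ∑ w ∈ ρ.children v, c.edgeSlope v w :=
    Finset.sum_congr rfl fun w hw => by rw [(ρ.mem_children.1 hw).2]
  rw [e]
  rw [add_right_comm, add_neg_eq_zero] at h
  rw [← h, add_comm]

end Slopes

section Clusters

variable (c : Curve Δ) {e₀ : E} (ρ : Rooting c.graph (c.endVert e₀))

theorem notMem_below_root {v : Fin c.numVert} (hv : v ≠ c.endVert e₀) :
    e₀ ∉ ρ.below c.endVert v := by
  rw [ρ.mem_below]
  rintro ⟨k, hk⟩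
  rw [ρ.iterate_root] at hk
  exact hv hk.symm

variable [DecidableEq E]

/-- The cluster of a vertex: the ends other than `e₀` which are separated from `e₀` by the
vertex. -/
def cluster (v : Fin c.numVert) : Finset E := (ρ.below c.endVert v).erase e₀

/-- The ends other than `e₀` attached to a vertex. -/
def endsAt (e₀ : E) (v : Fin c.numVert) : Finset E :=
  Finset.univ.filter fun e => e ≠ e₀ ∧ c.endVert e = v

theorem mem_endsAt {v : Fin c.numVert} {e : E} :
    e ∈ c.endsAt e₀ v ↔ e ≠ e₀ ∧ c.endVert e = v := by simp [endsAt]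

theorem mem_cluster {v : Fin c.numVert} {e : E} :
    e ∈ c.cluster ρ v ↔ e ≠ e₀ ∧ e ∈ ρ.below c.endVert v := by simp [cluster]

theorem cluster_eq_below {v : Fin c.numVert} (hv : v ≠ c.endVert e₀) :
    c.cluster ρ v = ρ.below c.endVert v :=
  Finset.erase_eq_of_notMem (c.notMem_below_root ρ hv)

theorem cluster_root : c.cluster ρ (c.endVert e₀) = Finset.univ.erase e₀ := by
  ext e
  rw [mem_cluster, Finset.mem_erase]
  simp [ρ.mem_below_root]

/-- The branches at a vertex, away from the root: the children and the ends. -/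
def branches (v : Fin c.numVert) : Finset (Fin c.numVert ⊕ E) :=
  (ρ.children v).disjSum (c.endsAt e₀ v)

/-- The cluster of a branch. -/
def branchCluster : Fin c.numVert ⊕ E → Finset E := Sum.elim (c.cluster ρ) (fun e => {e})

theorem sum_cluster {M : Type*} [AddCommMonoid M] (f : E → M) (v : Fin c.numVert) :
    ∑ e ∈ c.cluster ρ v, f e =
      ∑ x ∈ c.branches ρ v, ∑ e ∈ c.branchCluster ρ x, f e := by
  classical
  rw [branches, Finset.sum_disjSum]
  simp only [branchCluster, Sum.elim_inl, Sum.elim_inr, Finset.sum_singleton]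
  have e1 : ∀ J : Finset E, ∑ e ∈ J.erase e₀, f e = ∑ e ∈ J, if e = e₀ then 0 else f e := by
    intro J
    rw [← Finset.sum_erase J (f := fun e => if e = e₀ then 0 else f e) (a := e₀) (if_pos rfl)]
    exact Finset.sum_congr rfl fun e he => (if_neg (Finset.ne_of_mem_erase he)).symm
  simp only [cluster, e1]
  rw [ρ.sum_below, add_comm]
  congr 1
  rw [endsAt, Finset.sum_filter, Finset.sum_filter]
  refine Finset.sum_congr rfl fun e _ => ?_
  by_cases h1 : e = e₀ <;> simp [h1]

theorem mem_branches {v : Fin c.numVert} {x : Fin c.numVert ⊕ E} :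
    x ∈ c.branches ρ v ↔ (∃ w ∈ ρ.children v, x = .inl w) ∨ ∃ e ∈ c.endsAt e₀ v, x = .inr e := by
  rw [branches, Finset.mem_disjSum]
  simp only [eq_comm]

theorem valence_eq (v : Fin c.numVert) : c.valence v = (c.branches ρ v).card + 1 := by
  classical
  have : Fintype (Direction c.graph c.endVert v) := Fintype.ofFinite _
  have h := ρ.sum_direction c.endVert v (fun _ => 1) (fun _ => 1)
  have e : ∑ d : Direction c.graph c.endVert v, Sum.elim (fun _ => 1) (fun _ => 1) d =
      c.valence v := by
    rw [valence, Nat.card_eq_fintype_card, Fintype.card_eq_sum_ones]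
    refine Finset.sum_congr rfl fun d _ => ?_
    cases d <;> rfl
  rw [e] at h
  rw [h, branches, Finset.card_disjSum]
  simp only [Finset.sum_const, smul_eq_mul, mul_one]
  by_cases hv : v = c.endVert e₀
  · have : (Finset.univ.filter fun e => c.endVert e = v) = insert e₀ (c.endsAt e₀ v) := by
      ext e
      simp only [Finset.mem_filter, Finset.mem_univ, true_and, Finset.mem_insert, mem_endsAt]
      by_cases he : e = e₀ <;> simp [he, hv]
    rw [this, Finset.card_insert_of_notMem (by simp [mem_endsAt]), if_pos hv]
    ring
  · have : (Finset.univ.filter fun e => c.endVert e = v) = c.endsAt e₀ v := by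
      ext e
      simp only [Finset.mem_filter, Finset.mem_univ, true_and, mem_endsAt]
      exact ⟨fun h => ⟨fun he => hv (by rw [← h, he]), h⟩, fun h => h.2⟩
    rw [this, if_neg hv]
    ring

theorem two_le_card_branches (v : Fin c.numVert) : 2 ≤ (c.branches ρ v).card := by
  have h1 := c.three_le_valence v
  have h2 := c.valence_eq ρ v
  rw [valence, Dir] at h2
  omega

/-- Every vertex except the root and every end except `e₀` is a branch of exactly one vertex. -/
theorem sum_card_branches :
    ∑ v, (c.branches ρ v).card + 2 = c.numVert + Fintype.card E := by
  classical
  have h1 : ∑ v, (ρ.children v).card = c.numVert - 1 := by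
    have := Finset.card_eq_sum_card_fiberwise (s := Finset.univ.filter (· ≠ c.endVert e₀))
      (t := Finset.univ) (f := ρ.parent) (fun _ _ => Finset.mem_coe.2 (Finset.mem_univ _))
    rw [Finset.filter_ne', Finset.card_erase_of_mem (Finset.mem_univ _), Finset.card_univ,
      Fintype.card_fin] at this
    rw [this]
    refine Finset.sum_congr rfl fun v _ => congrArg _ ?_
    ext w
    simp [Rooting.mem_children]
  have h2 : ∑ v, (c.endsAt e₀ v).card = Fintype.card E - 1 := by
    have := Finset.card_eq_sum_card_fiberwise (s := Finset.univ.filter (· ≠ e₀))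
      (t := Finset.univ) (f := c.endVert) (fun _ _ => Finset.mem_coe.2 (Finset.mem_univ _))
    rw [Finset.filter_ne', Finset.card_erase_of_mem (Finset.mem_univ _), Finset.card_univ] at this
    rw [this]
    refine Finset.sum_congr rfl fun v _ => congrArg _ ?_
    ext w
    simp [mem_endsAt]
  simp only [branches, Finset.card_disjSum, Finset.sum_add_distrib, h1, h2]
  have h3 : 0 < c.numVert := (c.endVert e₀).pos
  have h4 : 0 < Fintype.card E := Fintype.card_pos_iff.2 ⟨e₀⟩
  omega

theorem numVert_add_two_le (e₀ : E) : c.numVert + 2 ≤ Fintype.card E := by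
  obtain ⟨ρ⟩ := exists_rooting c.isTree (c.endVert e₀)
  have h1 := c.sum_card_branches ρ
  have h2 : ∑ _v : Fin c.numVert, 2 ≤ ∑ v, (c.branches ρ v).card :=
    Finset.sum_le_sum fun v _ => c.two_le_card_branches ρ v
  rw [Finset.sum_const, Finset.card_univ, Fintype.card_fin, smul_eq_mul] at h2
  omega

/-- The trivalent curves are those with the largest number of vertices. -/
theorem trivalent_iff (e₀ : E) : c.Trivalent ↔ c.numVert + 2 = Fintype.card E := by
  obtain ⟨ρ⟩ := exists_rooting c.isTree (c.endVert e₀)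
  have h1 := c.sum_card_branches ρ
  have h3 : ∑ _v : Fin c.numVert, 2 = c.numVert * 2 := by
    rw [Finset.sum_const, Finset.card_univ, Fintype.card_fin, smul_eq_mul]
  constructor
  · intro h
    have h2 : ∑ v, (c.branches ρ v).card = ∑ _v : Fin c.numVert, 2 :=
      Finset.sum_congr rfl fun v _ => by
        have := c.valence_eq ρ v
        rw [h v] at this
        omega
    omega
  · intro h v
    have h2 : ∑ _v : Fin c.numVert, 2 = ∑ v, (c.branches ρ v).card := by omega
    have := (Finset.sum_eq_sum_iff_of_le fun v _ => c.two_le_card_branches ρ v).1 h2 v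
      (Finset.mem_univ v)
    rw [c.valence_eq ρ v, ← this]

theorem card_cluster (v : Fin c.numVert) : (c.cluster ρ v).card =
    ∑ x ∈ c.branches ρ v, (c.branchCluster ρ x).card := by
  simp only [Finset.card_eq_sum_ones]
  exact c.sum_cluster ρ _ v

theorem two_le_card_cluster (v : Fin c.numVert) : 2 ≤ (c.cluster ρ v).card := by
  induction v using ρ.induction_up with
  | h v ih =>
    rw [card_cluster]
    have h : ∑ x ∈ c.branches ρ v, 1 ≤ ∑ x ∈ c.branches ρ v, (c.branchCluster ρ x).card := by
      refine Finset.sum_le_sum fun x hx => ?_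
      rcases (c.mem_branches ρ).1 hx with ⟨w, hw, rfl⟩ | ⟨e, he, rfl⟩
      · rw [Rooting.mem_children] at hw
        have := ih w hw.1 hw.2
        simp only [branchCluster, Sum.elim_inl]
        omega
      · simp [branchCluster]
    rw [Finset.sum_const, smul_eq_mul, mul_one] at h
    exact (c.two_le_card_branches ρ v).trans h

theorem branchCluster_nonempty (x : Fin c.numVert ⊕ E) : (c.branchCluster ρ x).Nonempty := by
  cases x with
  | inl w =>
    have := c.two_le_card_cluster ρ w
    exact Finset.card_pos.1 (by simp only [branchCluster, Sum.elim_inl]; omega)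
  | inr e => simp [branchCluster]

theorem cluster_eq_biUnion (v : Fin c.numVert) :
    c.cluster ρ v = (c.branches ρ v).biUnion (c.branchCluster ρ) := by
  ext e
  rw [Finset.mem_biUnion, mem_cluster, ρ.below_eq]
  simp only [Finset.mem_union, Finset.mem_filter, Finset.mem_univ, true_and, Finset.mem_biUnion,
    mem_branches]
  constructor
  · rintro ⟨h, h' | ⟨w, hw, h'⟩⟩
    · exact ⟨.inr e, Or.inr ⟨e, (c.mem_endsAt).2 ⟨h, h'⟩, rfl⟩, by simp [branchCluster]⟩
    · exact ⟨.inl w, Or.inl ⟨w, hw, rfl⟩, (c.mem_cluster ρ).2 ⟨h, h'⟩⟩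
  · rintro ⟨x, ⟨w, hw, rfl⟩ | ⟨e', he', rfl⟩, h⟩
    · have := (c.mem_cluster ρ).1 h
      exact ⟨this.1, Or.inr ⟨w, hw, this.2⟩⟩
    · simp only [branchCluster, Sum.elim_inr, Finset.mem_singleton] at h
      subst h
      exact ⟨((c.mem_endsAt).1 he').1, Or.inl ((c.mem_endsAt).1 he').2⟩

theorem disjoint_branchCluster {v : Fin c.numVert} {x y : Fin c.numVert ⊕ E}
    (hx : x ∈ c.branches ρ v) (hy : y ∈ c.branches ρ v) (h : x ≠ y) :
    Disjoint (c.branchCluster ρ x) (c.branchCluster ρ y) := by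
  rw [mem_branches] at hx hy
  have aux : ∀ {w : Fin c.numVert} {e : E}, w ∈ ρ.children v → e ∈ c.endsAt e₀ v →
      e ∉ c.cluster ρ w := fun hw he h =>
    ρ.ne_of_mem_below_child c.endVert hw ((c.mem_cluster ρ).1 h).2 ((c.mem_endsAt).1 he).2
  rcases hx with ⟨w, hw, rfl⟩ | ⟨e, he, rfl⟩ <;> rcases hy with ⟨w', hw', rfl⟩ | ⟨e', he', rfl⟩
  · exact Finset.disjoint_of_subset_left (Finset.erase_subset _ _)
      (Finset.disjoint_of_subset_right (Finset.erase_subset _ _)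
        (ρ.disjoint_below_of_children c.endVert hw hw' (fun h' => h (by rw [h']))))
  · exact Finset.disjoint_singleton_right.2 (aux hw he')
  · exact Finset.disjoint_singleton_left.2 (aux hw' he)
  · simp only [branchCluster, Sum.elim_inr, Finset.disjoint_singleton]
    exact fun h' => h (by rw [h'])

theorem branchCluster_ssubset {v : Fin c.numVert} {x : Fin c.numVert ⊕ E}
    (hx : x ∈ c.branches ρ v) : c.branchCluster ρ x ⊂ c.cluster ρ v := by
  classical
  have hs : c.branchCluster ρ x ⊆ c.cluster ρ v := by
    rw [cluster_eq_biUnion]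
    exact Finset.subset_biUnion_of_mem _ hx
  refine hs.ssubset_of_ne fun h => ?_
  obtain ⟨y, hy, hne⟩ := Finset.exists_mem_ne (c.two_le_card_branches ρ v) x
  obtain ⟨e, he⟩ := c.branchCluster_nonempty ρ y
  have h1 : e ∈ c.cluster ρ v := by
    rw [cluster_eq_biUnion]
    exact Finset.mem_biUnion.2 ⟨y, hy, he⟩
  rw [← h] at h1
  exact Finset.disjoint_left.1 (c.disjoint_branchCluster ρ hy hx hne) he h1

theorem cluster_ssubset_parent {v : Fin c.numVert} (hv : v ≠ c.endVert e₀) :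
    c.cluster ρ v ⊂ c.cluster ρ (ρ.parent v) :=
  c.branchCluster_ssubset ρ (x := .inl v)
    ((c.mem_branches ρ).2 (Or.inl ⟨v, (ρ.mem_children).2 ⟨hv, rfl⟩, rfl⟩))

theorem cluster_subset_iterate (v : Fin c.numVert) (k : ℕ) :
    c.cluster ρ v ⊆ c.cluster ρ (ρ.parent^[k] v) :=
  Finset.erase_subset_erase _ (ρ.below_subset_iterate _ _ _)

theorem cluster_nonempty (v : Fin c.numVert) : (c.cluster ρ v).Nonempty :=
  c.branchCluster_nonempty ρ (.inl v)

theorem cluster_injective : Function.Injective (c.cluster ρ) := by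
  have key : ∀ {u : Fin c.numVert} {k : ℕ}, c.cluster ρ u = c.cluster ρ (ρ.parent^[k] u) →
      u = ρ.parent^[k] u := by
    intro u k h
    cases k with
    | zero => rfl
    | succ k =>
      by_cases hu : u = c.endVert e₀
      · rw [hu, ρ.iterate_root]
      · rw [Function.iterate_succ_apply] at h
        have h1 := c.cluster_ssubset_parent ρ hu
        rw [h] at h1
        exact absurd (c.cluster_subset_iterate ρ (ρ.parent u) k) h1.2
  intro u v h
  obtain ⟨e, he⟩ := c.cluster_nonempty ρ u
  have he' := he
  rw [h] at he'
  rcases ρ.iterate_of_mem_below _ ((c.mem_cluster ρ).1 he).2 ((c.mem_cluster ρ).1 he').2 with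
    ⟨k, rfl⟩ | ⟨k, rfl⟩
  · exact key h
  · exact (key h.symm).symm

/-- The family of the clusters of a curve. -/
def clusters : Finset (Finset E) := Finset.univ.image (c.cluster ρ)

theorem mem_clusters {J : Finset E} : J ∈ c.clusters ρ ↔ ∃ v, c.cluster ρ v = J := by
  simp [clusters]

theorem card_clusters : (c.clusters ρ).card = c.numVert := by
  rw [clusters, Finset.card_image_of_injective _ (c.cluster_injective ρ), Finset.card_univ,
    Fintype.card_fin]

/-- The parent of a vertex can be recovered from the clusters. -/
theorem isParentIn_clusters {v : Fin c.numVert} (hv : v ≠ c.endVert e₀) :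
    IsParentIn (c.clusters ρ) (c.cluster ρ v) (c.cluster ρ (ρ.parent v)) := by
  refine ⟨(c.mem_clusters ρ).2 ⟨_, rfl⟩, c.cluster_ssubset_parent ρ hv, fun J hJ h => ?_⟩
  obtain ⟨u, rfl⟩ := (c.mem_clusters ρ).1 hJ
  obtain ⟨e, he⟩ := c.cluster_nonempty ρ v
  rcases ρ.iterate_of_mem_below _ ((c.mem_cluster ρ).1 he).2 ((c.mem_cluster ρ).1 (h.1 he)).2 with
    ⟨k, rfl⟩ | ⟨k, rfl⟩
  · cases k with
    | zero => exact absurd subset_rfl h.2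
    | succ k =>
      rw [Function.iterate_succ_apply]
      exact c.cluster_subset_iterate ρ _ k
  · exact absurd (c.cluster_subset_iterate ρ u k) h.2

theorem isParentIn_clusters_singleton {e : E} (he : e ≠ e₀) :
    IsParentIn (c.clusters ρ) {e} (c.cluster ρ (c.endVert e)) := by
  refine ⟨(c.mem_clusters ρ).2 ⟨_, rfl⟩, c.branchCluster_ssubset ρ (x := .inr e)
    ((c.mem_branches ρ).2 (Or.inr ⟨e, (c.mem_endsAt).2 ⟨he, rfl⟩, rfl⟩)), fun J hJ h => ?_⟩
  obtain ⟨u, rfl⟩ := (c.mem_clusters ρ).1 hJ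
  obtain ⟨k, rfl⟩ := (ρ.mem_below c.endVert).1
    ((c.mem_cluster ρ).1 (h.1 (Finset.mem_singleton_self e))).2
  exact c.cluster_subset_iterate ρ _ k

end Clusters

end Curve

namespace Curve

variable {E N : Type*} [Fintype E] [AddCommGroup N] {Δ : E → N}

/-! ### Slopes, moments and multiplicities in terms of clusters -/

section Moments

theorem realContract_self (ω : TwoForm N) (a : N) : realContract ω a (incl N a) = 0 := by
  rw [realContract_incl, twoForm_self, Int.cast_zero]

/-- At a vertex with outgoing slopes `a`, `b` and `-(a + b)`, the positive one of the two bivectors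
`± a ∧ b` does not depend on the pair of slopes that is used to define it. -/
theorem wedge_eq_of_triangle (ω : TwoForm N) {a b u v : N} (hab : 0 < ω ![a, b])
    (hu : u = -(a + b) ∨ u = a ∨ u = b) (hv : v = -(a + b) ∨ v = a ∨ v = b)
    (huv : 0 < ω ![u, v]) : wedge u v = wedge a b := by
  have h1 := twoForm_swap ω b a
  have h2 := wedge_swap b a
  rcases hu with rfl | rfl | rfl <;> rcases hv with rfl | rfl | rfl <;>
    simp only [twoForm_neg_left, twoForm_neg_right, twoForm_add_left, twoForm_add_right,
      twoForm_self, wedge_neg_left, wedge_neg_right, wedge_add_left, wedge_add_right,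
      wedge_self, h1, h2] at huv hab ⊢ <;>
    first
    | (exfalso; linarith)
    | abel

theorem twoForm_eq_zero_of_triangle (ω : TwoForm N) {a b u v : N} (hab : ω ![a, b] = 0)
    (hu : u = -(a + b) ∨ u = a ∨ u = b) (hv : v = -(a + b) ∨ v = a ∨ v = b) :
    ω ![u, v] = 0 := by
  have h1 := twoForm_swap ω b a
  rcases hu with rfl | rfl | rfl <;> rcases hv with rfl | rfl | rfl <;>
    simp only [twoForm_neg_left, twoForm_neg_right, twoForm_add_left, twoForm_add_right,
      twoForm_self, h1, hab, neg_zero, add_zero]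

variable (c : Curve Δ) {e₀ : E}

/-- A point `p` above the image of the end `e` lies on the line of this end, so that the vertex
of the end can be reached from it. -/
theorem exists_smul_add_eq_of_ev {e : E} {p : RealSpace N}
    (h : c.ev e = (Submodule.span ℝ {incl N (Δ e)}).mkQ p) :
    ∃ s : ℝ, c.pos (c.endVert e) = p + s • incl N (-Δ e) := by
  rw [ev, ← sub_eq_zero, ← map_sub, Submodule.mkQ_apply, Submodule.Quotient.mk_eq_zero,
    Submodule.mem_span_singleton] at h
  obtain ⟨s, hs⟩ := h
  refine ⟨-s, ?_⟩
  rw [map_neg, smul_neg, neg_smul, neg_neg, hs]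
  abel

variable [DecidableEq E]

theorem sum_erase_end (hsum : ∑ e, Δ e = 0) : ∑ e ∈ Finset.univ.erase e₀, Δ e = -Δ e₀ := by
  rw [← Finset.add_sum_erase _ _ (Finset.mem_univ e₀)] at hsum
  exact eq_neg_of_add_eq_zero_right hsum

variable (ρ : Rooting c.graph (c.endVert e₀))

theorem exists_branches_eq {v : Fin c.numVert} (hv : c.valence v = 3) :
    ∃ x y, x ≠ y ∧ c.branches ρ v = {x, y} ∧
      Disjoint (c.branchCluster ρ x) (c.branchCluster ρ y) ∧
      c.cluster ρ v = c.branchCluster ρ x ∪ c.branchCluster ρ y := by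
  have h := c.valence_eq ρ v
  have h2 : (c.branches ρ v).card = 2 := by omega
  obtain ⟨x, y, hxy, hb⟩ := Finset.card_eq_two.1 h2
  refine ⟨x, y, hxy, hb, c.disjoint_branchCluster ρ (v := v) (by simp [hb]) (by simp [hb]) hxy, ?_⟩
  rw [cluster_eq_biUnion, hb]
  simp

variable [Module.Free ℤ N]

theorem edgeSlope_parent (v : Fin c.numVert) (hv : v ≠ c.endVert e₀) :
    c.edgeSlope (ρ.parent v) v = ∑ e ∈ c.cluster ρ v, Δ e := by
  rw [c.cluster_eq_below ρ hv]
  exact ρ.eq_sum_below c.endVert Δ (fun v => c.edgeSlope (ρ.parent v) v)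
    (c.edgeSlope_parent_eq ρ) v hv

theorem pos_parent (v : Fin c.numVert) (hv : v ≠ c.endVert e₀) :
    c.pos v = c.pos (ρ.parent v) +
      c.edgeLen (ρ.parent v) v • incl N (∑ e ∈ c.cluster ρ v, Δ e) := by
  rw [← c.edgeSlope_parent ρ v hv]
  exact c.pos_eq (ρ.adj_parent v hv)

theorem realContract_parent (ω : TwoForm N) (v : Fin c.numVert) (hv : v ≠ c.endVert e₀) :
    realContract ω (∑ e ∈ c.cluster ρ v, Δ e) (c.pos v) =
      realContract ω (∑ e ∈ c.cluster ρ v, Δ e) (c.pos (ρ.parent v)) := by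
  rw [c.pos_parent ρ v hv, map_add, map_smul, realContract_self, smul_zero, add_zero]

/-- The moment of a bounded edge is the sum of the moments of the ends behind it. -/
theorem realContract_cluster (ω : TwoForm N) (v : Fin c.numVert) (hv : v ≠ c.endVert e₀) :
    realContract ω (∑ e ∈ c.cluster ρ v, Δ e) (c.pos v) = ∑ e ∈ c.cluster ρ v, c.moment ω e := by
  classical
  rw [← c.edgeSlope_parent ρ v hv, c.cluster_eq_below ρ hv]
  refine ρ.eq_sum_below c.endVert (c.moment ω)
    (fun v => realContract ω (c.edgeSlope (ρ.parent v) v) (c.pos v)) (fun v hv => ?_) v hv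
  rw [c.edgeSlope_parent_eq ρ v hv, realContract_add, LinearMap.add_apply, realContract_sum,
    realContract_sum]
  congr 1
  · refine Finset.sum_congr rfl fun e he => ?_
    rw [moment, (Finset.mem_filter.1 he).2]
  · refine Finset.sum_congr rfl fun w hw => ?_
    rw [Rooting.mem_children] at hw
    rw [c.edgeSlope_parent ρ w hw.1, c.realContract_parent ρ ω w hw.1, hw.2]

/-- At a vertex the moments of all its branches are reached. -/
theorem sum_defect_branch (ω : TwoForm N) {v : Fin c.numVert} {x : Fin c.numVert ⊕ E}
    (hx : x ∈ c.branches ρ v) :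
    ∑ e ∈ c.branchCluster ρ x, defect Δ ω (c.moment ω) (c.pos v) e = 0 := by
  rw [sum_defect, sub_eq_zero]
  rcases (c.mem_branches ρ).1 hx with ⟨w, hw, rfl⟩ | ⟨e, he, rfl⟩
  · rw [Rooting.mem_children] at hw
    simp only [branchCluster, Sum.elim_inl]
    rw [← c.realContract_cluster ρ ω w hw.1, c.realContract_parent ρ ω w hw.1, hw.2]
  · simp only [branchCluster, Sum.elim_inr, Finset.sum_singleton]
    rw [moment, ((c.mem_endsAt).1 he).2]

theorem exists_dir {v : Fin c.numVert} {x : Fin c.numVert ⊕ E}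
    (hx : x ∈ c.branches ρ v) : ∃ d : c.Dir v, c.outSlope v d = ∑ e ∈ c.branchCluster ρ x, Δ e := by
  rcases (c.mem_branches ρ).1 hx with ⟨w, hw, rfl⟩ | ⟨e, he, rfl⟩
  · rw [Rooting.mem_children] at hw
    have h := ρ.adj_parent w hw.1
    rw [hw.2] at h
    refine ⟨.inl ⟨w, h⟩, ?_⟩
    simp only [branchCluster, Sum.elim_inl]
    rw [← c.edgeSlope_parent ρ w hw.1, hw.2, edgeSlope, dif_pos h]
    rfl
  · refine ⟨.inr ⟨e, ((c.mem_endsAt).1 he).2⟩, ?_⟩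
    simp only [branchCluster, Sum.elim_inr, Finset.sum_singleton]
    rfl

/-- The outgoing slopes at a vertex are those of its branches and the opposite of their sum. -/
theorem outSlope_cases (hsum : ∑ e, Δ e = 0) (v : Fin c.numVert) (d : c.Dir v) :
    c.outSlope v d = -∑ e ∈ c.cluster ρ v, Δ e ∨
      ∃ x ∈ c.branches ρ v, c.outSlope v d = ∑ e ∈ c.branchCluster ρ x, Δ e := by
  rcases d with ⟨w, hw⟩ | ⟨e, he⟩
  · have e1 : c.outSlope v (.inl ⟨w, hw⟩) = c.edgeSlope v w := by
      rw [edgeSlope, dif_pos hw]; rfl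
    rw [e1]
    rcases ρ.eq_parent_of_adj _ _ hw with h | h
    · right
      refine ⟨.inl w, (c.mem_branches ρ).2 (Or.inl ⟨w, ρ.mem_children.2 ⟨h.1, h.2.symm⟩, rfl⟩), ?_⟩
      simp only [branchCluster, Sum.elim_inl]
      rw [← c.edgeSlope_parent ρ w h.1, ← h.2]
    · left
      rw [← c.edgeSlope_parent ρ v h.1, ← h.2, c.edgeSlope_symm w v]
  · by_cases h : e = e₀
    · subst h
      left
      subst he
      rw [cluster_root, sum_erase_end hsum, neg_neg]
      rfl
    · right
      refine ⟨.inr e, (c.mem_branches ρ).2 (Or.inr ⟨e, (c.mem_endsAt).2 ⟨h, he⟩, rfl⟩), ?_⟩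
      simp only [branchCluster, Sum.elim_inr, Finset.sum_singleton]
      rfl

theorem outSlope_cases_of_branches (hsum : ∑ e, Δ e = 0) {v : Fin c.numVert}
    {x y : Fin c.numVert ⊕ E} (hxy : x ≠ y) (hb : c.branches ρ v = {x, y}) (d : c.Dir v) :
    c.outSlope v d = -(∑ e ∈ c.branchCluster ρ x, Δ e + ∑ e ∈ c.branchCluster ρ y, Δ e) ∨
      c.outSlope v d = ∑ e ∈ c.branchCluster ρ x, Δ e ∨
      c.outSlope v d = ∑ e ∈ c.branchCluster ρ y, Δ e := by
  have h := c.outSlope_cases ρ hsum v d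
  rw [c.sum_cluster, hb, Finset.sum_pair hxy] at h
  rcases h with h | ⟨z, hz, h⟩
  · exact Or.inl h
  · rw [Finset.mem_insert, Finset.mem_singleton] at hz
    rcases hz with rfl | rfl
    · exact Or.inr (Or.inl h)
    · exact Or.inr (Or.inr h)

theorem vertexFactor_eq_commutator (hsum : ∑ e, Δ e = 0) (ω : TwoForm N) {v : Fin c.numVert}
    {x y : Fin c.numVert ⊕ E} (hxy : x ≠ y) (hb : c.branches ρ v = {x, y})
    (hpos : 0 < pairing (endForm Δ ω) (c.branchCluster ρ x) (c.branchCluster ρ y)) :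
    c.vertexFactor ω v =
      commutator (commFactor Δ ω) (c.branchCluster ρ x) (c.branchCluster ρ y) := by
  rw [pairing_endForm] at hpos
  have hpos' : 0 < ω ![∑ e ∈ c.branchCluster ρ x, Δ e, ∑ e ∈ c.branchCluster ρ y, Δ e] := by
    exact_mod_cast hpos
  obtain ⟨d₁, h₁⟩ := c.exists_dir ρ (v := v) (x := x) (by simp [hb])
  obtain ⟨d₂, h₂⟩ := c.exists_dir ρ (v := v) (x := y) (by simp [hb])
  have h : ∃ p : c.Dir v × c.Dir v, 0 < ω ![c.outSlope v p.1, c.outSlope v p.2] :=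
    ⟨(d₁, d₂), by rwa [h₁, h₂]⟩
  rw [vertexFactor, dif_pos h, wedge_eq_of_triangle ω hpos'
    (c.outSlope_cases_of_branches ρ hsum hxy hb _)
    (c.outSlope_cases_of_branches ρ hsum hxy hb _) h.choose_spec, ← wedge_swap]
  rfl

/-- The definition of the vertex factor requires a pair of slopes with a positive form, so that the
factor is zero if there is none. -/
theorem vertexFactor_eq_zero (hsum : ∑ e, Δ e = 0) (ω : TwoForm N) {v : Fin c.numVert}
    {x y : Fin c.numVert ⊕ E} (hxy : x ≠ y) (hb : c.branches ρ v = {x, y})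
    (h0 : pairing (endForm Δ ω) (c.branchCluster ρ x) (c.branchCluster ρ y) = 0) :
    c.vertexFactor ω v = 0 := by
  rw [pairing_endForm] at h0
  have h0' : ω ![∑ e ∈ c.branchCluster ρ x, Δ e, ∑ e ∈ c.branchCluster ρ y, Δ e] = 0 := by
    exact_mod_cast h0
  rw [vertexFactor, dif_neg]
  rintro ⟨p, hp⟩
  rw [twoForm_eq_zero_of_triangle ω h0'
    (c.outSlope_cases_of_branches ρ hsum hxy hb _)
    (c.outSlope_cases_of_branches ρ hsum hxy hb _)] at hp
  exact lt_irrefl _ hp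

end Moments

/-! ### The flow tree of a trivalent curve -/

section Extraction

variable [DecidableEq E] (c : Curve Δ) {e₀ : E} (ρ : Rooting c.graph (c.endVert e₀))

/-- The product of the vertex factors over a branch. -/
def branchMult (ω : TwoForm N) : Fin c.numVert ⊕ E → RefinedRing Δ ω :=
  Sum.elim (fun w => ∏ u ∈ ρ.below id w, c.vertexFactor ω u) (fun _ => 1)

/-- The clusters of the vertices of a branch. -/
def branchNodes : Fin c.numVert ⊕ E → Finset (Finset E) :=
  Sum.elim (fun w => (ρ.below id w).image (c.cluster ρ)) (fun _ => ∅)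

theorem branchMult_inl (ω : TwoForm N) (v : Fin c.numVert) :
    c.branchMult ρ ω (.inl v) =
      c.vertexFactor ω v * ∏ x ∈ c.branches ρ v, c.branchMult ρ ω x := by
  rw [branches, Finset.prod_disjSum]
  simp only [branchMult, Sum.elim_inl, Sum.elim_inr, Finset.prod_const_one, mul_one]
  rw [ρ.prod_below]
  congr 1
  simp [Finset.filter_eq']

theorem branchNodes_inl (v : Fin c.numVert) : c.branchNodes ρ (.inl v) =
    insert (c.cluster ρ v) ((c.branches ρ v).biUnion (c.branchNodes ρ)) := by
  have e : (c.branches ρ v).biUnion (c.branchNodes ρ) =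
      (ρ.children v).biUnion fun w => c.branchNodes ρ (.inl w) := by
    ext J
    simp only [Finset.mem_biUnion, mem_branches]
    constructor
    · rintro ⟨x, ⟨w, hw, rfl⟩ | ⟨e, he, rfl⟩, h⟩
      · exact ⟨w, hw, h⟩
      · simp [branchNodes] at h
    · rintro ⟨w, hw, h⟩
      exact ⟨_, Or.inl ⟨w, hw, rfl⟩, h⟩
  rw [e]
  simp only [branchNodes, Sum.elim_inl]
  ext J
  simp only [Finset.mem_image, Finset.mem_insert, Finset.mem_biUnion]
  constructor
  · rintro ⟨u, hu, rfl⟩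
    rw [ρ.below_eq, Finset.mem_union, Finset.mem_filter, Finset.mem_biUnion] at hu
    rcases hu with ⟨-, rfl⟩ | ⟨w, hw, hu⟩
    · exact Or.inl rfl
    · exact Or.inr ⟨w, hw, u, hu, rfl⟩
  · rintro (rfl | ⟨w, hw, u, hu, rfl⟩)
    · exact ⟨v, ρ.mem_below_att id v, rfl⟩
    · refine ⟨u, ?_, rfl⟩
      rw [ρ.below_eq]
      exact Finset.mem_union_right _ (Finset.mem_biUnion.2 ⟨w, hw, hu⟩)

variable [Module.Free ℤ N]

/-- The flow tree of the part of a trivalent curve behind a vertex `v`. -/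
theorem exists_vertexTree (hsum : ∑ e, Δ e = 0) (ω : TwoForm N) (hc : c.Trivalent)
    (hm : ∀ v x y, x ≠ y → c.branches ρ v = {x, y} →
      pairing (endForm Δ ω) (c.branchCluster ρ x) (c.branchCluster ρ y) ≠ 0)
    (v : Fin c.numVert) :
    ∃ S T : BinTree E, BinTree.node S T ∈ binTrees (c.cluster ρ v) ∧
      0 < pairing (endForm Δ ω) S.leaves T.leaves ∧
      S.Positive (endForm Δ ω) (defect Δ ω (c.moment ω) (c.pos v)) ∧
      T.Positive (endForm Δ ω) (defect Δ ω (c.moment ω) (c.pos v)) ∧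
      ∑ e ∈ S.leaves, defect Δ ω (c.moment ω) (c.pos v) e = 0 ∧
      (BinTree.node S T).nodes = c.branchNodes ρ (.inl v) ∧
      (BinTree.node S T).mult (commFactor Δ ω) = c.branchMult ρ ω (.inl v) := by
  induction v using ρ.induction_up with
  | h v ih =>
    have branch : ∀ x ∈ c.branches ρ v, ∃ T ∈ binTrees (c.branchCluster ρ x),
        T.Positive (endForm Δ ω) (defect Δ ω (c.moment ω) (c.pos v)) ∧
        T.nodes = c.branchNodes ρ x ∧ T.mult (commFactor Δ ω) = c.branchMult ρ ω x := by
      intro x hx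
      rcases (c.mem_branches ρ).1 hx with ⟨w, hw, rfl⟩ | ⟨e, he, rfl⟩
      · rw [Rooting.mem_children] at hw
        obtain ⟨S, T, h1, h2, h3, h4, h5, h6, h7⟩ := ih w hw.1 hw.2
        refine ⟨_, h1, ?_, h6, h7⟩
        have hST := node_mem_binTrees_iff.1 h1
        have hpos := c.pos_parent ρ w hw.1
        rw [hw.2, ← hST.2.2.2.1] at hpos
        have hlen : 0 < c.edgeLen v w := by
          have := ρ.adj_parent w hw.1
          rw [hw.2] at this
          exact c.edgeLen_pos this
        rw [hpos] at h3 h4 h5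
        refine ⟨h2, ?_, ?_, ?_⟩
        · rw [sum_defect_add_smul _ _ _ _ _ _ _ hST.1, sub_eq_zero] at h5
          rw [h5]
          exact mul_pos hlen h2
        · rwa [advance_defect Δ ω _ _ _ _ _ hST.1 h2.ne' h5]
        · rwa [advance_defect Δ ω _ _ _ _ _ hST.1 h2.ne' h5]
      · refine ⟨.leaf e, ?_, trivial, rfl, rfl⟩
        rw [leaf_mem_binTrees]
        rfl
    -- The two branches are ordered so that the form is positive.
    obtain ⟨x, y, hxy, hb, hd, hu, hp⟩ : ∃ x y, x ≠ y ∧ c.branches ρ v = {x, y} ∧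
        Disjoint (c.branchCluster ρ x) (c.branchCluster ρ y) ∧
        c.cluster ρ v = c.branchCluster ρ x ∪ c.branchCluster ρ y ∧
        0 < pairing (endForm Δ ω) (c.branchCluster ρ x) (c.branchCluster ρ y) := by
      obtain ⟨x, y, hxy, hb, hd, hu⟩ := c.exists_branches_eq ρ (hc v)
      rcases lt_trichotomy (pairing (endForm Δ ω) (c.branchCluster ρ x) (c.branchCluster ρ y)) 0
        with h | h | h
      · refine ⟨y, x, hxy.symm, by rw [hb, Finset.pair_comm], hd.symm,
          by rw [hu, Finset.union_comm], ?_⟩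
        rw [pairing_swap (endForm_swap Δ ω)]
        linarith
      · exact absurd h (hm v x y hxy hb)
      · exact ⟨x, y, hxy, hb, hd, hu, h⟩
    have hx : x ∈ c.branches ρ v := by simp [hb]
    have hy : y ∈ c.branches ρ v := by simp [hb]
    obtain ⟨S, hS, hSp, hSn, hSm⟩ := branch x hx
    obtain ⟨T, hT, hTp, hTn, hTm⟩ := branch y hy
    have lS := leaves_of_mem_binTrees hS
    have lT := leaves_of_mem_binTrees hT
    refine ⟨S, T, ?_, ?_, hSp, hTp, ?_, ?_, ?_⟩
    · rw [node_mem_binTrees_iff, lS, lT]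
      exact ⟨hd, c.branchCluster_nonempty ρ x, c.branchCluster_nonempty ρ y, hu.symm, hS, hT⟩
    · rwa [lS, lT]
    · rw [lS]
      exact c.sum_defect_branch ρ ω hx
    · rw [BinTree.nodes, lS, lT, hSn, hTn, branchNodes_inl, hb, hu]
      congr 1
      simp
    · rw [BinTree.mult, lS, lT, hSm, hTm, branchMult_inl, hb, Finset.prod_pair hxy,
        c.vertexFactor_eq_commutator ρ hsum ω hxy hb hp, mul_assoc]

/-- A trivalent curve without vertices whose bivector is orthogonal to `ω` comes from a flow tree,
which has the same clusters and the same multiplicity. -/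
theorem exists_tree (hsum : ∑ e, Δ e = 0) (ω : TwoForm N) (hc : c.Trivalent)
    (hm : ∀ v x y, x ≠ y → c.branches ρ v = {x, y} →
      pairing (endForm Δ ω) (c.branchCluster ρ x) (c.branchCluster ρ y) ≠ 0)
    {p : RealSpace N}
    (hp : c.ev e₀ = (Submodule.span ℝ {incl N (Δ e₀)}).mkQ p) :
    ∃ T ∈ binTrees (Finset.univ.erase e₀),
      T.TopPositive (endForm Δ ω) (defect Δ ω (c.moment ω) p) ∧ T.nodes = c.clusters ρ ∧
      T.mult (commFactor Δ ω) = c.refinedMult ω := by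
  have hall : ρ.below id (c.endVert e₀) = Finset.univ := by
    ext v; simp only [Finset.mem_univ, iff_true]; exact ρ.mem_below_root id v
  obtain ⟨S, T, h1, h2, h3, h4, h5, h6, h7⟩ := c.exists_vertexTree ρ hsum ω hc hm (c.endVert e₀)
  rw [cluster_root] at h1
  have hST := node_mem_binTrees_iff.1 h1
  obtain ⟨s, hs⟩ := c.exists_smul_add_eq_of_ev hp
  rw [← sum_erase_end hsum, ← hST.2.2.2.1] at hs
  rw [hs] at h3 h4 h5
  refine ⟨_, h1, ⟨h2, ?_, ?_⟩, ?_, ?_⟩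
  · rwa [advance_defect Δ ω _ _ _ _ _ hST.1 h2.ne' h5]
  · rwa [advance_defect Δ ω _ _ _ _ _ hST.1 h2.ne' h5]
  · rw [h6, branchNodes, Sum.elim_inl, hall]
    rfl
  · rw [h7, branchMult, Sum.elim_inl, hall]
    rfl

/-- The form does not vanish at the vertices of a curve of non-zero multiplicity. -/
theorem pairing_ne_zero_of_refinedMult (hsum : ∑ e, Δ e = 0) (ω : TwoForm N)
    (hm : c.refinedMult ω ≠ 0) (v : Fin c.numVert) (x y : Fin c.numVert ⊕ E) (hxy : x ≠ y)
    (hb : c.branches ρ v = {x, y}) :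
    pairing (endForm Δ ω) (c.branchCluster ρ x) (c.branchCluster ρ y) ≠ 0 := fun h =>
  hm (Finset.prod_eq_zero (Finset.mem_univ v) (c.vertexFactor_eq_zero ρ hsum ω hxy hb h))

end Extraction

/-! ### The clusters determine the combinatorial type -/

theorem Rooting.adj_iff {V : Type*} {G : SimpleGraph V} {r : V} (ρ : Rooting G r) {u v : V} :
    G.Adj u v ↔ (v ≠ r ∧ u = ρ.parent v) ∨ (u ≠ r ∧ v = ρ.parent u) := by
  refine ⟨ρ.eq_parent_of_adj u v, ?_⟩
  rintro (⟨h, rfl⟩ | ⟨h, rfl⟩)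
  · exact ρ.adj_parent v h
  · exact (ρ.adj_parent u h).symm

/-- The vertices are in bijection with the clusters, the parent of a vertex is given by the least
cluster that strictly contains its own, and the vertex of an end `e ≠ e₀` by the least cluster that
contains `e`. -/
theorem sameType_of_clusters_eq [DecidableEq E] (c c' : Curve Δ) {e₀ : E}
    (ρ : Rooting c.graph (c.endVert e₀)) (ρ' : Rooting c'.graph (c'.endVert e₀))
    (h : c.clusters ρ = c'.clusters ρ') : c.SameType c' := by
  have ex : ∀ v, ∃ v', c'.cluster ρ' v' = c.cluster ρ v := fun v =>
    (c'.mem_clusters ρ').1 (h ▸ (c.mem_clusters ρ).2 ⟨v, rfl⟩)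
  have ex' : ∀ v', ∃ v, c.cluster ρ v = c'.cluster ρ' v' := fun v =>
    (c.mem_clusters ρ).1 (h ▸ (c'.mem_clusters ρ').2 ⟨v, rfl⟩)
  choose f hf using ex
  choose g hg using ex'
  have hroot : f (c.endVert e₀) = c'.endVert e₀ :=
    c'.cluster_injective ρ' (by rw [hf, cluster_root, cluster_root])
  let φ : Fin c.numVert ≃ Fin c'.numVert :=
    ⟨f, g, fun v => c.cluster_injective ρ (by rw [hg, hf]),
      fun v => c'.cluster_injective ρ' (by rw [hf, hg])⟩
  have hr : ∀ v, f v = c'.endVert e₀ ↔ v = c.endVert e₀ := fun v => by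
    rw [← hroot]; exact φ.injective.eq_iff
  have hparent : ∀ v, v ≠ c.endVert e₀ → f (ρ.parent v) = ρ'.parent (f v) := by
    intro v hv
    apply c'.cluster_injective ρ'
    have h1 := c.isParentIn_clusters ρ hv
    have h2 := c'.isParentIn_clusters ρ' (v := f v) (fun h => hv ((hr v).1 h))
    rw [hf] at h2 ⊢
    rw [h] at h1
    exact h1.unique h2
  refine ⟨⟨φ, fun {u v} => ?_⟩, fun e => ?_⟩
  · change c'.graph.Adj (f u) (f v) ↔ _
    rw [Rooting.adj_iff ρ', Rooting.adj_iff ρ]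
    simp only [ne_eq, hr]
    have h1 : ∀ {u v}, ¬ v = c.endVert e₀ → (f u = ρ'.parent (f v) ↔ u = ρ.parent v) :=
      fun {u v} hv => by rw [← hparent v hv]; exact φ.injective.eq_iff
    constructor
    · rintro (⟨a, b⟩ | ⟨a, b⟩)
      · exact Or.inl ⟨a, (h1 a).1 b⟩
      · exact Or.inr ⟨a, (h1 a).1 b⟩
    · rintro (⟨a, b⟩ | ⟨a, b⟩)
      · exact Or.inl ⟨a, (h1 a).2 b⟩
      · exact Or.inr ⟨a, (h1 a).2 b⟩
  · change c'.endVert e = f (c.endVert e)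
    by_cases he : e = e₀
    · rw [he, hroot]
    · apply c'.cluster_injective ρ'
      have h1 := c.isParentIn_clusters_singleton ρ he
      have h2 := c'.isParentIn_clusters_singleton ρ' he
      rw [h] at h1
      rw [hf]
      exact h2.unique h1

end Curve

/-! ### Construction of curves from laminar families -/

/-- A rooted graph is a tree. -/
theorem Rooting.isTree {V : Type*} [Finite V] {G : SimpleGraph V} {r : V} (ρ : Rooting G r) :
    G.IsTree := by
  rw [SimpleGraph.isTree_iff_connected_and_card]
  constructor
  · have hr : ∀ v, G.Reachable v r := by
      intro v
      induction' hn : ρ.depth v using Nat.strong_induction_on with n ih generalizing v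
      by_cases h : v = r
      · rw [h]
      · exact (ρ.adj_parent v h).symm.reachable.trans (ih _ (hn ▸ ρ.depth_parent v h) _ rfl)
    have : Nonempty V := ⟨r⟩
    exact ⟨fun u v => (hr u).trans (hr v).symm⟩
  · let f : {v // v ≠ r} → G.edgeSet := fun v => ⟨s(ρ.parent v.1, v.1), ρ.adj_parent v.1 v.2⟩
    have hf : Function.Bijective f := by
      constructor
      · rintro ⟨v, hv⟩ ⟨w, hw⟩ h
        have h' : s(ρ.parent v, v) = s(ρ.parent w, w) := congrArg Subtype.val h
        rw [Sym2.eq_iff] at h'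
        rcases h' with h' | ⟨h1, h2⟩
        · exact Subtype.ext h'.2
        · have h3 := ρ.depth_parent v hv
          have h4 := ρ.depth_parent w hw
          rw [h1] at h3
          rw [← h2] at h4
          omega
      · rintro ⟨e, he⟩
        induction e with
        | _ u v =>
          rcases ρ.eq_parent_of_adj u v he with ⟨h1, h2⟩ | ⟨h1, h2⟩
          · exact ⟨⟨v, h1⟩, Subtype.ext (by simp [f, h2])⟩
          · exact ⟨⟨u, h1⟩, Subtype.ext (by simp [f, h2, Sym2.eq_swap])⟩
    rw [← Nat.card_eq_of_bijective f hf]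
    have := Fintype.ofFinite V
    classical
    rw [Nat.card_eq_fintype_card, Nat.card_eq_fintype_card, Fintype.card_subtype_compl]
    simp only [Fintype.card_unique]
    have : 0 < Fintype.card V := Fintype.card_pos_iff.2 ⟨r⟩
    omega

/-- The families of clusters of rooted trees whose ends other than the root end `e₀` are labelled
by the elements of `E` other than `e₀`. -/
structure IsClusterFamily {E : Type*} [Fintype E] [DecidableEq E] (e₀ : E)
    (L : Finset (Finset E)) : Prop where
  top_mem : Finset.univ.erase e₀ ∈ L
  notMem : ∀ I ∈ L, e₀ ∉ I
  laminar : ∀ I ∈ L, ∀ J ∈ L, I ⊆ J ∨ J ⊆ I ∨ Disjoint I J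
  two_le_card : ∀ I ∈ L, 2 ≤ I.card

namespace IsClusterFamily

variable {E : Type*} [Fintype E] [DecidableEq E] {e₀ : E} {L : Finset (Finset E)}

theorem subset_top (hL : IsClusterFamily e₀ L) {I : Finset E} (hI : I ∈ L) :
    I ⊆ Finset.univ.erase e₀ := fun e he =>
  Finset.mem_erase.2 ⟨fun h => hL.notMem I hI (h ▸ he), Finset.mem_univ e⟩

theorem exists_isParentIn (hL : IsClusterFamily e₀ L) {X : Finset E} (hX : X.Nonempty)
    (h : X ⊂ Finset.univ.erase e₀) : ∃ J, IsParentIn L X J := by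
  obtain ⟨J, hJ, hmin⟩ := Finset.exists_min_image (L.filter (X ⊂ ·)) Finset.card
    ⟨_, Finset.mem_filter.2 ⟨hL.top_mem, h⟩⟩
  rw [Finset.mem_filter] at hJ
  refine ⟨J, hJ.1, hJ.2, fun J' hJ' hX' => ?_⟩
  rcases hL.laminar J hJ.1 J' hJ' with h | h | h
  · exact h
  · exact (Finset.eq_of_subset_of_card_le h
      (hmin J' (Finset.mem_filter.2 ⟨hJ', hX'⟩))).symm.subset
  · obtain ⟨x, hx⟩ := hX
    exact absurd (hX'.1 hx) (Finset.disjoint_left.1 h (hJ.2.1 hx))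

end IsClusterFamily

/-- The vertices of the curve to be constructed are numbered, one for each cluster of the family;
this is the cluster of a vertex. -/
def familyCluster {E : Type*} (L : Finset (Finset E)) (v : Fin L.card) : Finset E :=
  (L.equivFin.symm v).1

theorem familyCluster_mem {E : Type*} (L : Finset (Finset E)) (v : Fin L.card) :
    familyCluster L v ∈ L := (L.equivFin.symm v).2

theorem familyCluster_injective {E : Type*} (L : Finset (Finset E)) :
    Function.Injective (familyCluster L) :=
  Subtype.val_injective.comp L.equivFin.symm.injective

theorem exists_familyCluster_eq {E : Type*} {L : Finset (Finset E)} {I : Finset E} (hI : I ∈ L) :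
    ∃ v, familyCluster L v = I :=
  ⟨L.equivFin ⟨I, hI⟩, by simp [familyCluster]⟩

/-- A laminar family defines a tree: the parent of a cluster is the least cluster that strictly
contains it. -/
theorem IsClusterFamily.exists_rooting {E : Type*} [Fintype E] [DecidableEq E] {e₀ : E}
    {L : Finset (Finset E)} (hL : IsClusterFamily e₀ L) :
    ∃ (G : SimpleGraph (Fin L.card)) (r : Fin L.card) (ρ : Rooting G r),
      familyCluster L r = Finset.univ.erase e₀ ∧
      ∀ v, v ≠ r → IsParentIn L (familyCluster L v) (familyCluster L (ρ.parent v)) := by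
  classical
  obtain ⟨r, hr⟩ := exists_familyCluster_eq hL.top_mem
  have hne : ∀ v, v ≠ r → familyCluster L v ⊂ Finset.univ.erase e₀ := fun v hv =>
    (hL.subset_top (familyCluster_mem L v)).ssubset_of_ne
      fun h => hv (familyCluster_injective L (h.trans hr.symm))
  have hnon : ∀ v, (familyCluster L v).Nonempty := fun v => by
    have := hL.two_le_card _ (familyCluster_mem L v)
    exact Finset.card_pos.1 (by omega)
  have ex : ∀ v, ∃ u, (v = r → u = r) ∧
      (v ≠ r → IsParentIn L (familyCluster L v) (familyCluster L u)) := by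
    intro v
    by_cases h : v = r
    · exact ⟨r, fun _ => rfl, fun h' => absurd h h'⟩
    · obtain ⟨J, hJ⟩ := hL.exists_isParentIn (hnon v) (hne v h)
      obtain ⟨u, rfl⟩ := exists_familyCluster_eq hJ.1
      exact ⟨u, fun h' => absurd h' h, fun _ => hJ⟩
  choose par hpar using ex
  have hpne : ∀ v, v ≠ r → par v ≠ v := fun v hv h => by
    have := ((hpar v).2 hv).2.1
    rw [h] at this
    exact absurd subset_rfl this.2
  let G : SimpleGraph (Fin L.card) :=
    { Adj := fun u v => (v ≠ r ∧ u = par v) ∨ (u ≠ r ∧ v = par u)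
      symm := ⟨fun u v h => h.symm⟩
      loopless := ⟨fun v h => by
        rcases h with h | h <;> exact hpne v h.1 h.2.symm⟩ }
  refine ⟨G, r, ⟨par, fun v => Fintype.card E - (familyCluster L v).card, (hpar r).1 rfl,
    fun v hv => Or.inl ⟨hv, rfl⟩, fun v hv => ?_, fun u v h => h⟩, hr, fun v hv => (hpar v).2 hv⟩
  have h1 := Finset.card_lt_card ((hpar v).2 hv).2.1
  have h2 := Finset.card_le_univ (familyCluster L (par v))
  omega

section Construction

variable {E N : Type*} [Fintype E] [AddCommGroup N] {Δ : E → N} [DecidableEq E] {e₀ : E}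
  {L : Finset (Finset E)}

/-- A laminar family, positions of the vertices and lengths of the edges which are compatible
define a curve. -/
theorem IsClusterFamily.exists_curve (hL : IsClusterFamily e₀ L) (hsum : ∑ e, Δ e = 0)
    (P : Finset E → RealSpace N) (len : Finset E → ℝ)
    (hlen : ∀ I ∈ L, I ≠ Finset.univ.erase e₀ → 0 < len I)
    (hP : ∀ I ∈ L, ∀ J, IsParentIn L I J → P I = P J + len I • incl N (∑ e ∈ I, Δ e)) :
    ∃ (c : Curve Δ) (ρ : Rooting c.graph (c.endVert e₀)), c.clusters ρ = L ∧
      ∀ v, c.pos v = P (c.cluster ρ v) := by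
  classical
  obtain ⟨G, r, ρ, hr, hpar⟩ := hL.exists_rooting
  set cl := familyCluster L with hcl
  have hmem : ∀ v, cl v ∈ L := familyCluster_mem L
  have htop : ∀ v, v ≠ r → cl v ≠ Finset.univ.erase e₀ := fun v hv h =>
    hv (familyCluster_injective L (h.trans hr.symm))
  have ex : ∀ e, ∃ v, (e = e₀ → v = r) ∧ (e ≠ e₀ → IsParentIn L {e} (cl v)) := by
    intro e
    by_cases h : e = e₀
    · exact ⟨r, fun _ => rfl, fun h' => absurd h h'⟩
    · have hs : {e} ⊂ Finset.univ.erase e₀ := by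
        have h2 := hL.two_le_card _ hL.top_mem
        refine LE.le.ssubset_of_ne (by simp [h]) fun h' => ?_
        rw [← h', Finset.card_singleton] at h2
        omega
      obtain ⟨J, hJ⟩ := hL.exists_isParentIn (Finset.singleton_nonempty e) hs
      obtain ⟨v, rfl⟩ := exists_familyCluster_eq hJ.1
      exact ⟨v, fun h' => absurd h' h, fun _ => hJ⟩
  choose att hatt using ex
  have hatt0 : att e₀ = r := (hatt e₀).1 rfl
  have hsub : ∀ u v, cl u ⊆ cl v → ∃ k, ρ.parent^[k] u = v := by
    intro u
    induction' hn : ρ.depth u using Nat.strong_induction_on with n ih generalizing u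
    intro v huv
    rcases huv.eq_or_ssubset with h | h
    · exact ⟨0, familyCluster_injective L h⟩
    · have hu : u ≠ r := by
        rintro rfl
        rw [hr] at h
        exact h.2 (hL.subset_top (hmem v))
      obtain ⟨k, hk⟩ := ih _ (hn ▸ ρ.depth_parent u hu) _ rfl v ((hpar u hu).2.2 _ (hmem v) h)
      exact ⟨k + 1, hk⟩
  have hmono : ∀ k u, cl u ⊆ cl (ρ.parent^[k] u) := by
    intro k
    induction k with
    | zero => exact fun u => subset_rfl
    | succ k ih =>
      intro u
      rw [Function.iterate_succ_apply]
      refine subset_trans ?_ (ih _)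
      by_cases hu : u = r
      · rw [hu, ρ.parent_root]
      · exact (hpar u hu).2.1.1
  -- The clusters of the tree are the members of the family.
  have hbelow : ∀ v, (ρ.below att v).erase e₀ = cl v := by
    intro v
    ext e
    rw [Finset.mem_erase, ρ.mem_below]
    constructor
    · rintro ⟨he, k, rfl⟩
      exact hmono k _ (((hatt e).2 he).2.1.1 (Finset.mem_singleton_self e))
    · intro he
      have hne : e ≠ e₀ := fun h => hL.notMem _ (hmem v) (h ▸ he)
      refine ⟨hne, hsub _ _ (((hatt e).2 hne).2.2 _ (hmem v) ?_)⟩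
      refine LE.le.ssubset_of_ne (by simpa using he) fun h' => ?_
      have h2 := hL.two_le_card _ (hmem v)
      rw [← h', Finset.card_singleton] at h2
      omega
  have hbelow' : ∀ v, v ≠ r → ρ.below att v = cl v := by
    intro v hv
    rw [← hbelow v, Finset.erase_eq_of_notMem]
    rw [ρ.mem_below]
    rintro ⟨k, hk⟩
    rw [hatt0, ρ.iterate_root] at hk
    exact hv hk.symm
  have hbelowr : ρ.below att r = Finset.univ := by
    ext e; simp only [Finset.mem_univ, iff_true]; exact ρ.mem_below_root att e
  have hss : ∀ {u v}, G.Adj u v → (u ≠ r ∧ v = ρ.parent u ∧ cl u ⊂ cl v) ∨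
      (v ≠ r ∧ u = ρ.parent v ∧ cl v ⊂ cl u) := by
    intro u v h
    rcases ρ.eq_parent_of_adj u v h with ⟨h1, h2⟩ | ⟨h1, h2⟩
    · exact Or.inr ⟨h1, h2, h2 ▸ (hpar v h1).2.1⟩
    · exact Or.inl ⟨h1, h2, h2 ▸ (hpar u h1).2.1⟩
  have hnot : ∀ {I J : Finset E}, I ⊂ J → ¬ J ⊂ I := fun h h' => h.2 h'.1
  -- The slope from `u` to `v` is the sum of the slopes behind the edge, with a sign if `u` is the
  -- child; `sl` only matters for adjacent vertices.
  let sl : Fin L.card → Fin L.card → N := fun u v =>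
    if cl u ⊂ cl v then -∑ e ∈ cl u, Δ e else ∑ e ∈ cl v, Δ e
  have hchild : ∀ v, ∑ w ∈ ρ.children v, sl v w =
      ∑ w ∈ ρ.children v, ∑ e ∈ ρ.below att w, Δ e := fun v => by
    refine Finset.sum_congr rfl fun w hw => ?_
    rw [Rooting.mem_children] at hw
    have := (hpar w hw.1).2.1
    rw [hw.2] at this
    simp only [sl]
    rw [if_neg (hnot this), hbelow' w hw.1]
  have hval : ∀ v, 3 ≤ Nat.card (Direction G att v) := by
    intro v
    have : Fintype (Direction G att v) := Fintype.ofFinite _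
    have h := ρ.sum_direction att v (fun _ => 1) (fun _ => 1)
    have e1 : ∑ d : Direction G att v, Sum.elim (fun _ => 1) (fun _ => 1) d =
        Nat.card (Direction G att v) := by
      rw [Nat.card_eq_fintype_card, Fintype.card_eq_sum_ones]
      exact Finset.sum_congr rfl fun d _ => by cases d <;> rfl
    rw [e1] at h
    rw [h]
    have h2 := ρ.sum_below att (fun _ => 1) v
    simp only [Finset.sum_const, smul_eq_mul, mul_one] at h2 ⊢
    have hlt : ∀ w ∈ ρ.children v, (cl w).card < (cl v).card := fun w hw => by
      rw [Rooting.mem_children] at hw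
      have := (hpar w hw.1).2.1
      rw [hw.2] at this
      exact Finset.card_lt_card this
    have hcw : ∀ w ∈ ρ.children v, (ρ.below att w).card = (cl w).card := fun w hw => by
      rw [hbelow' w (ρ.mem_children.1 hw).1]
    rw [Finset.sum_congr rfl hcw] at h2
    have h2c := hL.two_le_card _ (hmem v)
    -- Without children, at least two ends are attached to `v`; with a single child, whose cluster is
    -- strictly smaller, at least one end is. The root end or the parent accounts for the third
    -- direction.
    rcases Nat.lt_trichotomy (ρ.children v).card 1 with h0 | h0 | h0
    · have h0' : ρ.children v = ∅ := by rw [← Finset.card_eq_zero]; omega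
      rw [h0', Finset.sum_empty, add_zero] at h2
      by_cases hv : v = r
      · subst hv
        rw [← hbelow v, hbelowr, Finset.card_erase_of_mem (Finset.mem_univ _)] at h2c
        rw [hbelowr] at h2
        omega
      · rw [hbelow' v hv] at h2
        rw [if_neg hv]
        omega
    · obtain ⟨w, hw⟩ := Finset.card_eq_one.1 h0
      have hlw := hlt w (by simp [hw])
      rw [hw, Finset.sum_singleton] at h2
      by_cases hv : v = r
      · subst hv
        rw [← hbelow v, hbelowr, Finset.card_erase_of_mem (Finset.mem_univ _)] at hlw h2c
        rw [hbelowr] at h2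
        omega
      · rw [hbelow' v hv] at h2
        rw [if_neg hv]
        omega
    · by_cases hv : v = r
      · have : 0 < (Finset.univ.filter fun e => att e = v).card :=
          Finset.card_pos.2 ⟨e₀, by simp [hatt0, hv]⟩
        omega
      · rw [if_neg hv]
        omega
  have haff : ∀ ⦃u v⦄, G.Adj u v → P (cl v) = P (cl u) +
      (if cl u ⊂ cl v then len (cl u) else len (cl v)) • incl N (sl u v) := fun u v h => by
    simp only [sl]
    rcases hss h with ⟨h1, h2, h3⟩ | ⟨h1, h2, h3⟩
    · rw [if_pos h3, if_pos h3, hP _ (hmem u) _ (h2 ▸ hpar u h1), map_neg, smul_neg,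
        add_neg_cancel_right]
    · rw [if_neg (hnot h3), if_neg (hnot h3), hP _ (hmem v) _ (h2 ▸ hpar v h1)]
  have hbal : ∀ v, ∑ d : Direction G att v,
      Sum.elim (fun w => sl v w.1) (fun e => Δ e.1) d = 0 := fun v => by
    refine (ρ.sum_direction att v (sl v) Δ).trans ?_
    rw [hchild]
    by_cases hv : v = r
    · have := ρ.sum_below att Δ v
      rw [hv, hbelowr, hsum] at this
      rw [if_pos hv, hv, add_zero, add_comm]
      exact this.symm
    · have h1 := ρ.sum_below att Δ v
      rw [hbelow' v hv] at h1
      have h2 : sl v (ρ.parent v) = -∑ e ∈ cl v, Δ e := if_pos (hpar v hv).2.1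
      rw [if_neg hv, h2, h1]
      abel
  let c : Curve Δ :=
    { numVert := L.card
      graph := G
      isTree := ρ.isTree
      endVert := att
      three_le_valence := hval
      length := fun u v _ => if cl u ⊂ cl v then len (cl u) else len (cl v)
      length_pos := fun u v h => by
        rcases hss h with ⟨h1, h2, h3⟩ | ⟨h1, h2, h3⟩
        · rw [if_pos h3]; exact hlen _ (hmem u) (htop u h1)
        · rw [if_neg (hnot h3)]; exact hlen _ (hmem v) (htop v h1)
      length_symm := fun u v h => by
        rcases hss h with ⟨h1, h2, h3⟩ | ⟨h1, h2, h3⟩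
        · rw [if_pos h3, if_neg (hnot h3)]
        · rw [if_pos h3, if_neg (hnot h3)]
      pos := fun v => P (cl v)
      slope := fun u v _ => sl u v
      affine := haff
      balanced := hbal }
  have hr0 : c.endVert e₀ = r := hatt0
  -- The root is only propositionally equal to the vertex of `e₀`, so that the rooting is
  -- transported.
  obtain ⟨ρ', hρ'⟩ : ∃ ρ' : Rooting c.graph (c.endVert e₀),
      ∀ v, ρ'.below att v = ρ.below att v := by
    have : ∀ r', r' = r → ∃ ρ' : Rooting G r', ∀ v, ρ'.below att v = ρ.below att v := by
      rintro _ rfl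
      exact ⟨ρ, fun _ => rfl⟩
    exact this _ hr0
  have hclus : ∀ v, c.cluster ρ' v = cl v := fun v => by
    change (ρ'.below att v).erase e₀ = cl v
    rw [hρ' v]
    exact hbelow v
  refine ⟨c, ρ', ?_, fun v => ?_⟩
  · ext I
    rw [Curve.mem_clusters]
    simp only [hclus]
    constructor
    · rintro ⟨v, rfl⟩
      exact hmem v
    · exact exists_familyCluster_eq
  · exact congrArg P (hclus v).symm

end Construction

/-! ### The nodes of a flow tree -/

section Nodes

variable {ι : Type*} [DecidableEq ι]

namespace BinTree

theorem leaves_mem_nodes (S T : BinTree ι) : S.leaves ∪ T.leaves ∈ (node S T).nodes :=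
  Finset.mem_insert_self _ _

theorem mem_nodes_node {S T : BinTree ι} {J : Finset ι} :
    J ∈ (node S T).nodes ↔ J = S.leaves ∪ T.leaves ∨ J ∈ S.nodes ∨ J ∈ T.nodes := by
  rw [nodes, Finset.mem_insert, Finset.mem_union]

theorem subset_leaves {T : BinTree ι} {J : Finset ι} (h : J ∈ T.nodes) : J ⊆ T.leaves := by
  induction T with
  | leaf i => simp [nodes] at h
  | node S T hS hT =>
    rcases mem_nodes_node.1 h with rfl | h | h
    · exact subset_rfl
    · exact (hS h).trans Finset.subset_union_left
    · exact (hT h).trans Finset.subset_union_right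

theorem leaves_mem_nodes_or (T : BinTree ι) : T.leaves ∈ T.nodes ∨ ∃ i, T = leaf i := by
  cases T with
  | leaf i => exact Or.inr ⟨i, rfl⟩
  | node S T => exact Or.inl (leaves_mem_nodes S T)

theorem two_le_card_of_mem_nodes {T : BinTree ι} {I : Finset ι} (hT : T ∈ binTrees I)
    {J : Finset ι} (h : J ∈ T.nodes) : 2 ≤ J.card := by
  induction T generalizing I with
  | leaf i => simp [nodes] at h
  | node S T hS hT' =>
    obtain ⟨hd, hSn, hTn, -, hSb, hTb⟩ := node_mem_binTrees_iff.1 hT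
    rcases mem_nodes_node.1 h with rfl | h | h
    · rw [Finset.card_union_of_disjoint hd]
      have := hSn.card_pos
      have := hTn.card_pos
      omega
    · exact hS hSb h
    · exact hT' hTb h

theorem nonempty_of_mem_nodes {T : BinTree ι} {I : Finset ι} (hT : T ∈ binTrees I)
    {J : Finset ι} (h : J ∈ T.nodes) : J.Nonempty := by
  have := two_le_card_of_mem_nodes hT h
  exact Finset.card_pos.1 (by omega)

theorem nodes_laminar {T : BinTree ι} {I : Finset ι} (hT : T ∈ binTrees I)
    {J K : Finset ι} (hJ : J ∈ T.nodes) (hK : K ∈ T.nodes) : J ⊆ K ∨ K ⊆ J ∨ Disjoint J K := by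
  induction T generalizing I with
  | leaf i => simp [nodes] at hJ
  | node S T hS hT' =>
    obtain ⟨hd, -, -, -, hSb, hTb⟩ := node_mem_binTrees_iff.1 hT
    have sub : ∀ {X}, X ∈ (node S T).nodes → X ⊆ S.leaves ∪ T.leaves := fun h => subset_leaves h
    rcases mem_nodes_node.1 hJ with rfl | hJ' | hJ'
    · exact Or.inr (Or.inl (sub hK))
    · rcases mem_nodes_node.1 hK with rfl | hK' | hK'
      · exact Or.inl (sub hJ)
      · exact hS hSb hJ' hK'
      · exact Or.inr (Or.inr (hd.mono (subset_leaves hJ') (subset_leaves hK')))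
    · rcases mem_nodes_node.1 hK with rfl | hK' | hK'
      · exact Or.inl (sub hJ)
      · exact Or.inr (Or.inr (hd.symm.mono (subset_leaves hJ') (subset_leaves hK')))
      · exact hT' hTb hJ' hK'

theorem node_notMem_nodes {S T : BinTree ι} {I : Finset ι} (h : node S T ∈ binTrees I) :
    S.leaves ∪ T.leaves ∉ S.nodes ∧ S.leaves ∪ T.leaves ∉ T.nodes := by
  obtain ⟨hd, hSn, hTn, -, -, -⟩ := node_mem_binTrees_iff.1 h
  constructor <;> intro h'
  · have := subset_leaves h'
    obtain ⟨x, hx⟩ := hTn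
    exact Finset.disjoint_left.1 hd (this (Finset.mem_union_right _ hx)) hx
  · have := subset_leaves h'
    obtain ⟨x, hx⟩ := hSn
    exact Finset.disjoint_left.1 hd hx (this (Finset.mem_union_left _ hx))

theorem disjoint_nodes {S T : BinTree ι} {I : Finset ι} (h : node S T ∈ binTrees I) :
    Disjoint S.nodes T.nodes := by
  obtain ⟨hd, -, -, -, hSb, -⟩ := node_mem_binTrees_iff.1 h
  rw [Finset.disjoint_left]
  intro J h1 h2
  obtain ⟨x, hx⟩ := nonempty_of_mem_nodes hSb h1
  exact Finset.disjoint_left.1 hd (subset_leaves h1 hx) (subset_leaves h2 hx)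

theorem sum_nodes {M : Type*} [AddCommMonoid M] {S T : BinTree ι} {I : Finset ι}
    (h : node S T ∈ binTrees I) (f : Finset ι → M) :
    ∑ J ∈ (node S T).nodes, f J = f (S.leaves ∪ T.leaves) +
      (∑ J ∈ S.nodes, f J + ∑ J ∈ T.nodes, f J) := by
  have h1 := node_notMem_nodes h
  rw [nodes, Finset.sum_insert (by simp [h1.1, h1.2]), Finset.sum_union (disjoint_nodes h)]

/-- A binary tree has one node less than leaves. -/
theorem card_nodes {T : BinTree ι} {I : Finset ι} (hT : T ∈ binTrees I) :
    T.nodes.card + 1 = I.card := by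
  rw [← leaves_of_mem_binTrees hT]
  induction T generalizing I with
  | leaf i => simp [nodes, leaves]
  | node S T hS hT' =>
    obtain ⟨hd, -, -, -, hSb, hTb⟩ := node_mem_binTrees_iff.1 hT
    have h := sum_nodes hT (fun _ => 1)
    simp only [← Finset.card_eq_sum_ones] at h
    rw [h, leaves, Finset.card_union_of_disjoint hd, ← hS hSb, ← hT' hTb]
    omega

theorem filter_nodes_left {S T : BinTree ι} {I : Finset ι} (h : node S T ∈ binTrees I) :
    (node S T).nodes.filter (· ⊆ S.leaves) = S.nodes := by
  obtain ⟨hd, hSn, hTn, -, hSb, hTb⟩ := node_mem_binTrees_iff.1 h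
  ext J
  rw [Finset.mem_filter, mem_nodes_node]
  constructor
  · rintro ⟨rfl | h1 | h1, h2⟩
    · obtain ⟨x, hx⟩ := hTn
      exact absurd hx (Finset.disjoint_left.1 hd (h2 (Finset.mem_union_right _ hx)))
    · exact h1
    · obtain ⟨x, hx⟩ := nonempty_of_mem_nodes hTb h1
      exact absurd (subset_leaves h1 hx) (Finset.disjoint_left.1 hd (h2 hx))
  · exact fun h1 => ⟨Or.inr (Or.inl h1), subset_leaves h1⟩

theorem filter_nodes_right {S T : BinTree ι} {I : Finset ι} (h : node S T ∈ binTrees I) :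
    (node S T).nodes.filter (· ⊆ T.leaves) = T.nodes := by
  obtain ⟨hd, hSn, hTn, -, hSb, hTb⟩ := node_mem_binTrees_iff.1 h
  ext J
  rw [Finset.mem_filter, mem_nodes_node]
  constructor
  · rintro ⟨rfl | h1 | h1, h2⟩
    · obtain ⟨x, hx⟩ := hSn
      exact absurd (h2 (Finset.mem_union_left _ hx)) (Finset.disjoint_left.1 hd hx)
    · obtain ⟨x, hx⟩ := nonempty_of_mem_nodes hSb h1
      exact absurd (h2 hx) (Finset.disjoint_left.1 hd (subset_leaves h1 hx))
    · exact h1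
  · exact fun h1 => ⟨Or.inr (Or.inr h1), subset_leaves h1⟩

/-- If two trees have the same nodes, the leaves of a branch of the first one belong to a single
branch of the second one. -/
theorem leaves_subset_of_nodes_eq {S T S' T' : BinTree ι} {I : Finset ι}
    (h : node S T ∈ binTrees I) (h' : node S' T' ∈ binTrees I)
    (hn : (node S T).nodes = (node S' T').nodes) {A : BinTree ι} (hA : A = S ∨ A = T) :
    A.leaves ⊆ S'.leaves ∨ A.leaves ⊆ T'.leaves := by
  obtain ⟨hd, hSn, hTn, hu, hSb, hTb⟩ := node_mem_binTrees_iff.1 h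
  obtain ⟨hd', hSn', hTn', hu', hSb', hTb'⟩ := node_mem_binTrees_iff.1 h'
  have hAI : A.leaves ⊆ I := by
    rw [← hu]
    rcases hA with rfl | rfl
    · exact Finset.subset_union_left
    · exact Finset.subset_union_right
  rcases A.leaves_mem_nodes_or with h1 | ⟨i, rfl⟩
  · have h2 : A.leaves ∈ (node S T).nodes := by
      rw [mem_nodes_node]
      rcases hA with rfl | rfl
      · exact Or.inr (Or.inl h1)
      · exact Or.inr (Or.inr h1)
    rw [hn, mem_nodes_node] at h2
    rcases h2 with h2 | h2 | h2
    · exfalso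
      rw [hu', ← hu] at h2
      have h3 := node_notMem_nodes h
      rcases hA with rfl | rfl
      · exact h3.1 (h2 ▸ h1)
      · exact h3.2 (h2 ▸ h1)
    · exact Or.inl (subset_leaves h2)
    · exact Or.inr (subset_leaves h2)
  · have : i ∈ S'.leaves ∪ T'.leaves := hu' ▸ hAI (Finset.mem_singleton_self i)
    rcases Finset.mem_union.1 this with h2 | h2
    · exact Or.inl (Finset.singleton_subset_iff.2 h2)
    · exact Or.inr (Finset.singleton_subset_iff.2 h2)

/-- An ordered flow tree is determined by its nodes, since the form decides which branch comes
first. -/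
theorem eq_of_nodes_eq {w : ι → ι → ℝ} (hw : ∀ i j, w i j = -w j i) {T T' : BinTree ι}
    {I : Finset ι} (hT : T ∈ binTrees I) (hT' : T' ∈ binTrees I) (ho : T.Ordered w)
    (ho' : T'.Ordered w) (h : T.nodes = T'.nodes) : T = T' := by
  induction T generalizing T' I with
  | leaf i =>
    cases T' with
    | leaf j =>
      have h1 := leaf_mem_binTrees.1 hT
      rw [leaf_mem_binTrees.1 hT', Finset.singleton_inj] at h1
      rw [h1]
    | node S' T' =>
      have := leaves_mem_nodes S' T'
      rw [← h] at this
      simp [nodes] at this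
  | node S T hS hT1 =>
    cases T' with
    | leaf j =>
      have := leaves_mem_nodes S T
      rw [h] at this
      simp [nodes] at this
    | node S' T' =>
      have hA := leaves_subset_of_nodes_eq hT hT' h (Or.inl rfl)
      have hB := leaves_subset_of_nodes_eq hT hT' h (Or.inr rfl)
      have fl := filter_nodes_left hT
      have fr := filter_nodes_right hT
      have fl' := filter_nodes_left hT'
      have fr' := filter_nodes_right hT'
      obtain ⟨hd, hSn, hTn, hu, hSb, hTb⟩ := node_mem_binTrees_iff.1 hT
      obtain ⟨hd', hSn', hTn', hu', hSb', hTb'⟩ := node_mem_binTrees_iff.1 hT'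
      have huu : S.leaves ∪ T.leaves = S'.leaves ∪ T'.leaves := hu.trans hu'.symm
      have noboth : ∀ {X Y : Finset ι}, Disjoint X Y → Y.Nonempty →
          S.leaves ∪ T.leaves = X ∪ Y → S.leaves ⊆ X → T.leaves ⊆ X → False := by
        intro X Y hXY hY hXu h1 h2
        obtain ⟨x, hx⟩ := hY
        exact Finset.disjoint_left.1 hXY
          (Finset.union_subset h1 h2 (hXu ▸ Finset.mem_union_right _ hx)) hx
      have eqs : ∀ {X Y : Finset ι}, Disjoint X Y → S.leaves ∪ T.leaves = X ∪ Y →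
          S.leaves ⊆ X → T.leaves ⊆ Y → S.leaves = X ∧ T.leaves = Y := by
        intro X Y hXY hXu h1 h2
        refine ⟨h1.antisymm fun x hx => ?_, h2.antisymm fun x hx => ?_⟩
        · rcases Finset.mem_union.1 (hXu ▸ Finset.mem_union_left Y hx) with h3 | h3
          · exact h3
          · exact absurd (h2 h3) (Finset.disjoint_left.1 hXY hx)
        · rcases Finset.mem_union.1 (hXu ▸ Finset.mem_union_right X hx) with h3 | h3
          · exact absurd hx (Finset.disjoint_left.1 hXY (h1 h3))
          · exact h3
      rcases hA with hA | hA <;> rcases hB with hB | hB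
      · exact (noboth hd' hTn' huu hA hB).elim
      · obtain ⟨h1, h2⟩ := eqs hd' huu hA hB
        rw [h, h1, fl'] at fl
        rw [h, h2, fr'] at fr
        rw [hS hSb (h1 ▸ hSb') ho.2.1 ho'.2.1 fl.symm, hT1 hTb (h2 ▸ hTb') ho.2.2 ho'.2.2 fr.symm]
      · obtain ⟨h1, h2⟩ := eqs hd'.symm (huu.trans (Finset.union_comm _ _)) hA hB
        have h3 := ho.1
        have h4 := ho'.1
        rw [h1, h2, pairing_swap hw] at h3
        linarith
      · exact (noboth hd'.symm hSn' (huu.trans (Finset.union_comm _ _)) hA hB).elim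

theorem isParentIn_node_left {S T : BinTree ι} {I : Finset ι} (h : node S T ∈ binTrees I) :
    IsParentIn (node S T).nodes S.leaves (S.leaves ∪ T.leaves) := by
  obtain ⟨hd, hSn, hTn, -, -, -⟩ := node_mem_binTrees_iff.1 h
  refine ⟨leaves_mem_nodes S T, Finset.subset_union_left.ssubset_of_ne fun h' => ?_,
    fun J hJ hSJ => ?_⟩
  · obtain ⟨x, hx⟩ := hTn
    exact Finset.disjoint_left.1 hd (h' ▸ Finset.mem_union_right _ hx) hx
  · rcases mem_nodes_node.1 hJ with rfl | hJ | hJ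
    · exact subset_rfl
    · exact absurd (subset_leaves hJ) hSJ.2
    · obtain ⟨x, hx⟩ := hSn
      exact absurd (subset_leaves hJ (hSJ.1 hx)) (Finset.disjoint_left.1 hd hx)

theorem isParentIn_node_right {S T : BinTree ι} {I : Finset ι} (h : node S T ∈ binTrees I) :
    IsParentIn (node S T).nodes T.leaves (S.leaves ∪ T.leaves) := by
  obtain ⟨hd, hSn, hTn, -, -, -⟩ := node_mem_binTrees_iff.1 h
  refine ⟨leaves_mem_nodes S T, Finset.subset_union_right.ssubset_of_ne fun h' => ?_,
    fun J hJ hSJ => ?_⟩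
  · obtain ⟨x, hx⟩ := hSn
    exact Finset.disjoint_left.1 hd hx (h' ▸ Finset.mem_union_left _ hx)
  · rcases mem_nodes_node.1 hJ with rfl | hJ | hJ
    · exact subset_rfl
    · obtain ⟨x, hx⟩ := hTn
      exact absurd hx (Finset.disjoint_left.1 hd (subset_leaves hJ (hSJ.1 hx)))
    · exact absurd (subset_leaves hJ) hSJ.2

theorem IsParentIn.node_of_left {S T : BinTree ι} {I : Finset ι} (h : node S T ∈ binTrees I)
    {X Y : Finset ι} (hX : X.Nonempty) (hXY : IsParentIn S.nodes X Y) :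
    IsParentIn (node S T).nodes X Y := by
  obtain ⟨hd, hSn, hTn, -, -, -⟩ := node_mem_binTrees_iff.1 h
  have hY := subset_leaves hXY.1
  refine ⟨mem_nodes_node.2 (Or.inr (Or.inl hXY.1)), hXY.2.1, fun J hJ hSJ => ?_⟩
  rcases mem_nodes_node.1 hJ with rfl | hJ | hJ
  · exact hY.trans Finset.subset_union_left
  · exact hXY.2.2 J hJ hSJ
  · obtain ⟨x, hx⟩ := hX
    exact absurd (subset_leaves hJ (hSJ.1 hx))
      (Finset.disjoint_left.1 hd (hY (hXY.2.1.1 hx)))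

theorem IsParentIn.node_of_right {S T : BinTree ι} {I : Finset ι} (h : node S T ∈ binTrees I)
    {X Y : Finset ι} (hX : X.Nonempty) (hXY : IsParentIn T.nodes X Y) :
    IsParentIn (node S T).nodes X Y := by
  obtain ⟨hd, hSn, hTn, -, -, -⟩ := node_mem_binTrees_iff.1 h
  have hY := subset_leaves hXY.1
  refine ⟨mem_nodes_node.2 (Or.inr (Or.inr hXY.1)), hXY.2.1, fun J hJ hSJ => ?_⟩
  rcases mem_nodes_node.1 hJ with rfl | hJ | hJ
  · exact hY.trans Finset.subset_union_right
  · obtain ⟨x, hx⟩ := hX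
    exact absurd (hY (hXY.2.1.1 hx)) (Finset.disjoint_left.1 hd (subset_leaves hJ (hSJ.1 hx)))
  · exact hXY.2.2 J hJ hSJ

/-- Every node of an ordered tree has two branches which pair positively. -/
theorem exists_branches_of_mem_nodes {w : ι → ι → ℝ} {T : BinTree ι} {I : Finset ι}
    (hT : T ∈ binTrees I) (ho : T.Ordered w) {J : Finset ι} (hJ : J ∈ T.nodes) :
    ∃ A B : Finset ι, Disjoint A B ∧ A.Nonempty ∧ B.Nonempty ∧ 0 < pairing w A B ∧
      IsParentIn T.nodes A J ∧ IsParentIn T.nodes B J ∧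
      (A ∈ T.nodes ∨ ∃ i, A = {i}) ∧ (B ∈ T.nodes ∨ ∃ i, B = {i}) := by
  induction T generalizing I with
  | leaf i => simp [nodes] at hJ
  | node S T hS hT1 =>
    obtain ⟨hd, hSn, hTn, -, hSb, hTb⟩ := node_mem_binTrees_iff.1 hT
    rcases mem_nodes_node.1 hJ with rfl | hJ | hJ
    · refine ⟨_, _, hd, hSn, hTn, ho.1, isParentIn_node_left hT, isParentIn_node_right hT, ?_, ?_⟩
      · exact S.leaves_mem_nodes_or.imp (fun h => mem_nodes_node.2 (Or.inr (Or.inl h)))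
          fun ⟨i, h⟩ => ⟨i, h ▸ rfl⟩
      · exact T.leaves_mem_nodes_or.imp (fun h => mem_nodes_node.2 (Or.inr (Or.inr h)))
          fun ⟨i, h⟩ => ⟨i, h ▸ rfl⟩
    · obtain ⟨A, B, h1, h2, h3, h4, h5, h6, h7, h8⟩ := hS hSb ho.2.1 hJ
      exact ⟨A, B, h1, h2, h3, h4, IsParentIn.node_of_left hT h2 h5,
        IsParentIn.node_of_left hT h3 h6,
        h7.imp_left fun h => mem_nodes_node.2 (Or.inr (Or.inl h)),
        h8.imp_left fun h => mem_nodes_node.2 (Or.inr (Or.inl h))⟩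
    · obtain ⟨A, B, h1, h2, h3, h4, h5, h6, h7, h8⟩ := hT1 hTb ho.2.2 hJ
      exact ⟨A, B, h1, h2, h3, h4, IsParentIn.node_of_right hT h2 h5,
        IsParentIn.node_of_right hT h3 h6,
        h7.imp_left fun h => mem_nodes_node.2 (Or.inr (Or.inr h)),
        h8.imp_left fun h => mem_nodes_node.2 (Or.inr (Or.inr h))⟩

/-- Two disjoint clusters are siblings in some tree. -/
theorem exists_siblings {I J K : Finset ι} (hJ : J.Nonempty) (hK : K.Nonempty)
    (h : Disjoint J K) (hI : J ∪ K ⊆ I) :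
    ∃ T ∈ binTrees I, IsParentIn T.nodes J (J ∪ K) ∧ IsParentIn T.nodes K (J ∪ K) ∧
      (J ∈ T.nodes ∨ ∃ i, J = {i}) ∧ (K ∈ T.nodes ∨ ∃ i, K = {i}) := by
  obtain ⟨S, hS⟩ := binTrees_nonempty hJ
  obtain ⟨T, hT⟩ := binTrees_nonempty hK
  have lS := leaves_of_mem_binTrees hS
  have lT := leaves_of_mem_binTrees hT
  have hST : node S T ∈ binTrees (J ∪ K) := by
    rw [node_mem_binTrees_iff, lS, lT]
    exact ⟨h, hJ, hK, rfl, hS, hT⟩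
  have p1 := isParentIn_node_left hST
  have p2 := isParentIn_node_right hST
  have i1 : J ∈ (node S T).nodes ∨ ∃ i, J = {i} := by
    rcases S.leaves_mem_nodes_or with h' | ⟨i, rfl⟩
    · exact Or.inl (mem_nodes_node.2 (Or.inr (Or.inl (lS ▸ h'))))
    · exact Or.inr ⟨i, lS.symm⟩
  have i2 : K ∈ (node S T).nodes ∨ ∃ i, K = {i} := by
    rcases T.leaves_mem_nodes_or with h' | ⟨i, rfl⟩
    · exact Or.inl (mem_nodes_node.2 (Or.inr (Or.inr (lT ▸ h'))))
    · exact Or.inr ⟨i, lT.symm⟩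
  rw [lS, lT] at p1 p2
  rcases hI.eq_or_ssubset with hI' | hI'
  · exact ⟨_, hI' ▸ hST, p1, p2, i1, i2⟩
  · have hne : (I \ (J ∪ K)).Nonempty := Finset.sdiff_nonempty.2 hI'.2
    obtain ⟨U, hU⟩ := binTrees_nonempty hne
    have hU' : node (node S T) U ∈ binTrees I := by
      rw [node_mem_binTrees_iff, leaves_of_mem_binTrees hST, leaves_of_mem_binTrees hU]
      exact ⟨Finset.disjoint_sdiff, hJ.mono Finset.subset_union_left, hne,
        Finset.union_sdiff_of_subset hI, hST, hU⟩
    exact ⟨_, hU', IsParentIn.node_of_left hU' hJ p1, IsParentIn.node_of_left hU' hK p2,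
      i1.imp_left fun h => mem_nodes_node.2 (Or.inr (Or.inl h)),
      i2.imp_left fun h => mem_nodes_node.2 (Or.inr (Or.inl h))⟩

/-! ### The lengths of the edges of a flow tree -/

/-- The lengths of the edges of the flow tree which starts from `y`; the edge of a subtree is
recorded by the set of its leaves. -/
def lengths (w : ι → ι → ℝ) : BinTree ι → (ι → ℝ) → Finset ι → ℝ
  | .leaf _, _, _ => 0
  | .node S T, y, J =>
    if J = S.leaves ∪ T.leaves then (∑ i ∈ S.leaves, y i) / pairing w S.leaves T.leaves
    else if J ⊆ S.leaves then S.lengths w (advance w y S.leaves T.leaves) J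
    else T.lengths w (advance w y S.leaves T.leaves) J

theorem lengths_top (w : ι → ι → ℝ) (S T : BinTree ι) (y : ι → ℝ) :
    (node S T).lengths w y (S.leaves ∪ T.leaves) =
      (∑ i ∈ S.leaves, y i) / pairing w S.leaves T.leaves := by
  rw [lengths, if_pos rfl]

theorem lengths_left (w : ι → ι → ℝ) {S T : BinTree ι} {I : Finset ι}
    (h : node S T ∈ binTrees I) (y : ι → ℝ) {J : Finset ι} (hJ : J ∈ S.nodes) :
    (node S T).lengths w y J = S.lengths w (advance w y S.leaves T.leaves) J := by
  rw [lengths, if_neg, if_pos (subset_leaves hJ)]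
  rintro rfl
  exact (node_notMem_nodes h).1 hJ

theorem lengths_right (w : ι → ι → ℝ) {S T : BinTree ι} {I : Finset ι}
    (h : node S T ∈ binTrees I) (y : ι → ℝ) {J : Finset ι} (hJ : J ∈ T.nodes) :
    (node S T).lengths w y J = T.lengths w (advance w y S.leaves T.leaves) J := by
  rw [lengths, if_neg, if_neg]
  · intro h'
    have := filter_nodes_left h ▸ Finset.mem_filter.2 ⟨mem_nodes_node.2 (Or.inr (Or.inr hJ)), h'⟩
    exact Finset.disjoint_left.1 (disjoint_nodes h) this hJ
  · rintro rfl
    exact (node_notMem_nodes h).2 hJ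

theorem forall_mem_nodes {S T : BinTree ι} {P : Finset ι → Prop} :
    (∀ J ∈ (node S T).nodes, P J) ↔
      P (S.leaves ∪ T.leaves) ∧ (∀ J ∈ S.nodes, P J) ∧ ∀ J ∈ T.nodes, P J := by
  simp only [mem_nodes_node]
  constructor
  · exact fun h => ⟨h _ (Or.inl rfl), fun J hJ => h J (Or.inr (Or.inl hJ)),
      fun J hJ => h J (Or.inr (Or.inr hJ))⟩
  · rintro ⟨h1, h2, h3⟩ J (rfl | h | h)
    exacts [h1, h2 J h, h3 J h]

theorem positive_iff_lengths {w : ι → ι → ℝ} {T : BinTree ι} {I : Finset ι}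
    (hT : T ∈ binTrees I) (ho : T.Ordered w) (y : ι → ℝ) :
    T.Positive w y ↔ ∀ J ∈ T.nodes, 0 < T.lengths w y J := by
  induction T generalizing I y with
  | leaf i => simp [nodes, Positive]
  | node S T hS hT1 =>
    obtain ⟨hd, hSn, hTn, -, hSb, hTb⟩ := node_mem_binTrees_iff.1 hT
    rw [forall_mem_nodes, lengths_top, div_pos_iff_of_pos_right ho.1, Positive,
      hS hSb ho.2.1, hT1 hTb ho.2.2]
    constructor
    · rintro ⟨-, h1, h2, h3⟩
      exact ⟨h1, fun J hJ => lengths_left w hT y hJ ▸ h2 J hJ,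
        fun J hJ => lengths_right w hT y hJ ▸ h3 J hJ⟩
    · rintro ⟨h1, h2, h3⟩
      exact ⟨ho.1, h1, fun J hJ => lengths_left w hT y hJ ▸ h2 J hJ,
        fun J hJ => lengths_right w hT y hJ ▸ h3 J hJ⟩

theorem lengths_nonneg {w : ι → ι → ℝ} {T : BinTree ι} {I : Finset ι}
    (hT : T ∈ binTrees I) (ho : T.Ordered w) (y : ι → ℝ) (hn : ¬ T.Negative w y) :
    ∀ J ∈ T.nodes, 0 ≤ T.lengths w y J := by
  induction T generalizing I y with
  | leaf i => simp [nodes]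
  | node S T hS hT1 =>
    obtain ⟨hd, hSn, hTn, -, hSb, hTb⟩ := node_mem_binTrees_iff.1 hT
    simp only [Negative, not_or, not_lt] at hn
    rw [forall_mem_nodes, lengths_top]
    exact ⟨div_nonneg hn.1 ho.1.le,
      fun J hJ => lengths_left w hT y hJ ▸ hS hSb ho.2.1 _ hn.2.1 J hJ,
      fun J hJ => lengths_right w hT y hJ ▸ hT1 hTb ho.2.2 _ hn.2.2 J hJ⟩

theorem topPositive_iff_lengths {w : ι → ι → ℝ} {T : BinTree ι} {I : Finset ι}
    (hT : T ∈ binTrees I) (ho : T.Ordered w) (y : ι → ℝ) :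
    T.TopPositive w y ↔ ∀ J ∈ T.nodes, J ≠ I → 0 < T.lengths w y J := by
  cases T with
  | leaf i => simp [nodes, TopPositive]
  | node S T =>
    obtain ⟨hd, hSn, hTn, hu, hSb, hTb⟩ := node_mem_binTrees_iff.1 hT
    have h0 := node_notMem_nodes hT
    rw [hu] at h0
    rw [forall_mem_nodes, TopPositive, positive_iff_lengths hSb ho.2.1,
      positive_iff_lengths hTb ho.2.2]
    constructor
    · rintro ⟨-, h2, h3⟩
      exact ⟨fun h => absurd hu h, fun J hJ _ => lengths_left w hT y hJ ▸ h2 J hJ,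
        fun J hJ _ => lengths_right w hT y hJ ▸ h3 J hJ⟩
    · rintro ⟨-, h2, h3⟩
      exact ⟨ho.1,
        fun J hJ => lengths_left w hT y hJ ▸ h2 J hJ fun h => h0.1 (h ▸ hJ),
        fun J hJ => lengths_right w hT y hJ ▸ h3 J hJ fun h => h0.2 (h ▸ hJ)⟩

theorem lengths_nonneg_of_not_topNegative {w : ι → ι → ℝ} {T : BinTree ι} {I : Finset ι}
    (hT : T ∈ binTrees I) (ho : T.Ordered w) (y : ι → ℝ) (hn : ¬ T.TopNegative w y) :
    ∀ J ∈ T.nodes, J ≠ I → 0 ≤ T.lengths w y J := by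
  cases T with
  | leaf i => simp [nodes]
  | node S T =>
    obtain ⟨hd, hSn, hTn, hu, hSb, hTb⟩ := node_mem_binTrees_iff.1 hT
    simp only [TopNegative, not_or] at hn
    rw [forall_mem_nodes]
    exact ⟨fun h => absurd hu h,
      fun J hJ _ => lengths_left w hT y hJ ▸ lengths_nonneg hSb ho.2.1 _ hn.1 J hJ,
      fun J hJ _ => lengths_right w hT y hJ ▸ lengths_nonneg hTb ho.2.2 _ hn.2 J hJ⟩

/-- When the flow tree that starts from `y` reaches the leaf `e`, the coordinate `y_e` has become
zero. This expresses its initial value in terms of the lengths. -/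
theorem eq_sum_lengths {w : ι → ι → ℝ} (hw : ∀ i j, w i j = -w j i) {T : BinTree ι}
    {I : Finset ι} (hT : T ∈ binTrees I) (ho : T.Ordered w) {y : ι → ℝ} (hy : ∑ i ∈ I, y i = 0)
    {e : ι} (he : e ∈ I) :
    y e = ∑ J ∈ T.nodes with e ∈ J, T.lengths w y J * ∑ k ∈ J, w e k := by
  induction T generalizing I y with
  | leaf i =>
    rw [leaf_mem_binTrees.1 hT] at hy he
    rw [Finset.mem_singleton] at he
    rw [Finset.sum_singleton] at hy
    simp [nodes, he, hy]
  | node S T hS hT1 =>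
    obtain ⟨hd, hSn, hTn, hu, hSb, hTb⟩ := node_mem_binTrees_iff.1 hT
    have hself : ∀ A B : Finset ι, Disjoint A B →
        pairing w A (A ∪ B) = pairing w A B := fun A B hAB => by
      have : pairing w A (A ∪ B) = pairing w A A + pairing w A B := by
        simp only [pairing]
        rw [← Finset.sum_add_distrib]
        exact Finset.sum_congr rfl fun _ _ => Finset.sum_union hAB
      rw [this, pairing_self hw, zero_add]
    have hadv : ∀ A : Finset ι, ∑ i ∈ A, advance w y S.leaves T.leaves i =
        ∑ i ∈ A, y i - (∑ j ∈ S.leaves, y j) / pairing w S.leaves T.leaves *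
          pairing w A (S.leaves ∪ T.leaves) := fun A => by
      simp only [advance]
      rw [Finset.sum_sub_distrib, ← Finset.mul_sum]
      rfl
    have hST : ∑ i ∈ S.leaves, y i + ∑ i ∈ T.leaves, y i = 0 := by
      rw [← Finset.sum_union hd, hu, hy]
    have hyS : ∑ i ∈ S.leaves, advance w y S.leaves T.leaves i = 0 := by
      rw [hadv, hself _ _ hd, div_mul_cancel₀ _ ho.1.ne', sub_self]
    have hyT : ∑ i ∈ T.leaves, advance w y S.leaves T.leaves i = 0 := by
      rw [hadv, Finset.union_comm, hself _ _ hd.symm, pairing_swap hw T.leaves, mul_neg,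
        div_mul_cancel₀ _ ho.1.ne']
      linarith
    have e0 : y e = (∑ j ∈ S.leaves, y j) / pairing w S.leaves T.leaves *
        ∑ k ∈ S.leaves ∪ T.leaves, w e k + advance w y S.leaves T.leaves e := by
      rw [advance]; ring
    have hzero : ∀ {A : BinTree ι}, e ∉ A.leaves → ∀ f : Finset ι → ℝ,
        ∑ J ∈ A.nodes, (if e ∈ J then f J else 0) = 0 := fun hA f =>
      Finset.sum_eq_zero fun J hJ => if_neg fun h => hA (subset_leaves hJ h)
    rw [Finset.sum_filter, sum_nodes hT, if_pos (hu.symm ▸ he), lengths_top, e0]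
    congr 1
    rw [← hu] at he
    have cl : ∀ J ∈ S.nodes, (if e ∈ J then (node S T).lengths w y J * ∑ k ∈ J, w e k else 0) =
        if e ∈ J then S.lengths w (advance w y S.leaves T.leaves) J * ∑ k ∈ J, w e k else 0 :=
      fun J hJ => by rw [lengths_left w hT y hJ]
    have cr : ∀ J ∈ T.nodes, (if e ∈ J then (node S T).lengths w y J * ∑ k ∈ J, w e k else 0) =
        if e ∈ J then T.lengths w (advance w y S.leaves T.leaves) J * ∑ k ∈ J, w e k else 0 :=
      fun J hJ => by rw [lengths_right w hT y hJ]
    rw [Finset.sum_congr rfl cl, Finset.sum_congr rfl cr]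
    rcases Finset.mem_union.1 he with h | h
    · rw [hzero (Finset.disjoint_left.1 hd h), add_zero, ← Finset.sum_filter]
      exact hS hSb ho.2.1 hyS h
    · rw [hzero (Finset.disjoint_right.1 hd h), zero_add, ← Finset.sum_filter]
      exact hT1 hTb ho.2.2 hyT h

end BinTree

end Nodes

/-! ### The curve of a flow tree -/

theorem BinTree.isClusterFamily_nodes {E : Type*} [Fintype E] [DecidableEq E] {e₀ : E}
    (hE : 3 ≤ Fintype.card E) {T : BinTree E} (hT : T ∈ binTrees (Finset.univ.erase e₀)) :
    IsClusterFamily e₀ T.nodes where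
  top_mem := by
    have h := leaves_of_mem_binTrees hT
    rcases T.leaves_mem_nodes_or with h' | ⟨i, rfl⟩
    · rwa [h] at h'
    · have h2 : (Finset.univ.erase e₀).card = 1 := by rw [← h]; rfl
      rw [Finset.card_erase_of_mem (Finset.mem_univ _), Finset.card_univ] at h2
      omega
  notMem I hI h := by
    have := BinTree.subset_leaves hI h
    rw [leaves_of_mem_binTrees hT] at this
    exact Finset.notMem_erase _ _ this
  laminar I hI J hJ := BinTree.nodes_laminar hT hI hJ
  two_le_card I hI := BinTree.two_le_card_of_mem_nodes hT hI

section Family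

variable {E N : Type*} [AddCommGroup N] (Δ : E → N) [DecidableEq E]
  {L : Finset (Finset E)}

/-- The position of the vertex with cluster `I`, given the lengths of the edges: it is reached
from `p` along the edges of the clusters which contain `I`. -/
def familyPos (L : Finset (Finset E)) (p : RealSpace N) (len : Finset E → ℝ) (I : Finset E) :
    RealSpace N :=
  p + ∑ J ∈ L with I ⊆ J, len J • incl N (∑ e ∈ J, Δ e)

theorem familyPos_parent (p : RealSpace N) (len : Finset E → ℝ) {I J : Finset E} (hI : I ∈ L)
    (h : IsParentIn L I J) :
    familyPos Δ L p len I = familyPos Δ L p len J + len I • incl N (∑ e ∈ I, Δ e) := by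
  have e : L.filter (I ⊆ ·) = insert I (L.filter (J ⊆ ·)) := by
    ext K
    rw [Finset.mem_insert, Finset.mem_filter, Finset.mem_filter]
    constructor
    · rintro ⟨hK, hIK⟩
      rcases hIK.eq_or_ssubset with h' | h'
      · exact Or.inl h'.symm
      · exact Or.inr ⟨hK, h.2.2 K hK h'⟩
    · rintro (rfl | ⟨hK, hJK⟩)
      · exact ⟨hI, subset_rfl⟩
      · exact ⟨hK, h.2.1.1.trans hJK⟩
  rw [familyPos, familyPos, e, Finset.sum_insert, add_comm (len I • _), ← add_assoc]
  intro h'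
  exact h.2.1.2 (Finset.mem_filter.1 h').2

variable [Fintype E] {e₀ : E}

theorem familyPos_top (hL : IsClusterFamily e₀ L) (hsum : ∑ e, Δ e = 0) (p : RealSpace N)
    (len : Finset E → ℝ) : familyPos Δ L p len (Finset.univ.erase e₀) =
      p - len (Finset.univ.erase e₀) • incl N (Δ e₀) := by
  have e : L.filter (Finset.univ.erase e₀ ⊆ ·) = {Finset.univ.erase e₀} := by
    ext K
    rw [Finset.mem_filter, Finset.mem_singleton]
    constructor
    · rintro ⟨hK, h⟩
      exact (hL.subset_top hK).antisymm h
    · rintro rfl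
      exact ⟨hL.top_mem, subset_rfl⟩
  rw [familyPos, e, Finset.sum_singleton, Curve.sum_erase_end hsum, map_neg, smul_neg,
    sub_eq_add_neg]

variable {Δ}

/-- A curve constructed from lengths has the prescribed moments as soon as the lengths account
for the defects at the starting point `p`. -/
theorem Curve.moment_eq_of_defect (ω : TwoForm N) {μ : E → ℝ} {p : RealSpace N} (c : Curve Δ)
    (ρ : Rooting c.graph (c.endVert e₀)) (hL : IsClusterFamily e₀ L) (hsum : ∑ e, Δ e = 0)
    (len : Finset E → ℝ) (hc : c.clusters ρ = L)
    (hpos : ∀ v, c.pos v = familyPos Δ L p len (c.cluster ρ v))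
    (h0 : realContract ω (Δ e₀) p = μ e₀)
    (hμ : ∀ e, e ≠ e₀ → defect Δ ω μ p e =
      ∑ J ∈ L with e ∈ J, len J * ∑ k ∈ J, endForm Δ ω e k) :
    c.moment ω = μ ∧ c.ev e₀ = (Submodule.span ℝ {incl N (Δ e₀)}).mkQ p := by
  have htop : c.pos (c.endVert e₀) = p - len (Finset.univ.erase e₀) • incl N (Δ e₀) := by
    rw [hpos, c.cluster_root ρ, familyPos_top Δ hL hsum]
  constructor
  · funext e
    rw [Curve.moment]
    by_cases he : e = e₀
    · rw [he, htop, map_sub, map_smul, realContract_self, smul_zero, sub_zero, h0]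
    · have hpar := c.isParentIn_clusters_singleton ρ he
      rw [hc] at hpar
      have hf : L.filter (c.cluster ρ (c.endVert e) ⊆ ·) = L.filter (e ∈ ·) := by
        refine Finset.filter_congr fun J hJ => ⟨fun h => h (hpar.2.1.1 (by simp)), fun h => ?_⟩
        refine hpar.2.2 J hJ (LE.le.ssubset_of_ne (by simpa using h) fun h' => ?_)
        have := hL.two_le_card J hJ
        rw [← h', Finset.card_singleton] at this
        omega
      have h := hμ e he
      rw [defect, sub_eq_iff_eq_add] at h
      rw [h, hpos, familyPos, hf, map_add, map_sum, add_comm]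
      congr 1
      refine Finset.sum_congr rfl fun J _ => ?_
      rw [map_smul, realContract_incl, twoForm_sum_right, smul_eq_mul]
      push_cast
      rfl
  · rw [Curve.ev, htop, map_sub, map_smul, sub_eq_self]
    simp [Submodule.mem_span_singleton_self]

theorem sum_defect_erase (hsum : ∑ e, Δ e = 0) (ω : TwoForm N) {μ : E → ℝ} (hμ : ∑ e, μ e = 0)
    {p : RealSpace N} (hp : realContract ω (Δ e₀) p = μ e₀) :
    ∑ e ∈ Finset.univ.erase e₀, defect Δ ω μ p e = 0 := by
  have h1 := Finset.add_sum_erase Finset.univ (defect Δ ω μ p) (Finset.mem_univ e₀)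
  rw [sum_defect Δ ω μ p Finset.univ, hsum, realContract_zero, hμ, LinearMap.zero_apply, sub_zero,
    defect, hp, sub_self, zero_add] at h1
  exact h1

/-- A flow tree without edges of negative length defines a curve; its edges of length zero are
contracted. -/
theorem exists_curve_of_tree (hsum : ∑ e, Δ e = 0) (hE : 3 ≤ Fintype.card E) (ω : TwoForm N)
    {μ : E → ℝ} (hμ : ∑ e, μ e = 0) {p : RealSpace N} (hp : realContract ω (Δ e₀) p = μ e₀)
    {T : BinTree E} (hT : T ∈ binTrees (Finset.univ.erase e₀))
    (ho : T.Ordered (endForm Δ ω))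
    (hn : ¬ T.TopNegative (endForm Δ ω) (defect Δ ω μ p)) :
    ∃ (c : Curve Δ) (ρ : Rooting c.graph (c.endVert e₀)), c.moment ω = μ ∧
      c.ev e₀ = (Submodule.span ℝ {incl N (Δ e₀)}).mkQ p ∧
      c.clusters ρ = T.nodes.filter fun J => J ≠ Finset.univ.erase e₀ →
        T.lengths (endForm Δ ω) (defect Δ ω μ p) J ≠ 0 := by
  classical
  set len := T.lengths (endForm Δ ω) (defect Δ ω μ p)
  have hL := BinTree.isClusterFamily_nodes hE hT
  set L := T.nodes
  set L' := L.filter fun J => J ≠ Finset.univ.erase e₀ → len J ≠ 0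
  have hsub : L' ⊆ L := Finset.filter_subset _ _
  have hLL : IsClusterFamily e₀ L' :=
    ⟨Finset.mem_filter.2 ⟨hL.top_mem, fun h => absurd rfl h⟩, fun I hI => hL.notMem I (hsub hI),
      fun I hI J hJ => hL.laminar I (hsub hI) J (hsub hJ),
      fun I hI => hL.two_le_card I (hsub hI)⟩
  have hzero : ∀ J ∈ L, J ∉ L' → len J = 0 := fun J hJ hJ' => by
    by_contra h
    exact hJ' (Finset.mem_filter.2 ⟨hJ, fun _ => h⟩)
  have hpos : ∀ I ∈ L', I ≠ Finset.univ.erase e₀ → 0 < len I := fun I hI hI' =>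
    lt_of_le_of_ne (BinTree.lengths_nonneg_of_not_topNegative hT ho _ hn I (hsub hI) hI')
      ((Finset.mem_filter.1 hI).2 hI').symm
  obtain ⟨c, ρ, hc, hcp⟩ := hLL.exists_curve hsum (familyPos Δ L' p len) len hpos
    fun I hI J h => familyPos_parent Δ p len hI h
  have hy := sum_defect_erase hsum ω hμ hp
  obtain ⟨h1, h2⟩ := c.moment_eq_of_defect ω (μ := μ) ρ hLL hsum len hc hcp hp fun e he => by
    rw [BinTree.eq_sum_lengths (endForm_swap Δ ω) hT ho hy (Finset.mem_erase.2 ⟨he, by simp⟩)]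
    symm
    refine Finset.sum_subset (Finset.filter_subset_filter _ hsub) fun J hJ hJ' => ?_
    rw [Finset.mem_filter] at hJ hJ'
    rw [hzero J hJ.1 fun h => hJ' ⟨h, hJ.2⟩, zero_mul]
  exact ⟨c, ρ, h1, h2, hc⟩

/-- In general position, no edge of a flow tree is contracted: if the lengths were non-negative and
some of them zero, contracting the corresponding edges would give a solution which is not
trivalent. -/
theorem topPositive_or_topNegative (hsum : ∑ e, Δ e = 0) (hE : 3 ≤ Fintype.card E) (ω : TwoForm N)
    {μ : E → ℝ} (hμ : ∑ e, μ e = 0) {p : RealSpace N} (hp : realContract ω (Δ e₀) p = μ e₀)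
    {A : Set (EndSpace (Δ e₀))} (hA : (Submodule.span ℝ {incl N (Δ e₀)}).mkQ p ∈ A)
    (hgp : GeneralPosition Δ ω e₀ μ A)
    {T : BinTree E} (hT : T ∈ binTrees (Finset.univ.erase e₀))
    (ho : T.Ordered (endForm Δ ω)) :
    T.TopPositive (endForm Δ ω) (defect Δ ω μ p) ∨
      T.TopNegative (endForm Δ ω) (defect Δ ω μ p) := by
  by_contra h
  rw [not_or] at h
  obtain ⟨c, ρ, h1, h2, h3⟩ := exists_curve_of_tree hsum hE ω hμ hp hT ho h.2
  have ht := (c.trivalent_iff e₀).1 (hgp c ⟨h1, h2 ▸ hA⟩).1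
  rw [← c.card_clusters ρ, h3] at ht
  have hcard := BinTree.card_nodes hT
  rw [Finset.card_erase_of_mem (Finset.mem_univ _), Finset.card_univ] at hcard
  have hle := Finset.card_filter_le T.nodes fun J => J ≠ Finset.univ.erase e₀ →
        T.lengths (endForm Δ ω) (defect Δ ω μ p) J ≠ 0
  have heq := Finset.eq_of_subset_of_card_le (Finset.filter_subset _ T.nodes)
    (show T.nodes.card ≤ (T.nodes.filter fun J => J ≠ Finset.univ.erase e₀ →
        T.lengths (endForm Δ ω) (defect Δ ω μ p) J ≠ 0).card by omega)
  refine h.1 ((BinTree.topPositive_iff_lengths hT ho _).2 fun J hJ hJ' => ?_)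
  have h4 := hJ
  rw [← heq, Finset.mem_filter] at h4
  exact lt_of_le_of_ne (BinTree.lengths_nonneg_of_not_topNegative hT ho _ h.2 J hJ hJ')
      (h4.2 hJ').symm

/-- The maximal clusters strictly contained in the cluster of a vertex, and the ends that are in
none of them, are its branches. -/
theorem Curve.exists_branch_of_isParentIn (c : Curve Δ) (ρ : Rooting c.graph (c.endVert e₀))
    {v : Fin c.numVert} {X : Finset E} (h : IsParentIn (c.clusters ρ) X (c.cluster ρ v))
    (hX : X ∈ c.clusters ρ ∨ ∃ e, X = {e}) :
    ∃ x ∈ c.branches ρ v, c.branchCluster ρ x = X := by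
  rcases hX with hX | ⟨e, rfl⟩
  · obtain ⟨w, rfl⟩ := (c.mem_clusters ρ).1 hX
    have hw : w ≠ c.endVert e₀ := by
      rintro rfl
      refine h.2.1.2 ?_
      rw [cluster_root]
      exact Finset.erase_subset_erase _ (Finset.subset_univ _)
    refine ⟨.inl w, (c.mem_branches ρ).2 (Or.inl ⟨w, ρ.mem_children.2 ⟨hw, ?_⟩, rfl⟩), rfl⟩
    exact c.cluster_injective ρ ((c.isParentIn_clusters ρ hw).unique h)
  · have he : e ≠ e₀ := ((c.mem_cluster ρ).1 (h.2.1.1 (Finset.mem_singleton_self e))).1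
    refine ⟨.inr e, (c.mem_branches ρ).2 (Or.inr ⟨e, c.mem_endsAt.2 ⟨he, ?_⟩, rfl⟩), rfl⟩
    exact c.cluster_injective ρ ((c.isParentIn_clusters_singleton ρ he).unique h)

variable [Module.Free ℤ N]

/-- Two disjoint clusters are the branches at a trivalent vertex of some curve, so that their
bivector lies in the lattice `K_ω` as soon as it is orthogonal to `ω`. -/
theorem wedge_mem_kernelLattice (hsum : ∑ e, Δ e = 0) (hE : 3 ≤ Fintype.card E) (ω : TwoForm N)
    {J K : Finset E} (hJ : J.Nonempty) (hK : K.Nonempty) (h : Disjoint J K)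
    (hJK : J ∪ K ⊆ Finset.univ.erase e₀)
    (h0 : ω ![∑ e ∈ J, Δ e, ∑ e ∈ K, Δ e] = 0) :
    wedge (∑ e ∈ J, Δ e) (∑ e ∈ K, Δ e) ∈ kernelLattice Δ ω := by
  obtain ⟨T, hT, p1, p2, i1, i2⟩ := BinTree.exists_siblings hJ hK h hJK
  have hL := BinTree.isClusterFamily_nodes hE hT
  -- The positions are not constrained, so that all the lengths may be chosen equal to `1`.
  obtain ⟨c, ρ, hc, -⟩ := hL.exists_curve hsum (familyPos Δ T.nodes 0 fun _ => 1) (fun _ => 1)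
    (fun _ _ _ => one_pos) fun I hI J h => familyPos_parent Δ 0 _ hI h
  have htri : c.Trivalent := by
    rw [c.trivalent_iff e₀, ← c.card_clusters ρ, hc]
    have hcard := BinTree.card_nodes hT
    rw [Finset.card_erase_of_mem (Finset.mem_univ _), Finset.card_univ] at hcard
    omega
  rw [← hc] at p1 p2 i1 i2
  obtain ⟨v, hv⟩ := (c.mem_clusters ρ).1 p1.1
  rw [← hv] at p1 p2
  obtain ⟨x, hx, hxJ⟩ := c.exists_branch_of_isParentIn ρ p1 i1
  obtain ⟨y, hy, hyK⟩ := c.exists_branch_of_isParentIn ρ p2 i2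
  obtain ⟨d, hd⟩ := c.exists_dir ρ hx
  obtain ⟨d', hd'⟩ := c.exists_dir ρ hy
  rw [hxJ] at hd
  rw [hyK] at hd'
  rw [← hd, ← hd'] at h0 ⊢
  by_cases hdd : d = d'
  · rw [hdd, wedge_self]
    exact zero_mem _
  · exact Submodule.subset_span ⟨c, v, d, d', htri v, hdd, h0, rfl⟩

theorem commutator_commFactor_eq_zero (hsum : ∑ e, Δ e = 0) (hE : 3 ≤ Fintype.card E)
    (ω : TwoForm N) {J K : Finset E} (hJ : J.Nonempty) (hK : K.Nonempty) (h : Disjoint J K)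
    (hJK : J ∪ K ⊆ Finset.univ.erase e₀) (h0 : pairing (endForm Δ ω) J K = 0) :
    commutator (commFactor Δ ω) J K = 0 := by
  rw [pairing_endForm, Int.cast_eq_zero] at h0
  have hm := wedge_mem_kernelLattice hsum hE ω hJ hK h hJK h0
  have e1 : ∀ a ∈ kernelLattice Δ ω, qPow Δ ω a = qPow Δ ω 0 := fun a ha => by
    rw [qPow, qPow, map_zero, Submodule.mkQ_apply, (Submodule.Quotient.mk_eq_zero _).2 ha]
  rw [commutator, commFactor, commFactor, wedge_swap (∑ e ∈ K, Δ e), e1 _ hm,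
    e1 _ (neg_mem hm), sub_self]

/-- The invariant: the weighted number of flow trees is the same for all the points in general
position. -/
theorem exists_topTreeSum_defect_eq (hsum : ∑ e, Δ e = 0) (hE : 3 ≤ Fintype.card E)
    (ω : TwoForm N) (e₀ : E) :
    ∃ B : RefinedRing Δ ω, ∀ (μ : E → ℝ) (p : RealSpace N) (A : Set (EndSpace (Δ e₀))),
      ∑ e, μ e = 0 → realContract ω (Δ e₀) p = μ e₀ →
      (Submodule.span ℝ {incl N (Δ e₀)}).mkQ p ∈ A → GeneralPosition Δ ω e₀ μ A →
      topTreeSum (endForm Δ ω) (commFactor Δ ω) (Finset.univ.erase e₀) (defect Δ ω μ p) = B := by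
  have hw : (fun i j => (((ω ![Δ i, Δ j] : ℤ) : ℚ) : ℝ)) = endForm Δ ω := by
    funext i j
    rw [endForm, Rat.cast_intCast]
  obtain ⟨B, hB⟩ := exists_topTreeSum_eq (fun i j => ((ω ![Δ i, Δ j] : ℤ) : ℚ))
    (fun i j => by rw [twoForm_swap]; push_cast; rfl) (commFactor Δ ω) (isCocycle_commFactor Δ ω)
    (Finset.univ.erase e₀)
    (by rw [Finset.card_erase_of_mem (Finset.mem_univ _), Finset.card_univ]; omega)
    (fun J K hJ hK h hJK h0 => by
      rw [hw] at h0
      exact commutator_commFactor_eq_zero hsum hE ω hJ hK h hJK h0)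
  rw [hw] at hB
  exact ⟨B, fun μ p A hμ hp hA hgp => hB _ (sum_defect_erase hsum ω hμ hp) fun T hT ho =>
    topPositive_or_topNegative hsum hE ω hμ hp hA hgp hT ho⟩

end Family

/-! ### Isomorphism classes of curves -/

namespace Curve

variable {E N : Type*} [Fintype E] [AddCommGroup N] {Δ : E → N}

theorem SameType.refl (c : Curve Δ) : c.SameType c := ⟨SimpleGraph.Iso.refl, fun _ => rfl⟩

theorem Iso.sameType {c c' : Curve Δ} (h : c.Iso c') : c.SameType c' :=
  let ⟨φ, h, _⟩ := h
  ⟨φ, h⟩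

theorem Iso.ev_eq {c c' : Curve Δ} (h : c.Iso c') (e : E) : c'.ev e = c.ev e := by
  obtain ⟨φ, h1, -, h3⟩ := h
  rw [ev, ev, h1, h3]

/-- The clusters of a curve rooted at the end `e₀`; they do not depend on the chosen rooting
(`Curve.clusters_eq`). -/
def typeClusters [DecidableEq E] (c : Curve Δ) (e₀ : E) : Finset (Finset E) :=
  c.clusters (exists_rooting c.isTree (c.endVert e₀)).some

theorem cluster_eq_cluster [DecidableEq E] (c : Curve Δ) {e₀ : E}
    (ρ ρ' : Rooting c.graph (c.endVert e₀)) (v : Fin c.numVert) :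
    c.cluster ρ v = c.cluster ρ' v := by
  have : ρ.parent = ρ'.parent := funext fun v => ρ.parent_eq ρ' v
  rw [cluster, cluster, Rooting.below, Rooting.below, this]

theorem clusters_eq [DecidableEq E] (c : Curve Δ) {e₀ : E}
    (ρ : Rooting c.graph (c.endVert e₀)) : c.clusters ρ = c.typeClusters e₀ := by
  rw [typeClusters, clusters, clusters]
  congr 1
  exact funext (c.cluster_eq_cluster ρ _)

/-- An isomorphism of graphs with labelled ends preserves the clusters. -/
theorem cluster_map [DecidableEq E] {c c' : Curve Δ} (φ : c.graph ≃g c'.graph)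
    (hφ : ∀ e, c'.endVert e = φ (c.endVert e)) {e₀ : E} (ρ : Rooting c.graph (c.endVert e₀))
    (ρ₁ : Rooting c'.graph (c'.endVert e₀)) (v : Fin c.numVert) :
    c'.cluster ρ₁ (φ v) = c.cluster ρ v := by
  let ρ' : Rooting c'.graph (c'.endVert e₀) :=
    { parent := fun v => φ (ρ.parent (φ.symm v))
      depth := fun v => ρ.depth (φ.symm v)
      parent_root := by rw [hφ, RelIso.symm_apply_apply, ρ.parent_root]
      adj_parent := fun v hv => by
        have h := ρ.adj_parent (φ.symm v) (fun h => hv (by rw [hφ, ← h, RelIso.apply_symm_apply]))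
        have h' := φ.map_adj_iff.2 h
        rwa [RelIso.apply_symm_apply] at h'
      depth_parent := fun v hv => by
        rw [RelIso.symm_apply_apply]
        exact ρ.depth_parent (φ.symm v) (fun h => hv (by rw [hφ, ← h, RelIso.apply_symm_apply]))
      eq_parent_of_adj := fun u v h => by
        have hne : ∀ w, φ.symm w ≠ c.endVert e₀ → w ≠ c'.endVert e₀ := fun w hw h =>
          hw (by rw [h, hφ, RelIso.symm_apply_apply])
        refine (ρ.eq_parent_of_adj _ _ (φ.symm.map_adj_iff.2 h)).imp
          (fun h => ⟨hne _ h.1, ?_⟩) (fun h => ⟨hne _ h.1, ?_⟩) <;>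
        rw [← h.2, RelIso.apply_symm_apply] }
  have hit : ∀ k v, ρ'.parent^[k] (φ v) = φ (ρ.parent^[k] v) := by
    intro k
    induction k with
    | zero => exact fun _ => rfl
    | succ k ih =>
      intro v
      rw [Function.iterate_succ_apply, Function.iterate_succ_apply, ← ih]
      congr 1
      change φ (ρ.parent (φ.symm (φ v))) = _
      rw [RelIso.symm_apply_apply]
  rw [c'.cluster_eq_cluster ρ₁ ρ']
  ext e
  rw [mem_cluster, mem_cluster, Rooting.mem_below, Rooting.mem_below]
  refine and_congr_right fun _ => exists_congr fun k => ?_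
  rw [← φ.injective.eq_iff, ← hit]
  exact iff_of_eq (congrArg (fun x => ρ'.parent^[k] x = φ v) (hφ e))

theorem SameType.typeClusters_eq [DecidableEq E] {c c' : Curve Δ} (h : c.SameType c') (e₀ : E) :
    c'.typeClusters e₀ = c.typeClusters e₀ := by
  obtain ⟨φ, hφ⟩ := h
  obtain ⟨ρ⟩ := exists_rooting c.isTree (c.endVert e₀)
  obtain ⟨ρ'⟩ := exists_rooting c'.isTree (c'.endVert e₀)
  rw [← c.clusters_eq ρ, ← c'.clusters_eq ρ']
  ext J
  rw [mem_clusters, mem_clusters]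
  constructor
  · rintro ⟨v, rfl⟩
    exact ⟨φ.symm v, by rw [← cluster_map φ hφ ρ ρ', RelIso.apply_symm_apply]⟩
  · rintro ⟨v, rfl⟩
    exact ⟨φ v, cluster_map φ hφ ρ ρ' v⟩

theorem sameType_of_typeClusters_eq [DecidableEq E] {c c' : Curve Δ} {e₀ : E}
    (h : c.typeClusters e₀ = c'.typeClusters e₀) : c.SameType c' :=
  sameType_of_clusters_eq c c' _ _ h

end Curve

/-! ### The number of curves -/

section Count

variable {E N : Type*} [Fintype E] [AddCommGroup N] {Δ : E → N} [DecidableEq E] {e₀ : E}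

/-- If the clusters of a curve are the nodes of an ordered tree, the form does not vanish at its
vertices. -/
theorem Curve.pairing_ne_zero_of_nodes (c : Curve Δ) (ρ : Rooting c.graph (c.endVert e₀))
    (ω : TwoForm N) {T : BinTree E} {I : Finset E} (hT : T ∈ binTrees I)
    (ho : T.Ordered (endForm Δ ω)) (h : c.clusters ρ = T.nodes) (v : Fin c.numVert)
    (x y : Fin c.numVert ⊕ E) (hxy : x ≠ y) (hb : c.branches ρ v = {x, y}) :
    pairing (endForm Δ ω) (c.branchCluster ρ x) (c.branchCluster ρ y) ≠ 0 := by
  have hv : c.cluster ρ v ∈ T.nodes := h ▸ (c.mem_clusters ρ).2 ⟨v, rfl⟩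
  obtain ⟨A, B, hd, hA, hB, hp, pA, pB, iA, iB⟩ := BinTree.exists_branches_of_mem_nodes hT ho hv
  rw [← h] at pA pB iA iB
  obtain ⟨a, ha, rfl⟩ := c.exists_branch_of_isParentIn ρ pA iA
  obtain ⟨b, hb', rfl⟩ := c.exists_branch_of_isParentIn ρ pB iB
  have hab : a ≠ b := by
    rintro rfl
    exact hA.ne_empty (disjoint_self.1 hd)
  rw [hb, Finset.mem_insert, Finset.mem_singleton] at ha hb'
  rcases ha with rfl | rfl <;> rcases hb' with rfl | rfl
  · exact absurd rfl hab
  · exact hp.ne'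
  · rw [pairing_swap (endForm_swap Δ ω)]
    exact neg_ne_zero.2 hp.ne'
  · exact absurd rfl hab

variable [Module.Free ℤ N]

/-- The multiplicity of a solution is that of the flow tree with the same clusters. -/
theorem Curve.refinedMult_eq_mult (hsum : ∑ e, Δ e = 0) (ω : TwoForm N) (c : Curve Δ)
    (hc : c.Trivalent) {T : BinTree E} (hT : T ∈ binTrees (Finset.univ.erase e₀))
    (ho : T.Ordered (endForm Δ ω)) (h : c.typeClusters e₀ = T.nodes) :
    c.refinedMult ω = T.mult (commFactor Δ ω) := by
  obtain ⟨ρ⟩ := exists_rooting c.isTree (c.endVert e₀)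
  rw [← c.clusters_eq ρ] at h
  obtain ⟨T', hT', hp, hn, hm⟩ := c.exists_tree ρ hsum ω hc
    (c.pairing_ne_zero_of_nodes ρ ω hT ho h) (p := c.pos (c.endVert e₀)) rfl
  rw [← hm, BinTree.eq_of_nodes_eq (endForm_swap Δ ω) hT' hT hp.ordered ho (hn.trans h)]

/-- The solutions of a problem in general position are counted by flow trees, at each of the
finitely many possible images `x` of the end `e₀`. -/
theorem hasCount_of_finset (hsum : ∑ e, Δ e = 0) (hE : 3 ≤ Fintype.card E) (ω : TwoForm N)
    {B : RefinedRing Δ ω}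
    (hB : ∀ (μ : E → ℝ) (p : RealSpace N) (A : Set (EndSpace (Δ e₀))),
      ∑ e, μ e = 0 → realContract ω (Δ e₀) p = μ e₀ →
      (Submodule.span ℝ {incl N (Δ e₀)}).mkQ p ∈ A → GeneralPosition Δ ω e₀ μ A →
      topTreeSum (endForm Δ ω) (commFactor Δ ω) (Finset.univ.erase e₀) (defect Δ ω μ p) = B)
    {μ : E → ℝ} (hμ : ∑ e, μ e = 0) {A : Set (EndSpace (Δ e₀))}
    (hA : GeneralPosition Δ ω e₀ μ A) (X : Finset (EndSpace (Δ e₀)))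
    (hX : ∀ x, x ∈ X ↔ x ∈ A ∧ spaceForm ω (Δ e₀) x = μ e₀) (W : EndSpace (Δ e₀) → ℕ) :
    HasCount (Solves ω e₀ μ A) (fun c => W (c.ev e₀) • c.refinedMult ω)
      ((∑ x ∈ X, W x) • B) := by
  classical
  have hform : ∀ c : Curve Δ, spaceForm ω (Δ e₀) (c.ev e₀) = c.moment ω e₀ := fun c => rfl
  have hev : ∀ c : Curve Δ, Solves ω e₀ μ A c ↔ c.moment ω = μ ∧ c.ev e₀ ∈ X := fun c => by
    rw [hX, Solves]
    refine and_congr_right fun h => ⟨fun h' => ⟨h', ?_⟩, And.left⟩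
    rw [hform, h]
  -- In general position a solution is determined up to isomorphism by `h(e₀)` and its clusters.
  -- The pairs which occur index the representatives.
  let real : EndSpace (Δ e₀) × Finset (Finset E) → Prop := fun z =>
    ∃ c : Curve Δ, c.moment ω = μ ∧ c.ev e₀ = z.1 ∧ c.typeClusters e₀ = z.2
  let D := (X ×ˢ Finset.univ).filter real
  have hD : ∀ z ∈ D, real z := fun z hz => (Finset.mem_filter.1 hz).2
  have hDX : ∀ z ∈ D, z.1 ∈ X := fun z hz => (Finset.mem_product.1 (Finset.mem_filter.1 hz).1).1
  obtain ⟨rep, hrep⟩ : ∃ rep : D → Curve Δ, ∀ z, (rep z).moment ω = μ ∧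
      (rep z).ev e₀ = z.1.1 ∧ (rep z).typeClusters e₀ = z.1.2 := by
    choose rep h using fun z : D => hD z.1 z.2
    exact ⟨rep, h⟩
  have hsol : ∀ z, Solves ω e₀ μ A (rep z) := fun z =>
    (hev _).2 ⟨(hrep z).1, by rw [(hrep z).2.1]; exact hDX _ z.2⟩
  have hinj : Function.Injective rep := fun z z' h => by
    refine Subtype.ext (Prod.ext ?_ ?_)
    · rw [← (hrep z).2.1, ← (hrep z').2.1, h]
    · rw [← (hrep z).2.2, ← (hrep z').2.2, h]
  refine ⟨Finset.univ.map ⟨rep, hinj⟩, ?_, ?_, ?_⟩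
  · intro c hc
    obtain ⟨z, -, rfl⟩ := Finset.mem_map.1 hc
    exact hsol z
  · intro c hc
    have hc' := (hev c).1 hc
    have hmem : (c.ev e₀, c.typeClusters e₀) ∈ D :=
      Finset.mem_filter.2 ⟨Finset.mem_product.2 ⟨hc'.2, Finset.mem_univ _⟩, c, hc.1, rfl, rfl⟩
    have hz := hrep ⟨_, hmem⟩
    refine ⟨rep ⟨_, hmem⟩, ⟨Finset.mem_map.2 ⟨_, Finset.mem_univ _, rfl⟩, ?_⟩, ?_⟩
    · exact (hA c hc).2 _ _ (Curve.SameType.refl c)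
        (Curve.sameType_of_typeClusters_eq hz.2.2.symm) (hc.1.trans hz.1.symm) hz.2.1.symm
    · rintro s ⟨hs, hcs⟩
      obtain ⟨z, -, rfl⟩ := Finset.mem_map.1 hs
      change rep z = _
      congr 1
      refine Subtype.ext (Prod.ext ?_ ?_)
      · rw [← (hrep z).2.1]
        exact hcs.ev_eq e₀
      · rw [← (hrep z).2.2]
        exact hcs.sameType.typeClusters_eq e₀
  · rw [Finset.sum_map]
    change ∑ z : D, W ((rep z).ev e₀) • (rep z).refinedMult ω = _
    let g : EndSpace (Δ e₀) × Finset (Finset E) → RefinedRing Δ ω := fun z =>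
      if h : z ∈ D then (rep ⟨z, h⟩).refinedMult ω else 0
    have e1 : ∀ z : D, W ((rep z).ev e₀) • (rep z).refinedMult ω = W z.1.1 • g z.1 := fun z => by
      rw [(hrep z).2.1]
      simp only [g]
      rw [dif_pos z.2]
    rw [Finset.sum_congr rfl fun z _ => e1 z,
      Finset.sum_coe_sort D (fun z => W z.1 • g z)]
    rw [Finset.sum_filter_of_ne fun z hz h => ?_, Finset.sum_product, Finset.sum_smul]
    swap
    · by_contra h'
      refine h ?_
      have : z ∉ D := fun h'' => h' (hD z h'')
      simp only [g]
      rw [dif_neg this, smul_zero]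
    refine Finset.sum_congr rfl fun x hx => ?_
    refine (Finset.smul_sum (r := W x) (s := Finset.univ) (f := fun F => g (x, F))).symm.trans ?_
    congr 1
    obtain ⟨p, rfl⟩ := Submodule.mkQ_surjective _ x
    have hx' := (hX _).1 hx
    rw [← hB μ p A hμ hx'.2 hx'.1 hA, topTreeSum, ← Finset.sum_filter]
    symm
    have hDx : ∀ {F}, ((Submodule.span ℝ {incl N (Δ e₀)}).mkQ p, F) ∈ D ↔
        real ((Submodule.span ℝ {incl N (Δ e₀)}).mkQ p, F) := fun {F} =>
      ⟨hD _, fun h => Finset.mem_filter.2 ⟨Finset.mem_product.2 ⟨hx, Finset.mem_univ _⟩, h⟩⟩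
    have hTreal : ∀ T ∈ (binTrees (Finset.univ.erase e₀)).filter
        (fun T => T.TopPositive (endForm Δ ω) (defect Δ ω μ p)),
        ∃ h : ((Submodule.span ℝ {incl N (Δ e₀)}).mkQ p, T.nodes) ∈ D,
          T.mult (commFactor Δ ω) = (rep ⟨_, h⟩).refinedMult ω := by
      intro T hT
      rw [Finset.mem_filter] at hT
      obtain ⟨c, ρ, h1, h2, h3⟩ := exists_curve_of_tree hsum hE ω hμ hx'.2 hT.1 hT.2.ordered
        hT.2.not_topNegative
      rw [Finset.filter_true_of_mem fun J hJ hJ' =>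
        ((BinTree.topPositive_iff_lengths hT.1 hT.2.ordered _).1 hT.2 J hJ hJ').ne',
        c.clusters_eq] at h3
      have hm := hDx.2 ⟨c, h1, h2, h3⟩
      refine ⟨hm, ?_⟩
      rw [(rep ⟨_, hm⟩).refinedMult_eq_mult hsum ω (hA _ (hsol _)).1 hT.1 hT.2.ordered
        (hrep ⟨_, hm⟩).2.2]
    -- The flow trees correspond to the families of clusters of the solutions of non-zero
    -- multiplicity.
    refine Finset.sum_bij_ne_zero (fun T _ _ => T.nodes) (fun _ _ _ => Finset.mem_univ _) ?_ ?_ ?_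
    · intro T hT _ T' hT' _ h
      rw [Finset.mem_filter] at hT hT'
      exact BinTree.eq_of_nodes_eq (endForm_swap Δ ω) hT.1 hT'.1 hT.2.ordered hT'.2.ordered h
    · intro F _ hF
      by_cases h : ((Submodule.span ℝ {incl N (Δ e₀)}).mkQ p, F) ∈ D
      · simp only [g] at hF
        rw [dif_pos h] at hF
        have hr := hrep ⟨_, h⟩
        obtain ⟨ρ⟩ := exists_rooting (rep ⟨_, h⟩).isTree ((rep ⟨_, h⟩).endVert e₀)
        obtain ⟨T, h1, h2, h3, h4⟩ := (rep ⟨_, h⟩).exists_tree ρ hsum ω (hA _ (hsol _)).1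
          ((rep ⟨_, h⟩).pairing_ne_zero_of_refinedMult ρ hsum ω hF) (p := p) hr.2.1
        rw [hr.1] at h2
        rw [Curve.clusters_eq, hr.2.2] at h3
        exact ⟨T, Finset.mem_filter.2 ⟨h1, h2⟩, by rw [h4]; exact hF, h3⟩
      · simp only [g] at hF
        rw [dif_neg h] at hF
        exact absurd rfl hF
    · intro T hT _
      obtain ⟨h, h'⟩ := hTreal T hT
      simp only [g]
      rw [dif_pos h, h']

end Count

/-! ### Dimension of the families of curves -/

namespace Curve

variable {E N : Type*} [Fintype E] [AddCommGroup N] {Δ : E → N} [DecidableEq E]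
  (c : Curve Δ) {e₀ : E} (ρ : Rooting c.graph (c.endVert e₀))

open Classical in
/-- The length of the edge that joins the vertex with cluster `J` to its parent; it is zero for
the cluster of the root, and if `J` is not a cluster. -/
def clusterLen (J : Finset E) : ℝ :=
  if h : ∃ v, c.cluster ρ v = J then c.edgeLen (ρ.parent h.choose) h.choose else 0

theorem clusterLen_cluster (v : Fin c.numVert) :
    c.clusterLen ρ (c.cluster ρ v) = c.edgeLen (ρ.parent v) v := by
  have h : ∃ w, c.cluster ρ w = c.cluster ρ v := ⟨v, rfl⟩
  rw [clusterLen, dif_pos h, c.cluster_injective ρ h.choose_spec]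

theorem clusterLen_top : c.clusterLen ρ (Finset.univ.erase e₀) = 0 := by
  rw [← c.cluster_root ρ, clusterLen_cluster, ρ.parent_root, edgeLen, dif_neg]
  exact fun h => h.ne rfl

variable [Module.Free ℤ N]

/-- The position of a vertex is reached from the root along the edges of the clusters that
contain its own. -/
theorem pos_eq_familyPos (v : Fin c.numVert) :
    c.pos v = familyPos Δ (c.clusters ρ) (c.pos (c.endVert e₀)) (c.clusterLen ρ)
      (c.cluster ρ v) := by
  induction' hn : ρ.depth v using Nat.strong_induction_on with n ih generalizing v
  by_cases hv : v = c.endVert e₀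
  · subst hv
    rw [familyPos, left_eq_add]
    refine Finset.sum_eq_zero fun J hJ => ?_
    rw [Finset.mem_filter, mem_clusters] at hJ
    obtain ⟨⟨w, rfl⟩, h⟩ := hJ
    rw [cluster_root] at h
    have : c.cluster ρ w = Finset.univ.erase e₀ :=
      subset_antisymm (Finset.erase_subset_erase _ (Finset.subset_univ _)) h
    rw [this, clusterLen_top, zero_smul]
  · rw [familyPos_parent Δ _ _ ((c.mem_clusters ρ).2 ⟨v, rfl⟩) (c.isParentIn_clusters ρ hv),
      ← ih _ (hn ▸ ρ.depth_parent v hv) _ rfl, clusterLen_cluster, c.pos_parent ρ v hv]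

theorem pos_endVert (e : E) :
    c.pos (c.endVert e) = c.pos (c.endVert e₀) +
      ∑ J ∈ (c.clusters ρ).erase (Finset.univ.erase e₀),
        if e ∈ J then c.clusterLen ρ J • incl N (∑ k ∈ J, Δ k) else 0 := by
  rw [Finset.sum_erase _ (by simp [clusterLen_top]), ← Finset.sum_filter]
  by_cases he : e = e₀
  · rw [Finset.filter_false_of_mem, Finset.sum_empty, add_zero, he]
    intro J hJ
    obtain ⟨v, rfl⟩ := (c.mem_clusters ρ).1 hJ
    rw [he, mem_cluster]
    exact fun h => h.1 rfl
  · have hpar := c.isParentIn_clusters_singleton ρ he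
    have hf : (c.clusters ρ).filter (c.cluster ρ (c.endVert e) ⊆ ·) =
        (c.clusters ρ).filter (e ∈ ·) := by
      refine Finset.filter_congr fun J hJ => ⟨fun h => h (hpar.2.1.1 (by simp)), fun h => ?_⟩
      refine hpar.2.2 J hJ (LE.le.ssubset_of_ne (by simpa using h) fun h' => ?_)
      obtain ⟨v, rfl⟩ := (c.mem_clusters ρ).1 hJ
      have := c.two_le_card_cluster ρ v
      rw [← h', Finset.card_singleton] at this
      omega
    rw [c.pos_eq_familyPos ρ (c.endVert e), familyPos, hf]

/-- A curve is determined by its clusters, the lengths of its edges and one position. -/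
theorem iso_of_clusterLen_eq (c' : Curve Δ) (ρ' : Rooting c'.graph (c'.endVert e₀))
    (h : c.clusters ρ = c'.clusters ρ') (hp : c.pos (c.endVert e₀) = c'.pos (c'.endVert e₀))
    (hl : ∀ J ∈ (c.clusters ρ).erase (Finset.univ.erase e₀),
      c.clusterLen ρ J = c'.clusterLen ρ' J) : c.Iso c' := by
  obtain ⟨φ, hφ⟩ := sameType_of_clusters_eq c c' ρ ρ' h
  have hcl := cluster_map φ hφ ρ ρ'
  have hlen : c.clusterLen ρ = c'.clusterLen ρ' := by
    funext J
    by_cases hJ : J ∈ c.clusters ρ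
    · by_cases hJ' : J = Finset.univ.erase e₀
      · rw [hJ', clusterLen_top, clusterLen_top]
      · exact hl J (Finset.mem_erase.2 ⟨hJ', hJ⟩)
    · have hJ' := hJ
      rw [h, mem_clusters] at hJ'
      rw [mem_clusters] at hJ
      rw [clusterLen, clusterLen, dif_neg hJ, dif_neg hJ']
  have hpar : ∀ v, v ≠ c.endVert e₀ → φ (ρ.parent v) = ρ'.parent (φ v) := fun v hv => by
    apply c'.cluster_injective ρ'
    have h1 := c.isParentIn_clusters ρ hv
    have h2 := c'.isParentIn_clusters ρ' (v := φ v)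
      (fun h' => hv (φ.injective (h'.trans (hφ e₀))))
    rw [hcl] at h2 ⊢
    rw [h] at h1
    exact h1.unique h2
  have hedge : ∀ v, v ≠ c.endVert e₀ →
      c'.edgeLen (φ (ρ.parent v)) (φ v) = c.edgeLen (ρ.parent v) v := fun v hv => by
    rw [hpar v hv, ← clusterLen_cluster, ← clusterLen_cluster, hcl, hlen]
  refine ⟨φ, hφ, fun u v huv => ?_, fun v => ?_⟩
  · have e1 : c'.length (φ.map_adj_iff.2 huv) = c'.edgeLen (φ u) (φ v) := by
      rw [edgeLen, dif_pos (φ.map_adj_iff.2 huv)]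
    have e2 : c.length huv = c.edgeLen u v := by rw [edgeLen, dif_pos huv]
    rw [e1, e2]
    rcases ρ.eq_parent_of_adj u v huv with ⟨h1, rfl⟩ | ⟨h1, rfl⟩
    · exact hedge v h1
    · rw [c'.edgeLen_symm, c.edgeLen_symm]
      exact hedge u h1
  · rw [c.pos_eq_familyPos ρ, c'.pos_eq_familyPos ρ', hcl, h, hp, hlen]

end Curve

section Constraints

variable {E N : Type*} [Fintype E] [AddCommGroup N] (Δ : E → N) (ω : TwoForm N) (e₀ : E)

/-- The equations satisfied by the constraints for which there may be solutions: the moments sum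
up to zero, and the image of the end `e₀` lies in a hyperplane determined by its moment. -/
def constraintMap : (E → ℝ) × EndSpace (Δ e₀) →ₗ[ℝ] ℝ × ℝ :=
  ((∑ e, LinearMap.proj (R := ℝ) (φ := fun _ : E => ℝ) e) ∘ₗ LinearMap.fst ℝ _ _).prod
    (spaceForm ω (Δ e₀) ∘ₗ LinearMap.snd ℝ _ _ -
      LinearMap.proj (R := ℝ) (φ := fun _ : E => ℝ) e₀ ∘ₗ LinearMap.fst ℝ _ _)

/-- The space of the constraints for which there may be solutions. -/
def constraintSpace : Submodule ℝ ((E → ℝ) × EndSpace (Δ e₀)) :=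
  LinearMap.ker (constraintMap Δ ω e₀)

variable {Δ ω e₀}

theorem mem_constraintSpace {z : (E → ℝ) × EndSpace (Δ e₀)} :
    z ∈ constraintSpace Δ ω e₀ ↔ ∑ e, z.1 e = 0 ∧ spaceForm ω (Δ e₀) z.2 = z.1 e₀ := by
  rw [constraintSpace, LinearMap.mem_ker, Prod.ext_iff]
  simp [constraintMap, sub_eq_zero]

variable [Module.Finite ℤ N]

/-- The constraint space has codimension at most `2` in a space of dimension at least `#E + rank
N - 1`. -/
theorem finrank_constraintSpace : Fintype.card E + Module.finrank ℝ (RealSpace N) ≤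
    Module.finrank ℝ (constraintSpace Δ ω e₀) + 3 := by
  have h1 := LinearMap.finrank_range_add_finrank_ker (constraintMap Δ ω e₀)
  have h2 := Submodule.finrank_le (LinearMap.range (constraintMap Δ ω e₀))
  have h3 : Module.finrank ℝ (EndSpace (Δ e₀)) + _ = _ :=
    Submodule.finrank_quotient_add_finrank (Submodule.span ℝ {incl N (Δ e₀)})
  have h4 := finrank_span_le_card (R := ℝ) ({incl N (Δ e₀)} : Set (RealSpace N))
  rw [Module.finrank_prod, Module.finrank_fintype_fun_eq_card] at h1
  rw [Module.finrank_prod, Module.finrank_self] at h2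
  simp only [Set.toFinset_singleton, Finset.card_singleton] at h4
  rw [constraintSpace]
  omega

end Constraints

section TypeMap

variable {E N : Type*} [Fintype E] [AddCommGroup N] (Δ : E → N) [DecidableEq E] (ω : TwoForm N)
  (e₀ : E)

/-- The parameters for the curves with a given family of clusters: the position of the vertex of
the root end and the lengths of the bounded edges. -/
abbrev TypeParam (N : Type*) [AddCommGroup N] (e₀ : E) (L : Finset (Finset E)) : Type _ :=
  RealSpace N × (L.erase (Finset.univ.erase e₀) → ℝ)

/-- The position of the vertex of an end, as a function of the parameters. -/
def typePos (L : Finset (Finset E)) (e : E) : TypeParam N e₀ L →ₗ[ℝ] RealSpace N :=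
  LinearMap.fst ℝ _ _ + ∑ J : L.erase (Finset.univ.erase e₀),
    if e ∈ J.1 then (LinearMap.toSpanSingleton ℝ (RealSpace N) (incl N (∑ k ∈ J.1, Δ k))) ∘ₗ
      LinearMap.proj J ∘ₗ LinearMap.snd ℝ _ _ else 0

theorem typePos_apply (L : Finset (Finset E)) (e : E) (z : TypeParam N e₀ L) :
    typePos Δ e₀ L e z = z.1 + ∑ J : L.erase (Finset.univ.erase e₀),
      if e ∈ J.1 then z.2 J • incl N (∑ k ∈ J.1, Δ k) else 0 := by
  rw [typePos, LinearMap.add_apply, LinearMap.sum_apply]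
  congr 1
  refine Finset.sum_congr rfl fun J _ => ?_
  split_ifs <;> rfl

/-- The moments and the image of the end `e₀`, as a function of the parameters. -/
def typeMap (L : Finset (Finset E)) : TypeParam N e₀ L →ₗ[ℝ] (E → ℝ) × EndSpace (Δ e₀) :=
  (LinearMap.pi fun e => realContract ω (Δ e) ∘ₗ typePos Δ e₀ L e).prod
    ((Submodule.span ℝ {incl N (Δ e₀)}).mkQ ∘ₗ LinearMap.fst ℝ _ _)

variable {Δ ω e₀}

/-- The parameters of a curve. -/
def Curve.param (c : Curve Δ) (ρ : Rooting c.graph (c.endVert e₀)) :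
    TypeParam N e₀ (c.clusters ρ) :=
  (c.pos (c.endVert e₀), fun J => c.clusterLen ρ J.1)

variable [Module.Free ℤ N]

theorem Curve.typeMap_param (c : Curve Δ) (ρ : Rooting c.graph (c.endVert e₀)) :
    typeMap Δ ω e₀ (c.clusters ρ) (c.param ρ) = (c.moment ω, c.ev e₀) := by
  refine Prod.ext (funext fun e => ?_) rfl
  change realContract ω (Δ e) (typePos Δ e₀ (c.clusters ρ) e (c.param ρ)) = _
  rw [typePos_apply]
  change _ = realContract ω (Δ e) (c.pos (c.endVert e))
  rw [c.pos_endVert ρ e]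
  congr 2
  exact Finset.sum_coe_sort ((c.clusters ρ).erase (Finset.univ.erase e₀))
    (fun J => if e ∈ J then c.clusterLen ρ J • incl N (∑ k ∈ J, Δ k) else 0)

theorem Curve.mem_range_typeMap (c : Curve Δ) :
    (c.moment ω, c.ev e₀) ∈ LinearMap.range (typeMap Δ ω e₀ (c.typeClusters e₀)) :=
  ⟨_, c.typeMap_param _⟩

variable [Module.Finite ℤ N]

theorem Curve.finrank_typeParam (c : Curve Δ) (ρ : Rooting c.graph (c.endVert e₀)) :
    Module.finrank ℝ (TypeParam N e₀ (c.clusters ρ)) + 1 =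
      Module.finrank ℝ (RealSpace N) + c.numVert := by
  have h : Finset.univ.erase e₀ ∈ c.clusters ρ :=
    (c.mem_clusters ρ).2 ⟨_, c.cluster_root ρ⟩
  have h1 := Finset.card_erase_add_one h
  rw [c.card_clusters ρ] at h1
  rw [Module.finrank_prod, Module.finrank_fintype_fun_eq_card, Fintype.card_coe]
  omega

/-- The curves which are not trivalent, and those with a type on which the evaluation is not
injective, have constraints in a proper subspace. -/
theorem Curve.exists_notMem_range (c : Curve Δ) (h : ¬ (c.Trivalent ∧ c.EvInjective ω e₀)) :
    ¬ constraintSpace Δ ω e₀ ≤ LinearMap.range (typeMap Δ ω e₀ (c.typeClusters e₀)) := by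
  intro hle
  obtain ⟨ρ⟩ := exists_rooting c.isTree (c.endVert e₀)
  rw [← c.clusters_eq ρ] at hle
  have h1 := Submodule.finrank_mono hle
  have h2 := finrank_constraintSpace (Δ := Δ) (ω := ω) (e₀ := e₀)
  have h3 := LinearMap.finrank_range_add_finrank_ker (typeMap Δ ω e₀ (c.clusters ρ))
  have h4 := c.finrank_typeParam ρ
  have h5 := c.numVert_add_two_le e₀
  -- The parameters form a space of dimension `rank N + #V - 1` with `#V ≤ #E - 2`, so that the
  -- image contains a space of dimension `#E + rank N - 3` only if the curve is trivalent and the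
  -- kernel zero.
  have h6 : c.numVert + 2 = Fintype.card E := by omega
  refine h ⟨(c.trivalent_iff e₀).2 h6, fun c₁ c₂ t₁ t₂ hm hev => ?_⟩
  have hker : LinearMap.ker (typeMap Δ ω e₀ (c.clusters ρ)) = ⊥ :=
    Submodule.finrank_eq_zero.1 (by omega)
  rw [LinearMap.ker_eq_bot] at hker
  obtain ⟨ρ₁⟩ := exists_rooting c₁.isTree (c₁.endVert e₀)
  obtain ⟨ρ₂⟩ := exists_rooting c₂.isTree (c₂.endVert e₀)
  have k₁ : c₁.clusters ρ₁ = c.clusters ρ := by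
    rw [c₁.clusters_eq, c.clusters_eq, t₁.typeClusters_eq]
  have k₂ : c₂.clusters ρ₂ = c.clusters ρ := by
    rw [c₂.clusters_eq, c.clusters_eq, t₂.typeClusters_eq]
  have p₁ := c₁.typeMap_param ρ₁ (ω := ω)
  have p₂ := c₂.typeMap_param ρ₂ (ω := ω)
  have key : ∀ (L L' : Finset (Finset E)) (z : TypeParam N e₀ L) (z' : TypeParam N e₀ L'),
      L = L' → Function.Injective (typeMap Δ ω e₀ L) →
      typeMap Δ ω e₀ L z = typeMap Δ ω e₀ L' z' →
      z.1 = z'.1 ∧ ∀ J hJ hJ', z.2 ⟨J, hJ⟩ = z'.2 ⟨J, hJ'⟩ := by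
    rintro L _ z z' rfl hi h
    rw [hi h]
    exact ⟨rfl, fun _ _ _ => rfl⟩
  obtain ⟨q1, q2⟩ := key _ _ (c₁.param ρ₁) (c₂.param ρ₂) (k₁.trans k₂.symm) (k₁ ▸ hker)
    (by rw [p₁, p₂, hm, hev])
  exact c₁.iso_of_clusterLen_eq ρ₁ c₂ ρ₂ (k₁.trans k₂.symm) q1 fun J hJ =>
    q2 J hJ ((k₁.trans k₂.symm) ▸ hJ)

end TypeMap

/-! ### General position -/

theorem holdsGenerically_of_finite {W ι : Type*} [AddCommGroup W] [Module ℝ W] [Finite ι]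
    {P : W → Prop} (A : ι → AffineSubspace ℝ W) (hA : ∀ i, A i ≠ ⊤)
    (h : ∀ w, ¬ P w → ∃ i, w ∈ A i) : HoldsGenerically P := by
  classical
  have := Fintype.ofFinite ι
  refine ⟨Finset.univ.image A, fun B hB => ?_, fun w hw => ?_⟩
  · obtain ⟨i, -, rfl⟩ := Finset.mem_image.1 hB
    exact hA i
  · obtain ⟨i, hi⟩ := h w hw
    exact ⟨A i, Finset.mem_image_of_mem _ (Finset.mem_univ i), hi⟩

/-- The preimage of a subspace under the affine map `w ↦ ψ w + b`. -/
def preimageSubspace {W Z : Type*} [AddCommGroup W] [Module ℝ W] [AddCommGroup Z] [Module ℝ Z]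
    (ψ : W →ₗ[ℝ] Z) (b : Z) (R : Submodule ℝ Z) : AffineSubspace ℝ W :=
  R.toAffineSubspace.comap (ψ.toAffineMap + AffineMap.const ℝ W b)

theorem mem_preimageSubspace {W Z : Type*} [AddCommGroup W] [Module ℝ W] [AddCommGroup Z]
    [Module ℝ Z] {ψ : W →ₗ[ℝ] Z} {b : Z} {R : Submodule ℝ Z} {w : W} :
    w ∈ preimageSubspace ψ b R ↔ ψ w + b ∈ R := Iff.rfl

theorem preimageSubspace_ne_top {W Z : Type*} [AddCommGroup W] [Module ℝ W] [AddCommGroup Z]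
    [Module ℝ Z] {ψ : W →ₗ[ℝ] Z} {b : Z} {R : Submodule ℝ Z} {w : W} (h : ψ w + b ∉ R) :
    preimageSubspace ψ b R ≠ ⊤ := fun h' =>
  h (mem_preimageSubspace.1 (h' ▸ AffineSubspace.mem_top ℝ W w))

section Generic

variable {E N : Type*} [Fintype E] [AddCommGroup N] {Δ : E → N} {ω : TwoForm N} {e₀ : E}

theorem spaceForm_endIncl (ω : TwoForm N) (n : N) (δ : EndLattice n) :
    spaceForm ω n (endIncl n δ) = latticeForm ω n δ := by
  obtain ⟨a, rfl⟩ := Submodule.mkQ_surjective _ δ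
  exact realContract_incl ω n a

/-- The intersection of the line of slope `δ` through `x` with the hyperplane which contains the
image of the end `e₀`, together with the moments. -/
def lineConstraint (Δ : E → N) (ω : TwoForm N) (e₀ : E) (δ : EndLattice (Δ e₀)) :
    (momentSpace E × EndSpace (Δ e₀)) →ₗ[ℝ] (E → ℝ) × EndSpace (Δ e₀) :=
  ((momentSpace E).subtype ∘ₗ LinearMap.fst ℝ _ _).prod
    (LinearMap.snd ℝ _ _ + LinearMap.toSpanSingleton ℝ _ (endIncl (Δ e₀) δ) ∘ₗ
      ((latticeForm ω (Δ e₀) δ : ℝ)⁻¹ • (LinearMap.proj e₀ ∘ₗ (momentSpace E).subtype ∘ₗ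
        LinearMap.fst ℝ _ _ - spaceForm ω (Δ e₀) ∘ₗ LinearMap.snd ℝ _ _)))

theorem lineConstraint_apply (δ : EndLattice (Δ e₀)) (z : momentSpace E × EndSpace (Δ e₀)) :
    lineConstraint Δ ω e₀ δ z = ((z.1 : E → ℝ), z.2 +
      ((latticeForm ω (Δ e₀) δ : ℝ)⁻¹ * (z.1.1 e₀ - spaceForm ω (Δ e₀) z.2)) •
        endIncl (Δ e₀) δ) := rfl

theorem lineConstraint_eq {δ : EndLattice (Δ e₀)} (hδ : latticeForm ω (Δ e₀) δ ≠ 0)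
    (μ : momentSpace E) {x y : EndSpace (Δ e₀)} {t : ℝ} (hy : y = x + t • endIncl (Δ e₀) δ)
    (h : spaceForm ω (Δ e₀) y = μ.1 e₀) : lineConstraint Δ ω e₀ δ (μ, x) = (μ.1, y) := by
  rw [lineConstraint_apply, hy]
  rw [hy, map_add, map_smul, spaceForm_endIncl, smul_eq_mul] at h
  have : (latticeForm ω (Δ e₀) δ : ℝ) ≠ 0 := Int.cast_ne_zero.2 hδ
  congr 3
  simp only
  rw [← h]
  field_simp
  ring

/-- The vertex from which an edge of a tropical curve starts. -/
def TropicalCurve.origin {n : N} (Ξ : TropicalCurve n) : Ξ.Edge → Fin Ξ.numVert :=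
  Sum.elim Ξ.src Ξ.root

theorem TropicalCurve.exists_eq_of_mem_carrier {n : N} (Ξ : TropicalCurve n) {ε : Ξ.Edge}
    {x : EndSpace n} (h : x ∈ Ξ.carrier ε) :
    ∃ t : ℝ, 0 ≤ t ∧ x = Ξ.pos (Ξ.origin ε) + t • endIncl n (Ξ.edgeSlope ε) := by
  rcases ε with b | e
  · obtain ⟨t, h0, -, h⟩ := h
    exact ⟨t, h0, h⟩
  · exact h

variable [DecidableEq E]

/-- The families of clusters for which the constraints of the curves lie in a proper subspace. -/
abbrev SmallType (Δ : E → N) (ω : TwoForm N) (e₀ : E) : Type _ :=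
  {L : Finset (Finset E) //
    ¬ constraintSpace Δ ω e₀ ≤ LinearMap.range (typeMap Δ ω e₀ L)}

/-- The projection along `δ` is onto the constraint space, so that proper subspaces have proper
preimages. -/
theorem preimage_typeMap_ne_top (δ : EndLattice (Δ e₀)) (b : EndSpace (Δ e₀))
    (L : SmallType Δ ω e₀) :
    preimageSubspace (lineConstraint Δ ω e₀ δ) (lineConstraint Δ ω e₀ δ (0, b))
      (LinearMap.range (typeMap Δ ω e₀ L.1)) ≠ ⊤ := by
  obtain ⟨z, hz, hz'⟩ := Set.not_subset.1 L.2
  have hz := mem_constraintSpace.1 hz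
  refine preimageSubspace_ne_top (w := (⟨z.1, hz.1⟩, z.2 - b)) ?_
  rw [← map_add, Prod.mk_add_mk, add_zero, sub_add_cancel, lineConstraint_apply]
  simp only [hz.2, sub_self, mul_zero, zero_smul, add_zero]
  exact hz'

variable [Module.Free ℤ N]

/-- The constraints of a curve for which `h(e₀)` is on the line of slope `δ` through `x + b` lie
in the preimage of the image of its type. -/
theorem Curve.mem_preimage (c : Curve Δ) {δ : EndLattice (Δ e₀)}
    (hδ : latticeForm ω (Δ e₀) δ ≠ 0) (μ : momentSpace E) {x b : EndSpace (Δ e₀)} {t : ℝ}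
    (hm : c.moment ω = μ) (hx : c.ev e₀ = x + b + t • endIncl (Δ e₀) δ) :
    (μ, x) ∈ preimageSubspace (lineConstraint Δ ω e₀ δ) (lineConstraint Δ ω e₀ δ (0, b))
      (LinearMap.range (typeMap Δ ω e₀ (c.typeClusters e₀))) := by
  rw [mem_preimageSubspace, ← map_add, Prod.mk_add_mk, add_zero,
    lineConstraint_eq hδ μ hx (hm ▸ rfl), ← hm]
  exact c.mem_range_typeMap

variable [Module.Finite ℤ N]

theorem holdsGenerically_line {δ : EndLattice (Δ e₀)} (hδ : latticeForm ω (Δ e₀) δ ≠ 0) :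
    HoldsGenerically (fun p : momentSpace E × EndSpace (Δ e₀) =>
      GeneralPosition Δ ω e₀ p.1 (line (Δ e₀) p.2 δ)) := by
  refine holdsGenerically_of_finite _ (preimage_typeMap_ne_top (Δ := Δ) (ω := ω) δ 0) ?_
  rintro ⟨μ, x⟩ h
  rw [GeneralPosition] at h
  push Not at h
  obtain ⟨c, ⟨hm, t, ht⟩, hc⟩ := h
  refine ⟨⟨c.typeClusters e₀, c.exists_notMem_range fun h => hc h.1 h.2⟩,
    c.mem_preimage hδ μ hm (t := t) ?_⟩
  rw [add_zero]
  exact ht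

/-- The bad pairs `(μ, x)` are those for which a vertex of `Ξ + x` is on the hyperplane, and
those for which the line of an edge of `Ξ + x` meets it at a point of the image of a bad type. -/
theorem holdsGenerically_translate (hω : spaceForm ω (Δ e₀) ≠ 0) (Ξ : TropicalCurve (Δ e₀)) :
    HoldsGenerically (fun p : momentSpace E × EndSpace (Δ e₀) =>
      GenericCurve Δ ω e₀ p.1 (Ξ.translate p.2)) := by
  let A : Fin Ξ.numVert ⊕ (Ξ.Edge × SmallType Δ ω e₀) →
      AffineSubspace ℝ (momentSpace E × EndSpace (Δ e₀)) := Sum.elim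
    (fun v => preimageSubspace (spaceForm ω (Δ e₀) ∘ₗ LinearMap.snd ℝ _ _ -
      LinearMap.proj e₀ ∘ₗ (momentSpace E).subtype ∘ₗ LinearMap.fst ℝ _ _)
      (spaceForm ω (Δ e₀) (Ξ.pos v)) ⊥)
    (fun z => preimageSubspace (lineConstraint Δ ω e₀ (Ξ.edgeSlope z.1))
      (lineConstraint Δ ω e₀ (Ξ.edgeSlope z.1) (0, Ξ.pos (Ξ.origin z.1)))
      (LinearMap.range (typeMap Δ ω e₀ z.2.1)))
  have hAv : ∀ v μ x, (μ, x) ∈ A (.inl v) ↔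
      spaceForm ω (Δ e₀) (Ξ.pos v + x) = μ.1 e₀ := fun v μ x => by
    change spaceForm ω (Δ e₀) x - μ.1 e₀ + spaceForm ω (Δ e₀) (Ξ.pos v) = 0 ↔ _
    rw [map_add, ← sub_eq_zero (b := μ.1 e₀)]
    exact Eq.congr (by ring) rfl
  refine holdsGenerically_of_finite A ?_ ?_
  · rintro (v | ⟨ε, L⟩) h
    · obtain ⟨u, hu⟩ : ∃ u, spaceForm ω (Δ e₀) u ≠ 0 := by
        by_contra h'
        push Not at h'
        exact hω (LinearMap.ext h')
      have h1 := (hAv v 0 (u - Ξ.pos v)).1 (h ▸ AffineSubspace.mem_top _ _ _)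
      rw [add_sub_cancel] at h1
      exact hu h1
    · exact preimage_typeMap_ne_top _ _ L h
  · rintro ⟨μ, x⟩ h
    by_cases ht : (Ξ.translate x).Transverse ω (μ.1 e₀)
    · have hg : ¬ GeneralPosition Δ ω e₀ μ (Ξ.translate x).support := fun hg => h ⟨ht, hg⟩
      rw [GeneralPosition] at hg
      push Not at hg
      obtain ⟨c, ⟨hm, hs⟩, hc⟩ := hg
      have hform : spaceForm ω (Δ e₀) (c.ev e₀) = μ.1 e₀ := by rw [← hm]; rfl
      rcases hs with ⟨v, hv⟩ | hs
      · exact absurd (hv ▸ hform) (ht v)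
      · obtain ⟨ε, hε⟩ := Set.mem_iUnion.1 hs
        obtain ⟨t, -, hx⟩ := (Ξ.translate x).exists_eq_of_mem_carrier hε
        have hδ : latticeForm ω (Δ e₀) (Ξ.edgeSlope ε) ≠ 0 := by
          intro h0
          rw [hx, map_add, map_smul, spaceForm_endIncl] at hform
          change spaceForm ω (Δ e₀) _ + t • ((latticeForm ω (Δ e₀) (Ξ.edgeSlope ε) : ℤ) : ℝ) = _
            at hform
          rw [h0, Int.cast_zero, smul_zero, add_zero] at hform
          exact ht _ hform
        refine ⟨.inr ⟨ε, c.typeClusters e₀, c.exists_notMem_range fun h => hc h.1 h.2⟩,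
          c.mem_preimage hδ μ hm (t := t) ?_⟩
        rw [hx, add_comm x]
        rfl
    · rw [TropicalCurve.Transverse] at ht
      push Not at ht
      obtain ⟨v, hv⟩ := ht
      exact ⟨.inl v, (hAv v μ x).2 hv⟩

end Generic

/-! ### Tropical curves and hyperplanes -/

namespace TropicalCurve

variable {N : Type*} [AddCommGroup N] {n : N} (Ξ : TropicalCurve n) (ω : TwoForm N)

/-- The sum of the negative parts of the values of the form on the slopes of the ends. -/
def negativeDegree : ℕ := (Ξ.degree.map fun s => (-latticeForm ω n s).toNat).sum

theorem negativeDegree_eq :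
    Ξ.negativeDegree ω = ∑ e, (-latticeForm ω n (Ξ.endSlope e)).toNat := by
  rw [negativeDegree, degree, Multiset.map_map]
  rfl

theorem balanced_form (v : Fin Ξ.numVert) :
    (∑ b, if Ξ.src b = v then latticeForm ω n (Ξ.slope b) else 0) -
      (∑ b, if Ξ.tgt b = v then latticeForm ω n (Ξ.slope b) else 0) +
      (∑ e, if Ξ.root e = v then latticeForm ω n (Ξ.endSlope e) else 0) = 0 := by
  classical
  have h := congrArg (spaceForm ω n) (Ξ.balanced v)
  simp only [map_add, map_sub, map_sum, spaceForm_endIncl, map_zero] at h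
  simp only [← Finset.sum_filter]
  have h' : (((∑ b with Ξ.src b = v, latticeForm ω n (Ξ.slope b)) -
      (∑ b with Ξ.tgt b = v, latticeForm ω n (Ξ.slope b)) +
      (∑ e with Ξ.root e = v, latticeForm ω n (Ξ.endSlope e)) : ℤ) : ℝ) = 0 := by
    push_cast
    convert h
  exact_mod_cast h'

variable {ω} {t : ℝ}

theorem spaceForm_tgt (b : Fin Ξ.numBounded) : spaceForm ω n (Ξ.pos (Ξ.tgt b)) =
    spaceForm ω n (Ξ.pos (Ξ.src b)) + Ξ.length b * (latticeForm ω n (Ξ.slope b) : ℝ) := by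
  rw [Ξ.affine, map_add, map_smul, spaceForm_endIncl, smul_eq_mul]

open Classical in
/-- The intersection number of a bounded edge with a hyperplane, in terms of the sides of the
hyperplane on which its vertices lie. -/
theorem bounded_contribution (ht : Ξ.Transverse ω t) (b : Fin Ξ.numBounded) :
    (if ∃ x ∈ Ξ.carrier (.inl b), spaceForm ω n x = t then
        ((latticeForm ω n (Ξ.slope b)).natAbs : ℤ) else 0) =
      (if spaceForm ω n (Ξ.pos (Ξ.src b)) < t then latticeForm ω n (Ξ.slope b) else 0) -
      (if spaceForm ω n (Ξ.pos (Ξ.tgt b)) < t then latticeForm ω n (Ξ.slope b) else 0) := by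
  have hs := ht (Ξ.src b)
  have hg := ht (Ξ.tgt b)
  have hst := Ξ.spaceForm_tgt (ω := ω) b
  have hl := Ξ.length_pos b
  set p := spaceForm ω n (Ξ.pos (Ξ.src b)) with hp
  set q := spaceForm ω n (Ξ.pos (Ξ.tgt b))
  set a := latticeForm ω n (Ξ.slope b) with ha
  set l := Ξ.length b with hl'
  have hex : (∃ x ∈ Ξ.carrier (.inl b), spaceForm ω n x = t) ↔
      ∃ s : ℝ, 0 ≤ s ∧ s ≤ l ∧ p + s * (a : ℝ) = t := by
    constructor
    · rintro ⟨x, ⟨s, h0, h1, rfl⟩, hx⟩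
      rw [map_add, map_smul, spaceForm_endIncl, smul_eq_mul] at hx
      exact ⟨s, h0, h1, hx⟩
    · rintro ⟨s, h0, h1, hx⟩
      refine ⟨_, ⟨s, h0, h1, rfl⟩, ?_⟩
      rw [map_add, map_smul, spaceForm_endIncl, smul_eq_mul]
      exact hx
  have hiff : (∃ x ∈ Ξ.carrier (.inl b), spaceForm ω n x = t) ↔
      (p < t ∧ t < q) ∨ (q < t ∧ t < p) := by
    rw [hex]
    constructor
    · rintro ⟨s, h0, h1, hx⟩
      rcases lt_or_gt_of_ne hs with h | h <;> rcases lt_or_gt_of_ne hg with h' | h'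
      · rcases le_total (a : ℝ) 0 with h2 | h2 <;> nlinarith
      · exact Or.inl ⟨h, h'⟩
      · exact Or.inr ⟨h', h⟩
      · rcases le_total (a : ℝ) 0 with h2 | h2 <;> nlinarith
    · intro h
      have ha0 : (a : ℝ) ≠ 0 := by
        intro h0
        rw [h0, mul_zero, add_zero] at hst
        rcases h with h | h <;> linarith
      refine ⟨(t - p) / a, ?_, ?_, by field_simp; ring⟩
      · rcases h with h | h
        · have : 0 < (a : ℝ) := by
            by_contra h'
            have := mul_nonneg hl.le (neg_nonneg.2 (not_lt.1 h'))
            linarith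
          exact div_nonneg (by linarith) this.le
        · have : (a : ℝ) < 0 := by
            by_contra h'
            have := mul_nonneg hl.le (not_lt.1 h')
            linarith
          exact div_nonneg_of_nonpos (by linarith) this.le
      · rcases h with h | h
        · have : 0 < (a : ℝ) := by
            by_contra h'
            have := mul_nonneg hl.le (neg_nonneg.2 (not_lt.1 h'))
            linarith
          rw [div_le_iff₀ this]
          linarith
        · have : (a : ℝ) < 0 := by
            by_contra h'
            have := mul_nonneg hl.le (not_lt.1 h')
            linarith
          rw [div_le_iff_of_neg this]
          linarith
  rw [if_congr hiff rfl rfl]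
  rcases lt_or_gt_of_ne hs with h | h <;> rcases lt_or_gt_of_ne hg with h' | h'
  · rw [if_neg (by rintro (h | h) <;> linarith [h.1, h.2]), if_pos h, if_pos h', sub_self]
  · rw [if_pos (Or.inl ⟨h, h'⟩), if_pos h, if_neg h'.not_gt, sub_zero]
    have : (0 : ℝ) < a := by
      by_contra h2
      have := mul_nonneg hl.le (neg_nonneg.2 (not_lt.1 h2))
      linarith
    exact Int.natAbs_of_nonneg (by exact_mod_cast this.le)
  · rw [if_pos (Or.inr ⟨h', h⟩), if_neg h.not_gt, if_pos h', zero_sub]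
    have : (a : ℝ) < 0 := by
      by_contra h2
      have := mul_nonneg hl.le (not_lt.1 h2)
      linarith
    exact Int.ofNat_natAbs_of_nonpos (by exact_mod_cast this.le)
  · rw [if_neg (by rintro (h | h) <;> linarith [h.1, h.2]), if_neg h.not_gt, if_neg h'.not_gt,
      sub_self]

open Classical in
/-- The intersection number of an unbounded end with a hyperplane, in terms of the side of the
hyperplane on which its vertex lies. -/
theorem end_contribution (ht : Ξ.Transverse ω t) (e : Fin Ξ.numEnds) :
    (if ∃ x ∈ Ξ.carrier (.inr e), spaceForm ω n x = t then
        ((latticeForm ω n (Ξ.endSlope e)).natAbs : ℤ) else 0) =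
      (if spaceForm ω n (Ξ.pos (Ξ.root e)) < t then latticeForm ω n (Ξ.endSlope e) else 0) +
      ((-latticeForm ω n (Ξ.endSlope e)).toNat : ℤ) := by
  have hs := ht (Ξ.root e)
  set p := spaceForm ω n (Ξ.pos (Ξ.root e)) with hp
  set a := latticeForm ω n (Ξ.endSlope e) with ha
  have hex : (∃ x ∈ Ξ.carrier (.inr e), spaceForm ω n x = t) ↔
      ∃ s : ℝ, 0 ≤ s ∧ p + s * (a : ℝ) = t := by
    constructor
    · rintro ⟨x, ⟨s, h0, rfl⟩, hx⟩
      rw [map_add, map_smul, spaceForm_endIncl, smul_eq_mul] at hx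
      exact ⟨s, h0, hx⟩
    · rintro ⟨s, h0, hx⟩
      refine ⟨_, ⟨s, h0, rfl⟩, ?_⟩
      rw [map_add, map_smul, spaceForm_endIncl, smul_eq_mul]
      exact hx
  have hiff : (∃ x ∈ Ξ.carrier (.inr e), spaceForm ω n x = t) ↔
      (p < t ∧ 0 < a) ∨ (t < p ∧ a < 0) := by
    rw [hex]
    constructor
    · rintro ⟨s, h0, hx⟩
      rcases lt_or_gt_of_ne hs with h | h
      · refine Or.inl ⟨h, ?_⟩
        by_contra h2
        have h3 : (a : ℝ) ≤ 0 := by exact_mod_cast not_lt.1 h2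
        nlinarith
      · refine Or.inr ⟨h, ?_⟩
        by_contra h2
        have h3 : 0 ≤ (a : ℝ) := by exact_mod_cast not_lt.1 h2
        nlinarith
    · intro h
      have ha0 : (a : ℝ) ≠ 0 := Int.cast_ne_zero.2 (by rcases h with h | h <;> omega)
      refine ⟨(t - p) / a, ?_, by field_simp; ring⟩
      rcases h with ⟨h1, h2⟩ | ⟨h1, h2⟩
      · have : 0 < (a : ℝ) := by exact_mod_cast h2
        exact div_nonneg (by linarith) this.le
      · have : (a : ℝ) < 0 := by exact_mod_cast h2
        exact div_nonneg_of_nonpos (by linarith) this.le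
  rw [if_congr hiff rfl rfl]
  rcases lt_or_gt_of_ne hs with h | h
  · have h' := h.not_gt
    simp only [h, h', true_and, false_and, or_false, if_true]
    split_ifs <;> omega
  · have h' := h.not_gt
    simp only [h, h', true_and, false_and, false_or, if_false]
    split_ifs <;> omega

/-- The intersection index with a transverse hyperplane only depends on the degree: by the
balancing condition, the flux through the part of the curve below the hyperplane vanishes. -/
theorem hyperplaneIndex_eq (ht : Ξ.Transverse ω t) :
    Ξ.hyperplaneIndex ω t = Ξ.negativeDegree ω := by
  classical
  rw [← Nat.cast_inj (R := ℤ), hyperplaneIndex, negativeDegree_eq, Finset.sum_filter,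
    Fintype.sum_sum_type]
  have h1 : ∀ b : Fin Ξ.numBounded, _ := Ξ.bounded_contribution ht
  have h2 : ∀ e : Fin Ξ.numEnds, _ := Ξ.end_contribution ht
  simp only [edgeSlope, Sum.elim_inl, Sum.elim_inr]
  have flux : ∑ v with spaceForm ω n (Ξ.pos v) < t,
      ((∑ b, if Ξ.src b = v then latticeForm ω n (Ξ.slope b) else 0) -
      (∑ b, if Ξ.tgt b = v then latticeForm ω n (Ξ.slope b) else 0) +
      (∑ e, if Ξ.root e = v then latticeForm ω n (Ξ.endSlope e) else 0)) = 0 :=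
    Finset.sum_eq_zero fun v _ => Ξ.balanced_form ω v
  have swap : ∀ {k : ℕ} (o : Fin k → Fin Ξ.numVert) (g : Fin k → ℤ),
      ∑ v with spaceForm ω n (Ξ.pos v) < t, ∑ b, (if o b = v then g b else 0) =
        ∑ b, if spaceForm ω n (Ξ.pos (o b)) < t then g b else 0 := fun o g => by
    rw [Finset.sum_comm]
    refine Finset.sum_congr rfl fun b _ => ?_
    rw [Finset.sum_ite_eq]
    simp
  rw [Finset.sum_add_distrib, Finset.sum_sub_distrib, swap, swap, swap] at flux
  have s1 := Finset.sum_congr (s₁ := Finset.univ) rfl fun b _ => h1 b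
  have s2 := Finset.sum_congr (s₁ := Finset.univ) rfl fun e _ => h2 e
  rw [Finset.sum_sub_distrib] at s1
  rw [Finset.sum_add_distrib] at s2
  simp only [Nat.cast_add, Nat.cast_sum, Nat.cast_ite, Nat.cast_zero]
  rw [s1, s2]
  linarith

/-- An edge meets a transverse hyperplane in at most one point. -/
theorem eq_of_mem_carrier (ht : Ξ.Transverse ω t) {ε : Ξ.Edge} {x y : EndSpace n}
    (hx : x ∈ Ξ.carrier ε) (hy : y ∈ Ξ.carrier ε) (hxt : spaceForm ω n x = t)
    (hyt : spaceForm ω n y = t) : x = y := by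
  obtain ⟨s, -, rfl⟩ := Ξ.exists_eq_of_mem_carrier hx
  obtain ⟨s', -, rfl⟩ := Ξ.exists_eq_of_mem_carrier hy
  rw [map_add, map_smul, spaceForm_endIncl, smul_eq_mul] at hxt hyt
  have h0 : (latticeForm ω n (Ξ.edgeSlope ε) : ℝ) ≠ 0 := fun h => by
    rw [h, mul_zero, add_zero] at hxt
    exact ht _ hxt
  have : s = s' := mul_right_cancel₀ h0 (by linarith)
  rw [this]

/-- The intersection of the curve with a transverse hyperplane is finite, and the intersection
index is the sum of the weights of its points. -/
theorem exists_finset_inter (ht : Ξ.Transverse ω t) : ∃ X : Finset (EndSpace n),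
    (∀ x, x ∈ X ↔ x ∈ Ξ.support ∧ spaceForm ω n x = t) ∧
    ∑ x ∈ X, Ξ.slopeWeight ω x = Ξ.negativeDegree ω := by
  classical
  let F : Finset Ξ.Edge := Finset.univ.filter fun ε => ∃ x ∈ Ξ.carrier ε, spaceForm ω n x = t
  have hF : ∀ ε : F, ∃ x ∈ Ξ.carrier ε.1, spaceForm ω n x = t := fun ε =>
    (Finset.mem_filter.1 ε.2).2
  choose pt hpt hpt' using hF
  have hX : ∀ x, x ∈ Finset.univ.image pt ↔ x ∈ Ξ.support ∧ spaceForm ω n x = t := by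
    intro x
    rw [Finset.mem_image]
    constructor
    · rintro ⟨ε, -, rfl⟩
      exact ⟨Or.inr (Set.mem_iUnion.2 ⟨ε.1, hpt ε⟩), hpt' ε⟩
    · rintro ⟨⟨v, rfl⟩ | h, hx⟩
      · exact absurd hx (ht v)
      · obtain ⟨ε, hε⟩ := Set.mem_iUnion.1 h
        let ε' : F := ⟨ε, Finset.mem_filter.2 ⟨Finset.mem_univ _, x, hε, hx⟩⟩
        exact ⟨ε', Finset.mem_univ _, Ξ.eq_of_mem_carrier ht (hpt ε') hε (hpt' ε') hx⟩
  refine ⟨Finset.univ.image pt, hX, ?_⟩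
  rw [← Ξ.hyperplaneIndex_eq ht, hyperplaneIndex]
  simp only [slopeWeight, Finset.sum_filter]
  rw [Finset.sum_comm]
  refine Finset.sum_congr rfl fun ε _ => ?_
  by_cases h : ∃ x ∈ Ξ.carrier ε, spaceForm ω n x = t
  · let ε' : F := ⟨ε, Finset.mem_filter.2 ⟨Finset.mem_univ _, h⟩⟩
    have hm : pt ε' ∈ Finset.univ.image pt := Finset.mem_image_of_mem _ (Finset.mem_univ _)
    rw [if_pos h, Finset.sum_eq_single_of_mem _ hm fun x hx hne => if_neg fun hxε => hne
      (Ξ.eq_of_mem_carrier ht hxε (hpt ε') ((hX x).1 hx).2 (hpt' ε')), if_pos (hpt ε')]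
  · rw [if_neg h]
    exact Finset.sum_eq_zero fun x hx => if_neg fun hxε => h ⟨x, hxε, ((hX x).1 hx).2⟩

end TropicalCurve

end OmegaProblem

end

theorem mainTheorem7 {N : Type*} [AddCommGroup N] [Module.Free ℤ N] [Module.Finite ℤ N]
    (hr : 2 ≤ Module.finrank ℤ N) {E : Type*} [Fintype E] (hE : 3 ≤ Fintype.card E)
    (Δ : E → N) (hΔ : ∀ e, Δ e ≠ 0) (hsum : ∑ e, Δ e = 0)
    (ω : OmegaProblem.TwoForm N) (hω : ∀ e, OmegaProblem.contract ω (Δ e) ≠ 0) (e₀ : E) :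
    ∃ B : OmegaProblem.RefinedRing Δ ω,
      -- `B` is the refined invariant of the problem with a line as constraint
      (∀ δ : OmegaProblem.EndLattice (Δ e₀), OmegaProblem.latticeForm ω (Δ e₀) δ ≠ 0 →
        OmegaProblem.HoldsGenerically
          (fun p : OmegaProblem.momentSpace E × OmegaProblem.EndSpace (Δ e₀) =>
            OmegaProblem.GeneralPosition Δ ω e₀ p.1 (OmegaProblem.line (Δ e₀) p.2 δ)) ∧
        ∀ (μ : OmegaProblem.momentSpace E) (x : OmegaProblem.EndSpace (Δ e₀)),
          OmegaProblem.GeneralPosition Δ ω e₀ μ (OmegaProblem.line (Δ e₀) x δ) →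
          OmegaProblem.HasCount
            (OmegaProblem.Solves ω e₀ μ (OmegaProblem.line (Δ e₀) x δ))
            (fun c => c.refinedMult ω) B) ∧
      -- the problem with a tropical curve as constraint; `d` is its intersection index
      ∀ Ξ : OmegaProblem.TropicalCurve (Δ e₀), ∃ d : ℕ,
        (∀ Ξ' : OmegaProblem.TropicalCurve (Δ e₀), Ξ'.degree = Ξ.degree →
          ∀ t : ℝ, Ξ'.Transverse ω t → Ξ'.hyperplaneIndex ω t = d) ∧
        OmegaProblem.HoldsGenerically
          (fun p : OmegaProblem.momentSpace E × OmegaProblem.EndSpace (Δ e₀) =>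
            OmegaProblem.GenericCurve Δ ω e₀ p.1 (Ξ.translate p.2)) ∧
        ∀ μ : OmegaProblem.momentSpace E, OmegaProblem.GenericCurve Δ ω e₀ μ Ξ →
          OmegaProblem.HasCount
            (OmegaProblem.Solves ω e₀ μ Ξ.support)
            (fun c => Ξ.slopeWeight ω (c.ev e₀) • c.refinedMult ω) (d • B) := by
  classical
  obtain ⟨B, hB⟩ := OmegaProblem.exists_topTreeSum_defect_eq hsum hE ω e₀
  have hform : OmegaProblem.spaceForm ω (Δ e₀) ≠ 0 := fun h => hω e₀ <| LinearMap.ext fun a => by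
    have h1 := OmegaProblem.realContract_incl ω (Δ e₀) a
    have h2 : OmegaProblem.realContract ω (Δ e₀) (OmegaProblem.incl N a) = 0 :=
      congrArg (fun f => f (Submodule.Quotient.mk (OmegaProblem.incl N a))) h
    rw [h2] at h1
    exact_mod_cast h1.symm
  refine ⟨B, fun δ hδ => ⟨OmegaProblem.holdsGenerically_line hδ, fun μ x hgp => ?_⟩, fun Ξ =>
    ⟨Ξ.negativeDegree ω, fun Ξ' hdeg t ht => ?_, OmegaProblem.holdsGenerically_translate hform Ξ,
      fun μ hgen => ?_⟩⟩
  · -- the line meets the hyperplane `ω(n_{e₀}, x) = μ_{e₀}` in a single point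
    have hδ' : (OmegaProblem.latticeForm ω (Δ e₀) δ : ℝ) ≠ 0 := Int.cast_ne_zero.2 hδ
    have hX : ∀ y, y ∈ ({x + ((μ.1 e₀ - OmegaProblem.spaceForm ω (Δ e₀) x) /
        OmegaProblem.latticeForm ω (Δ e₀) δ) • OmegaProblem.endIncl (Δ e₀) δ} :
          Finset (OmegaProblem.EndSpace (Δ e₀))) ↔
        y ∈ OmegaProblem.line (Δ e₀) x δ ∧ OmegaProblem.spaceForm ω (Δ e₀) y = μ.1 e₀ := by
      intro y
      rw [Finset.mem_singleton]
      constructor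
      · rintro rfl
        refine ⟨⟨_, rfl⟩, ?_⟩
        rw [map_add, map_smul, OmegaProblem.spaceForm_endIncl, smul_eq_mul, div_mul_cancel₀ _ hδ']
        ring
      · rintro ⟨⟨t, rfl⟩, h⟩
        rw [map_add, map_smul, OmegaProblem.spaceForm_endIncl, smul_eq_mul] at h
        rw [← h, add_sub_cancel_left, mul_div_cancel_right₀ _ hδ']
    have h := OmegaProblem.hasCount_of_finset hsum hE ω hB μ.2 hgp _ hX fun _ => 1
    simpa only [one_smul, Finset.sum_singleton] using h
  · rw [Ξ'.hyperplaneIndex_eq ht, OmegaProblem.TropicalCurve.negativeDegree, hdeg]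
    rfl
  · obtain ⟨X, hX, hd⟩ := Ξ.exists_finset_inter hgen.1
    rw [← hd]
    exact OmegaProblem.hasCount_of_finset hsum hE ω hB μ.2 hgen.2 X hX _
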